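/- **Conventions.** Manifolds are smooth, finite-dimensional, Hausdorff and second countable. A *family of manifolds* over a manifold $B$ (boundary and corners of $B$ are allowed) is a surjective submersion $\pi:N\to B$ whose fibres $N_t=\pi^{-1}(t)$ are manifolds without boundary: $\pi$ is smooth and surjective, and every point of $N$ has an open neighbourhood that is diffeomorphic over $B$ to an open subset of $\mathbb R^k\times B$ ($k$ fixed). A *complete exact symplectic manifold* is a pair $(X,\theta)$ of a manifold without boundary and a $1$-form such that $d\theta$ is nondegenerate and the Liouville vector field $Z_\theta$, defined by $i_{Z_\theta}d\theta=\theta$, is complete. A *generating Liouville domain* of $(X,\theta)$ is a compact codimension-zero submanifold with boundary $M\subset X$ such that $Z_\theta$ points outward along $\partial M$ and the images of $M$ under the flow of $Z_\theta$ for times $\ge 0$ cover $X$. A *Liouville manifold* is a complete exact symplectic manifold which contains a generating Liouville domain. A *family of Liouville manifolds* $(N_t,\theta_t)_{t\in B}$ is a family of manifolds $N\to B$ with $1$-forms $\theta_t$ on the fibres $N_t$, depending smoothly on $t$, such that each $(N_t,\theta_t)$ is a Liouville manifold. It *locally has families of generating Liouville domains* if every point of $B$ has an open neighbourhood $V$ for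 which there is a codimension-zero submanifold with boundary $M\subset\pi^{-1}(V)$, proper over $V$, such that $M_t=M\cap N_t$ is a generating Liouville domain of $N_t$ for every $t\in V$. The manifold $B$ is *smoothly contractible* if there is a smooth homotopy $B\times[0,1]\to B$ from the identity to a constant map. **Theorem (Moser's lemma for families).** Let $(N_t,\theta_t)_{t\in B}$ be a family of Liouville manifolds which locally has families of generating Liouville domains. Assume that $B$ is smoothly contractible and let $b\in B$. Then there exist a diffeomorphism $\psi:N_b\times B\to N$ over $B$ with $\psi(x,b)=x$ for all $x\in N_b$, and a smooth function $f$ on $N_b\times B$ which vanishes on $N_b\times\{b\}$ and outside some subset $L\subset N_b\times B$ such that $L\to B$ is proper, such that for all $t\in B$ $$\psi_t^*\theta_t+df_t=\theta_b,$$ where $\psi_t:N_b\to N_t$ and $f_t:N_b\to\mathbb R$ are the restrictions of $\psi$ and $f$ to $N_b\times\{t\}$. -/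

import Mathlib

open Set Topology
open scoped Manifold ContDiff

noncomputable section

namespace LiouvilleFamily

/-! ### One-forms, exact symplectic manifolds and Liouville manifolds

Here `X` is a smooth manifold without boundary, with charts in the vector space `E`. -/

section OneForms

variable {E : Type*} [NormedAddCommGroup E] [NormedSpace ℝ E]
  {E' : Type*} [NormedAddCommGroup E'] [NormedSpace ℝ E']
  {X : Type*} [TopologicalSpace X] [ChartedSpace E X]
  {Y : Type*} [TopologicalSpace Y] [ChartedSpace E' Y]

variable (E X) in
/-- A (not necessarily smooth) one-form on `X`: a covector at every point. -/
abbrev OneForm : Type _ := (x : X) → TangentSpace 𝓘(ℝ, E) x →L[ℝ] ℝ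

/-- The pullback `h^*θ` of a one-form. -/
def OneForm.pullback (h : Y → X) (θ : OneForm E X) : OneForm E' Y :=
  fun y => (θ (h y)).comp (mfderiv 𝓘(ℝ, E') 𝓘(ℝ, E) h y)

variable (E) in
/-- The one-form `du` of a function `u`. -/
def OneForm.ofFun (u : X → ℝ) : OneForm E X :=
  fun x => mfderiv 𝓘(ℝ, E) 𝓘(ℝ, ℝ) u x

/-- The coefficients of `θ` in the preferred chart around `x`, i.e. the pullback of `θ` under the
inverse of that chart, as a function from (an open subset of) `E` to the dual of `E`. -/
def OneForm.inChart (θ : OneForm E X) (x : X) : E → (E →L[ℝ] ℝ) :=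
  OneForm.pullback (E' := E) (Y := E) (chartAt E x).symm θ

/-- `θ` is a smooth one-form. -/
def OneForm.IsSmooth (θ : OneForm E X) : Prop :=
  ∀ x : X, ContDiffOn ℝ ∞ (θ.inChart x) (chartAt E x).target

/-- The exterior derivative `dθ` at the point `x`, as a bilinear form:
`dθ (v, w) = D_v η (w) - D_w η (v)` where `η` represents `θ` in the chart around `x`.
(The tangent space at `x` is identified with `E` by the differential of that same chart.) -/
def OneForm.d (θ : OneForm E X) (x : X) (v w : TangentSpace 𝓘(ℝ, E) x) : ℝ :=
  fderiv ℝ (θ.inChart x) (chartAt E x x) v w - fderiv ℝ (θ.inChart x) (chartAt E x x) w v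

/-- `(X, θ)` is an exact symplectic manifold: `θ` is smooth and `dθ` is nondegenerate. -/
structure IsExactSymplectic (θ : OneForm E X) : Prop where
  smooth : θ.IsSmooth
  nondegenerate : ∀ (x : X) (v : TangentSpace 𝓘(ℝ, E) x), (∀ w, θ.d x v w = 0) → v = 0

/-- The Liouville vector field `Z` of an exact symplectic manifold: the unique vector field with
`dθ (Z, w) = θ (w)` for all tangent vectors `w`. -/
def liouvilleField (θ : OneForm E X) (x : X) : TangentSpace 𝓘(ℝ, E) x :=
  Classical.epsilon fun z : TangentSpace 𝓘(ℝ, E) x => ∀ w, θ.d x z w = θ x w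

/-- The Liouville vector field is complete: through every point there passes an integral curve
that is defined for all times. -/
def IsComplete (θ : OneForm E X) : Prop :=
  ∀ x : X, ∃ γ : ℝ → X, IsMIntegralCurve γ (liouvilleField θ) ∧ γ 0 = x

/-- `M` generates `X`: the images of `M` under the Liouville flow for nonnegative times cover `X`,
i.e. every point is reached from `M` along the flow in nonnegative time. -/
def Generates (θ : OneForm E X) (M : Set X) : Prop :=
  ∀ x : X, ∃ γ : ℝ → X, IsMIntegralCurve γ (liouvilleField θ) ∧ γ 0 ∈ M ∧ ∃ s : ℝ, 0 ≤ s ∧ γ s = x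

end OneForms

/-- `g` is a defining function for the set `M` at the boundary point `p`: on an open neighbourhood
`U` of `p` it is smooth and `M ∩ U = {g ≤ 0} ∩ U`, and its differential at `p` is nonzero. -/
def IsDefiningFunctionAt {E H X : Type*} [NormedAddCommGroup E] [NormedSpace ℝ E]
    [TopologicalSpace H] (J : ModelWithCorners ℝ E H) [TopologicalSpace X] [ChartedSpace H X]
    (M : Set X) (p : X) (g : X → ℝ) : Prop :=
  (∃ U : Set X, IsOpen U ∧ p ∈ U ∧ ContMDiffOn J 𝓘(ℝ, ℝ) ∞ g U ∧ ∀ q ∈ U, q ∈ M ↔ g q ≤ 0) ∧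
    mfderiv J 𝓘(ℝ, ℝ) g p ≠ 0

section Liouville

variable {E : Type*} [NormedAddCommGroup E] [NormedSpace ℝ E]
  {X : Type*} [TopologicalSpace X] [ChartedSpace E X]

/-- `M ⊆ X` is a generating Liouville domain of `(X, θ)`: it is a compact submanifold with boundary,
of codimension zero, the Liouville vector field points outward along its boundary,
and `M` generates `X`. -/
structure IsGeneratingLiouvilleDomain (θ : OneForm E X) (M : Set X) : Prop where
  isCompact : IsCompact M
  smooth_boundary : ∀ p ∈ frontier M, ∃ g : X → ℝ, IsDefiningFunctionAt 𝓘(ℝ, E) M p g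
  outward : ∀ p ∈ frontier M, ∀ g : X → ℝ, IsDefiningFunctionAt 𝓘(ℝ, E) M p g →
    0 < OneForm.ofFun E g p (liouvilleField θ p)
  generates : Generates θ M

/-- A Liouville manifold (of finite type): a complete exact symplectic manifold which contains
a generating Liouville domain. -/
structure IsLiouvilleManifold (θ : OneForm E X) : Prop where
  exactSymplectic : IsExactSymplectic θ
  complete : IsComplete θ
  exists_domain : ∃ M : Set X, IsGeneratingLiouvilleDomain θ M

end Liouville

/-! ### Families of manifolds

The base `B` may have boundary and corners (this is governed by the model `I`); the fibres are
manifolds without boundary, with charts in `E`. -/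

section Families

/-- `φ` is a local product chart for `π : N → B`: a diffeomorphism over `B` from an open subset of
`N` onto an open subset of `E × B`. -/
structure IsProductChart {E EB HB EN HN B N : Type*}
    [NormedAddCommGroup E] [NormedSpace ℝ E]
    [NormedAddCommGroup EB] [NormedSpace ℝ EB] [TopologicalSpace HB]
    [NormedAddCommGroup EN] [NormedSpace ℝ EN] [TopologicalSpace HN]
    (I : ModelWithCorners ℝ EB HB) (J : ModelWithCorners ℝ EN HN)
    [TopologicalSpace B] [ChartedSpace HB B] [TopologicalSpace N] [ChartedSpace HN N]
    (π : N → B) (φ : OpenPartialHomeomorph N (E × B)) : Prop where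
  smooth : ContMDiffOn J (𝓘(ℝ, E).prod I) ∞ φ φ.source
  smooth_symm : ContMDiffOn (𝓘(ℝ, E).prod I) J ∞ φ.symm φ.target
  snd_eq : ∀ q ∈ φ.source, (φ q).2 = π q

/-- A family of manifolds without boundary over `B`: a surjective submersion `proj : N → B`, i.e. a
smooth surjective map which around every point of `N` looks like the projection of an open subset
of `E × B` to `B`. -/
structure SmoothFamily (E : Type*) {EB HB EN HN : Type*}
    [NormedAddCommGroup E] [NormedSpace ℝ E]
    [NormedAddCommGroup EB] [NormedSpace ℝ EB] [TopologicalSpace HB]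
    [NormedAddCommGroup EN] [NormedSpace ℝ EN] [TopologicalSpace HN]
    (I : ModelWithCorners ℝ EB HB) (J : ModelWithCorners ℝ EN HN) (N B : Type*)
    [TopologicalSpace B] [ChartedSpace HB B] [TopologicalSpace N] [ChartedSpace HN N] where
  proj : N → B
  smooth : ContMDiff J I ∞ proj
  surjective : Function.Surjective proj
  exists_chart : ∀ p : N, ∃ φ : OpenPartialHomeomorph N (E × B),
    IsProductChart I J proj φ ∧ p ∈ φ.source

variable {E EB HB EN HN B N : Type*}
  [NormedAddCommGroup E] [NormedSpace ℝ E]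
  [NormedAddCommGroup EB] [NormedSpace ℝ EB] [TopologicalSpace HB]
  [NormedAddCommGroup EN] [NormedSpace ℝ EN] [TopologicalSpace HN]
  {I : ModelWithCorners ℝ EB HB} {J : ModelWithCorners ℝ EN HN}
  [TopologicalSpace B] [ChartedSpace HB B] [TopologicalSpace N] [ChartedSpace HN N]

/-- The fibre `N_t = proj⁻¹ {t}` of a family. -/
@[ext]
structure SmoothFamily.Fiber (F : SmoothFamily E I J N B) (t : B) where
  incl : N
  proj_incl : F.proj incl = t

/-- Fibres carry the subspace topology. -/
instance (F : SmoothFamily E I J N B) (t : B) : TopologicalSpace (F.Fiber t) :=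
  TopologicalSpace.induced SmoothFamily.Fiber.incl inferInstance

theorem SmoothFamily.Fiber.isInducing_incl (F : SmoothFamily E I J N B) (t : B) :
    IsInducing (SmoothFamily.Fiber.incl : F.Fiber t → N) := ⟨rfl⟩

instance (F : SmoothFamily E I J N B) (t : B) : Nonempty (F.Fiber t) :=
  let ⟨q, hq⟩ := F.surjective t
  ⟨⟨q, hq⟩⟩

theorem IsProductChart.proj_symm {π : N → B} {φ : OpenPartialHomeomorph N (E × B)}
    (hφ : IsProductChart I J π φ) {z : E × B} (hz : z ∈ φ.target) : π (φ.symm z) = z.2 := by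
  rw [← hφ.snd_eq _ (φ.map_target hz), φ.right_inv hz]

theorem IsProductChart.apply_incl {F : SmoothFamily E I J N B}
    {φ : OpenPartialHomeomorph N (E × B)} (hφ : IsProductChart I J F.proj φ) {t : B}
    {x : F.Fiber t} (hx : x.incl ∈ φ.source) : φ x.incl = ((φ x.incl).1, t) :=
  Prod.ext rfl ((hφ.snd_eq _ hx).trans x.proj_incl)

open Classical in
/-- The map `e ↦ φ⁻¹ (e, t)` into the fibre `N_t`, where `φ` is a local product chart
(with an arbitrary value if `(e, t)` is not in the range of `φ`). -/
def SmoothFamily.fiberParam (F : SmoothFamily E I J N B) (φ : OpenPartialHomeomorph N (E × B))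
    (hφ : IsProductChart I J F.proj φ) (t : B) (e : E) : F.Fiber t :=
  if h : (e, t) ∈ φ.target then ⟨φ.symm (e, t), hφ.proj_symm h⟩ else Classical.arbitrary _

theorem SmoothFamily.incl_fiberParam (F : SmoothFamily E I J N B)
    (φ : OpenPartialHomeomorph N (E × B)) (hφ : IsProductChart I J F.proj φ) {t : B} {e : E}
    (h : (e, t) ∈ φ.target) : (F.fiberParam φ hφ t e).incl = φ.symm (e, t) := by
  rw [SmoothFamily.fiberParam, dif_pos h]

/-- The chart of the fibre `N_t` which a local product chart `φ` of the family induces: it sends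
`x` to the `E`-component of `φ x`, and its inverse sends `e` to `φ⁻¹ (e, t)`. -/
def SmoothFamily.fiberChart (F : SmoothFamily E I J N B) (φ : OpenPartialHomeomorph N (E × B))
    (hφ : IsProductChart I J F.proj φ) (t : B) : OpenPartialHomeomorph (F.Fiber t) E where
  toFun x := (φ x.incl).1
  invFun := F.fiberParam φ hφ t
  source := {x | x.incl ∈ φ.source}
  target := {e | (e, t) ∈ φ.target}
  map_source' x hx := by
    have h := φ.map_source hx
    rw [hφ.apply_incl hx] at h
    exact h
  map_target' e he := by
    change (F.fiberParam φ hφ t e).incl ∈ φ.source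
    rw [F.incl_fiberParam φ hφ he]
    exact φ.map_target he
  left_inv' x hx := by
    have h := φ.map_source hx
    rw [hφ.apply_incl hx] at h
    apply SmoothFamily.Fiber.ext
    rw [F.incl_fiberParam φ hφ h, ← hφ.apply_incl hx]
    exact φ.left_inv hx
  right_inv' e he := by
    rw [F.incl_fiberParam φ hφ he, φ.right_inv he]
  open_source := φ.open_source.preimage (SmoothFamily.Fiber.isInducing_incl F t).continuous
  open_target := φ.open_target.preimage (by fun_prop : Continuous fun e : E => (e, t))
  continuousOn_toFun :=
    continuous_fst.comp_continuousOn (φ.continuousOn.comp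
      (SmoothFamily.Fiber.isInducing_incl F t).continuous.continuousOn fun _ hx => hx)
  continuousOn_invFun := by
    rw [(SmoothFamily.Fiber.isInducing_incl F t).continuousOn_iff]
    have h : ContinuousOn (fun e : E => φ.symm (e, t)) {e | (e, t) ∈ φ.target} :=
      φ.symm.continuousOn.comp (by fun_prop : Continuous fun e : E => (e, t)).continuousOn
        fun _ he => he
    exact h.congr fun e he => F.incl_fiberParam φ hφ he

/-- The fibre `N_t` with the charts induced by the local product charts of the family. -/
instance SmoothFamily.chartedSpaceFiber (F : SmoothFamily E I J N B) (t : B) :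
    ChartedSpace E (F.Fiber t) where
  atlas := {c | ∃ φ, ∃ hφ : IsProductChart I J F.proj φ, c = F.fiberChart φ hφ t}
  chartAt x := F.fiberChart _ (F.exists_chart x.incl).choose_spec.1 t
  mem_chart_source x := (F.exists_chart x.incl).choose_spec.2
  chart_mem_atlas _ := ⟨_, _, rfl⟩

/-- The fibres are smooth manifolds. -/
instance SmoothFamily.isManifoldFiber (F : SmoothFamily E I J N B) (t : B) :
    IsManifold 𝓘(ℝ, E) ∞ (F.Fiber t) := by
  apply isManifold_of_contDiffOn
  rintro _ _ ⟨φ, hφ, rfl⟩ ⟨φ', hφ', rfl⟩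
  rw [← contMDiffOn_iff_contDiffOn]
  have hs : ∀ e, e ∈ ((F.fiberChart φ hφ t).symm ≫ₕ F.fiberChart φ' hφ' t).source →
      (e, t) ∈ φ.target ∧ φ.symm (e, t) ∈ φ'.source := by
    intro e he
    rw [OpenPartialHomeomorph.trans_source] at he
    have h1 : (e, t) ∈ φ.target := he.1
    refine ⟨h1, ?_⟩
    have h2 : (F.fiberParam φ hφ t e).incl ∈ φ'.source := he.2
    rwa [F.incl_fiberParam φ hφ h1] at h2
  have key : ContMDiffOn 𝓘(ℝ, E) 𝓘(ℝ, E) ∞ (fun e : E => (φ' (φ.symm (e, t))).1)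
      ((F.fiberChart φ hφ t).symm ≫ₕ F.fiberChart φ' hφ' t).source := by
    have h1 : ContMDiffOn 𝓘(ℝ, E) (𝓘(ℝ, E).prod I) ∞ (fun e : E => (e, t))
        ((F.fiberChart φ hφ t).symm ≫ₕ F.fiberChart φ' hφ' t).source :=
      (contMDiff_id.prodMk contMDiff_const).contMDiffOn
    have h2 := hφ.smooth_symm.comp h1 fun e he => (hs e he).1
    have h3 := hφ'.smooth.comp h2 fun e he => (hs e he).2
    exact contMDiff_fst.comp_contMDiffOn h3
  refine (key.mono ?_).congr ?_
  · intro e he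
    simpa using he
  · intro e he
    have he' : e ∈ ((F.fiberChart φ hφ t).symm ≫ₕ F.fiberChart φ' hφ' t).source := by
      simpa using he
    change (φ' (F.fiberParam φ hφ t e).incl).1 = _
    rw [F.incl_fiberParam φ hφ (hs e he').1]

/-- A family of one-forms `θ_t` on the fibres `N_t`, `t ∈ B`. -/
abbrev SmoothFamily.OneForms (F : SmoothFamily E I J N B) : Type _ :=
  (t : B) → OneForm E (F.Fiber t)

/-- The coefficients of the forms `θ_t` in a local product chart `φ`: at `(e, t)` the value is the
covector on `E` obtained by pulling back `θ_t` under the map `e ↦ φ⁻¹ (e, t)`. -/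
def SmoothFamily.OneForms.inChart {F : SmoothFamily E I J N B} (θ : F.OneForms)
    (φ : OpenPartialHomeomorph N (E × B)) (hφ : IsProductChart I J F.proj φ) (z : E × B) :
    E →L[ℝ] ℝ :=
  OneForm.pullback (E' := E) (Y := E) (F.fiberParam φ hφ z.2) (θ z.2) z.1

/-- The one-forms `θ_t` depend smoothly on `t`, jointly with the point of the fibre: in every local
product chart their coefficients are smooth on an open subset of `E × B`. -/
def SmoothFamily.OneForms.IsSmooth {F : SmoothFamily E I J N B} (θ : F.OneForms) : Prop :=
  ∀ (φ : OpenPartialHomeomorph N (E × B)) (hφ : IsProductChart I J F.proj φ),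
    ContMDiffOn (𝓘(ℝ, E).prod I) 𝓘(ℝ, E →L[ℝ] ℝ) ∞
      (SmoothFamily.OneForms.inChart θ φ hφ) φ.target

/-- `(N_t, θ_t)` is a family of Liouville manifolds. -/
structure SmoothFamily.IsLiouvilleFamily (F : SmoothFamily E I J N B) (θ : F.OneForms) :
    Prop where
  smooth : SmoothFamily.OneForms.IsSmooth θ
  isLiouvilleManifold : ∀ t : B, IsLiouvilleManifold (θ t)

/-- The map `π : M → V` is proper: compact subsets of `V` have compact preimage in `M`. -/
def ProperOver {A C : Type*} [TopologicalSpace A] [TopologicalSpace C] (π : A → C) (M : Set A)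
    (V : Set C) : Prop :=
  MapsTo π M V ∧ ∀ K ⊆ V, IsCompact K → IsCompact (M ∩ π ⁻¹' K)

/-- `M` is a family of generating Liouville domains over the open set `V ⊆ B`: it is a submanifold
with boundary, of codimension zero, of the part of `N` over `V`, it is proper over `V`, and
`M_t = M ∩ N_t` is a generating Liouville domain of `N_t` for all `t ∈ V`.
(The boundary of `M` need not be submersive over `V`.) -/
structure SmoothFamily.IsFamilyOfGeneratingDomains (F : SmoothFamily E I J N B) (θ : F.OneForms)
    (V : Set B) (M : Set N) : Prop where
  proper : ProperOver F.proj M V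
  smooth_boundary : ∀ p ∈ frontier M, F.proj p ∈ V → ∃ g : N → ℝ, IsDefiningFunctionAt J M p g
  isGeneratingLiouvilleDomain : ∀ t ∈ V,
    IsGeneratingLiouvilleDomain (θ t) {x : F.Fiber t | x.incl ∈ M}

/-- Families of generating Liouville domains exist locally over the base. -/
def SmoothFamily.LocallyHasGeneratingDomains (F : SmoothFamily E I J N B) (θ : F.OneForms) :
    Prop :=
  ∀ t : B, ∃ V : Set B, IsOpen V ∧ t ∈ V ∧ ∃ M : Set N, F.IsFamilyOfGeneratingDomains θ V M

/-- For `Ψ : N_b × B → N` over `B`, the map `Ψ_t : N_b → N_t`. -/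
def SmoothFamily.fiberMap (F : SmoothFamily E I J N B) {b : B} (Ψ : F.Fiber b × B → N)
    (hΨ : ∀ x t, F.proj (Ψ (x, t)) = t) (t : B) : F.Fiber b → F.Fiber t :=
  fun x => ⟨Ψ (x, t), hΨ x t⟩

end Families

/-- `B` is smoothly contractible: there is a smooth homotopy `B × [0,1] → B` from the identity to a
constant map. -/
def SmoothlyContractible {EB HB : Type*} [NormedAddCommGroup EB] [NormedSpace ℝ EB]
    [TopologicalSpace HB] (I : ModelWithCorners ℝ EB HB) (B : Type*)
    [TopologicalSpace B] [ChartedSpace HB B] : Prop :=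
  ∃ (c : B) (h : B × ℝ → B),
    ContMDiffOn (I.prod 𝓘(ℝ, ℝ)) I ∞ h (univ ×ˢ Icc (0 : ℝ) 1) ∧
      (∀ t, h (t, 0) = t) ∧ ∀ t, h (t, 1) = c

end LiouvilleFamily

end

/-!
Choose a smooth contraction `h : B × ℝ → B` with `h (t, 0) = t` and `h (t, 1) = a`. The forms `θ_t`
define a one-form along the fibres of the pull-back of `N → B` under `h`. For fixed `t` it is
extended to a one-form `Θ` on the pull-back of `N` to the line of the variable `s`: `extForm`, where
the coefficient of `ds` is glued from product charts with a partition of unity, plus a free function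
`κ`. Since `dΘ` is nondegenerate on the fibres, there is a unique vector field `ξ` over `∂/∂s` in
the kernel of `dΘ` (`kernelLift`). The one-forms change along the flow of `ξ` by the differential of
the integral of the function `Θ(ξ)`, the *energy* (`pullback_add_ofFun`), because `L_ξ Θ = d(Θ(ξ)) +
i_ξ dΘ`. Hence parallel transport from `N_t` to `N_a` and from there to `N_b` trivializes the family
as required, if `ξ` is complete and the energy has proper support.

The energy of `Θ` with the correction `κ` is that without it plus `κ - Z κ`, where `Z` is the
Liouville field (`energy_eq_add`). Let `χ` be a function which equals one outside a set that is
proper over `B`, and which vanishes far back along every Liouville flow line; it exists by the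
families of generating Liouville domains (`exists_cutoff`). Integration along the backward flow
lines of `Z` solves `Z κ = κ + χ • energy₀` (`fderiv_backwardIntegral`). With this `κ` the energy is
`(1 - χ) • energy₀`, and has proper support (`exists_hasProperSupport_energy`).

Where the energy vanishes, `Θ` is `i_Z dΘ`, and so `ξ` commutes with `Z`. A *trap* is a compact set,
over an open subset of `B`, which the backward Liouville flow does not leave and which all of its
flow lines reach (`IsTrap`). Outside a trap that contains the support of the energy, the Liouville
flow maps integral curves of `ξ` to integral curves (`isIntegralAt_liouvilleFlow`). Every point is
the image under this flow of a point in a fixed compact set, so integral curves of `ξ` exist for a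
uniform time near each time (`exists_integralCurve_kernelLift`), and `ξ` is complete.

The base may have corners, so that integral curves are solutions of ordinary differential equations
with parameters in a manifold with corners. Their smooth dependence on the parameters is proved by
applying an existence theorem on a set that is convex in the parameters to the tangent equation
(`exists_contDiffOn_timeOne`). Lifts, forms and curves are described by their coefficients in the
product charts of `N`, which avoids the total space of the pull-back as a manifold.
-/

noncomputable section

set_option linter.unusedSectionVars false

namespace LiouvilleFamily

open Metric Filter
open scoped NNReal

/-! ### Smooth dependence of ordinary differential equations on parameters in a convex set -/

section ODEDependence

variable {X P : Type*} [NormedAddCommGroup X] [NormedSpace ℝ X]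
  [NormedAddCommGroup P] [NormedSpace ℝ P]

/-- `γ` solves the autonomous equation `γ' = v (γ, p)` on `[0, 1]`, starts at `x` and stays
in `C`. -/
structure IsUnitSol (v : X × P → X) (C : Set X) (p : P) (x : X) (γ : ℝ → X) : Prop where
  start : γ 0 = x
  mem : ∀ r ∈ Icc (0 : ℝ) 1, γ r ∈ C
  deriv : ∀ r ∈ Icc (0 : ℝ) 1, HasDerivWithinAt γ (v (γ r, p)) (Icc 0 1) r

theorem IsUnitSol.continuousOn {v : X × P → X} {C : Set X} {p : P} {x : X} {γ : ℝ → X}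
    (h : IsUnitSol v C p x γ) : ContinuousOn γ (Icc 0 1) :=
  fun r hr => (h.deriv r hr).continuousWithinAt

theorem hasDerivWithinAt_Ici_of_Icc {γ : ℝ → X} {γ' : X} {r : ℝ} (hr : r ∈ Ico (0 : ℝ) 1)
    (h : HasDerivWithinAt γ γ' (Icc 0 1) r) : HasDerivWithinAt γ γ' (Ici r) r :=
  h.mono_of_mem_nhdsWithin (Icc_mem_nhdsGE_of_mem hr)

/-- The compact convex piece of the domain `univ × S` around `z` on which all estimates are
made. -/
def cornerBall (S : Set P) (z : X × P) (R : ℝ) : Set (X × P) := closedBall z R ∩ univ ×ˢ S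

theorem convex_cornerBall {S : Set P} (hS : Convex ℝ S) (z : X × P) (R : ℝ) :
    Convex ℝ (cornerBall S z R) :=
  (convex_closedBall z R).inter (convex_univ.prod hS)

theorem isCompact_cornerBall [FiniteDimensional ℝ X] [FiniteDimensional ℝ P] {S : Set P}
    (hS : IsClosed S) (z : X × P) (R : ℝ) : IsCompact (cornerBall S z R) := by
  have : ProperSpace (X × P) := FiniteDimensional.proper_real _
  exact (isCompact_closedBall z R).inter_right (isClosed_univ.prod hS)

theorem mem_cornerBall {S : Set P} {z : X × P} {R : ℝ} {x : X} {p : P} :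
    (x, p) ∈ cornerBall S z R ↔ x ∈ closedBall z.1 R ∧ p ∈ closedBall z.2 R ∧ p ∈ S := by
  simp [cornerBall, Prod.dist_eq, and_assoc]

theorem uniqueDiffOn_inter_univ_prod {U : Set (X × P)} {S : Set P} (hU : IsOpen U)
    (hS : UniqueDiffOn ℝ S) : UniqueDiffOn ℝ (U ∩ univ ×ˢ S) := by
  rw [inter_comm]
  exact (uniqueDiffOn_univ.prod hS).inter hU

theorem hasFDerivWithinAt_of_contDiffOn {Y : Type*} [NormedAddCommGroup Y] [NormedSpace ℝ Y]
    {v : X → Y} {D : Set X} (hv : ContDiffOn ℝ ∞ v D) {z : X} (hz : z ∈ D) :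
    HasFDerivWithinAt v (fderivWithin ℝ v D z) D z :=
  (hv.differentiableOn (by simp) z hz).hasFDerivWithinAt

/-- A Lipschitz constant which also bounds the derivative; that it is at least one makes later
divisions by it harmless. -/
theorem exists_lipschitzOnWith_of_isCompact_convex {Y : Type*} [NormedAddCommGroup Y]
    [NormedSpace ℝ Y] {v : X → Y} {D K : Set X} (hv : ContDiffOn ℝ ∞ v D)
    (hD : UniqueDiffOn ℝ D) (hK : IsCompact K) (hKc : Convex ℝ K) (hKD : K ⊆ D) :
    ∃ C : ℝ≥0, 1 ≤ C ∧ LipschitzOnWith C v K ∧ ∀ z ∈ K, ‖fderivWithin ℝ v D z‖ ≤ C := by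
  have hc : ContinuousOn (fderivWithin ℝ v D) K :=
    (hv.continuousOn_fderivWithin hD (by simp)).mono hKD
  obtain ⟨C, hC⟩ := hK.exists_bound_of_continuousOn hc
  refine ⟨max 1 C.toNNReal, le_max_left _ _, ?_, fun z hz => (hC z hz).trans ?_⟩
  · refine hKc.lipschitzOnWith_of_nnnorm_hasFDerivWithin_le
      (fun z hz => (hasFDerivWithinAt_of_contDiffOn hv (hKD hz)).mono hKD) fun z hz => ?_
    rw [← NNReal.coe_le_coe, coe_nnnorm]
    exact (hC z hz).trans ((Real.le_coe_toNNReal C).trans (by simp))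
  · exact (Real.le_coe_toNNReal C).trans (by simp)

/-- A field which vanishes at the parameter `z₀.2` has, for nearby parameters, solutions up to
time one. The fields in question are `c • v` with the length `c` of the time interval among the
parameters, and `c = 0` at `z₀.2`. -/
theorem exists_isUnitSol [FiniteDimensional ℝ X] [FiniteDimensional ℝ P]
    {v : X × P → X} {U : Set (X × P)} {S : Set P} (hU : IsOpen U) (hSc : IsClosed S)
    (hSv : Convex ℝ S) (hSu : UniqueDiffOn ℝ S) (hv : ContDiffOn ℝ ∞ v (U ∩ univ ×ˢ S))
    {z₀ : X × P} (hz₀ : z₀.2 ∈ S) (h0 : ∀ x, (x, z₀.2) ∈ U → v (x, z₀.2) = 0)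
    {R : ℝ} (hR : 0 < R) (hRU : closedBall z₀ R ⊆ U) :
    ∃ W ∈ 𝓝 z₀, ∀ z ∈ W, z.2 ∈ S → z.2 ∈ closedBall z₀.2 R ∧
      ∃ γ, IsUnitSol v (closedBall z₀.1 R) z.2 z.1 γ := by
  have : CompleteSpace X := FiniteDimensional.complete ℝ X
  have hKD : cornerBall S z₀ R ⊆ U ∩ univ ×ˢ S := inter_subset_inter_left _ hRU
  obtain ⟨C, hC1, hC, -⟩ := exists_lipschitzOnWith_of_isCompact_convex hv
    (uniqueDiffOn_inter_univ_prod hU hSu) (isCompact_cornerBall hSc z₀ R)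
    (convex_cornerBall hSv z₀ R) hKD
  -- for parameters within `R / (2 * C)` of `z₀.2` the field is bounded by `R / 2`
  set ρ : ℝ := R / (2 * C) with hρ
  have hC0 : (0 : ℝ) < C := lt_of_lt_of_le one_pos (by exact_mod_cast hC1)
  have hC1' : (1 : ℝ) ≤ C := by exact_mod_cast hC1
  have hρ0 : 0 < ρ := by positivity
  have hρR : ρ ≤ R / 2 := by
    rw [hρ]; gcongr; linarith
  refine ⟨closedBall z₀ ρ, closedBall_mem_nhds _ hρ0, fun z hz hzS => ?_⟩
  have hz' : dist z.1 z₀.1 ≤ ρ ∧ dist z.2 z₀.2 ≤ ρ := by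
    simpa [Prod.dist_eq] using hz
  have hz2 : z.2 ∈ closedBall z₀.2 R := by
    rw [mem_closedBall]; linarith [hz'.2]
  refine ⟨hz2, ?_⟩
  have hmem : ∀ x ∈ closedBall z₀.1 R, (x, z.2) ∈ cornerBall S z₀ R := fun x hx =>
    mem_cornerBall.2 ⟨hx, hz2, hzS⟩
  have hbound : ∀ x ∈ closedBall z₀.1 R, ‖v (x, z.2)‖ ≤ R / 2 := by
    intro x hx
    have hx0 : (x, z₀.2) ∈ cornerBall S z₀ R :=
      mem_cornerBall.2 ⟨hx, mem_closedBall_self hR.le, hz₀⟩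
    have h1 := hC.dist_le_mul _ (hmem x hx) _ hx0
    rw [h0 x (hKD hx0).1, dist_zero_right] at h1
    refine h1.trans ?_
    have h2 : dist (x, z.2) (x, z₀.2) ≤ ρ := by
      simpa [Prod.dist_eq, hρ0.le] using hz'.2
    calc (C : ℝ) * dist (x, z.2) (x, z₀.2) ≤ C * ρ := by gcongr
      _ = R / 2 := by rw [hρ]; field_simp
  have hpl : IsPicardLindelof (fun _ : ℝ => fun x => v (x, z.2))
      (⟨0, by simp⟩ : Icc (0 : ℝ) 1) z₀.1 R.toNNReal (R / 2).toNNReal (R / 2).toNNReal C := by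
    apply IsPicardLindelof.of_time_independent
    · intro x hx
      rw [Real.coe_toNNReal _ hR.le] at hx
      rw [Real.coe_toNNReal _ (by positivity)]
      exact hbound x hx
    · rw [Real.coe_toNNReal _ hR.le]
      refine LipschitzOnWith.of_dist_le_mul fun x hx y hy => ?_
      have := hC.dist_le_mul _ (hmem x hx) _ (hmem y hy)
      simpa [Prod.dist_eq] using this
    · rw [Real.coe_toNNReal _ hR.le, Real.coe_toNNReal _ (by positivity)]
      norm_num
      linarith
  have hx : z.1 ∈ closedBall z₀.1 ((R / 2).toNNReal : ℝ) := by
    rw [Real.coe_toNNReal _ (by positivity), mem_closedBall]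
    exact hz'.1.trans hρR
  obtain ⟨α, hα⟩ := ODE.FunSpace.exists_isFixedPt_next hpl hx
  refine ⟨α.compProj, ?_, fun r hr => ?_, fun r hr => ?_⟩
  · have := ODE.FunSpace.compProj_val (α := α) (t := ⟨0, by simp⟩)
    rw [← hα, ODE.FunSpace.next_apply₀] at this
    rw [← hα]
    exact this
  · have := α.compProj_mem_closedBall hpl.mul_max_le (t := r)
    rwa [Real.coe_toNNReal _ hR.le] at this
  · apply ODE.hasDerivWithinAt_picard_Icc (f := fun _ : ℝ => fun x => v (x, z.2))
      (u := closedBall z₀.1 (R.toNNReal : ℝ)) (t₀ := 0) (by simp) hpl.continuousOn_uncurry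
      α.continuous_compProj.continuousOn (fun _ ht' ↦ α.compProj_mem_closedBall hpl.mul_max_le)
      z.1 hr |>.congr_of_mem _ hr
    intro t' ht'
    nth_rw 1 [← hα]
    rw [ODE.FunSpace.compProj_of_mem ht', ODE.FunSpace.next_apply]

/-- Grönwall's inequality for solutions with different initial values and different parameters: the
parameter is treated as a constant component of the solution. -/
theorem IsUnitSol.dist_le {v : X × P → X} {S : Set P} {z₀ : X × P} {R : ℝ} {C : ℝ≥0}
    (hC : LipschitzOnWith C v (cornerBall S z₀ R)) {z z' : X × P} {γ γ' : ℝ → X}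
    (hz : z.2 ∈ closedBall z₀.2 R) (hzS : z.2 ∈ S) (hz' : z'.2 ∈ closedBall z₀.2 R)
    (hzS' : z'.2 ∈ S) (hγ : IsUnitSol v (closedBall z₀.1 R) z.2 z.1 γ)
    (hγ' : IsUnitSol v (closedBall z₀.1 R) z'.2 z'.1 γ') {r : ℝ} (hr : r ∈ Icc (0 : ℝ) 1) :
    dist (γ r, z.2) (γ' r, z'.2) ≤ dist z z' * Real.exp C := by
  have key := dist_le_of_trajectories_ODE_of_mem (E := X × P) (a := 0) (b := 1)
    (v := fun _ w => (v w, 0)) (s := fun _ => cornerBall S z₀ R) (K := C)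
    (f := fun r => (γ r, z.2)) (g := fun r => (γ' r, z'.2)) (δ := dist z z')
    (fun t _ => LipschitzOnWith.of_dist_le_mul fun a ha b hb => by
      simpa [Prod.dist_eq] using hC.dist_le_mul a ha b hb)
    (hγ.continuousOn.prodMk continuousOn_const)
    (fun t ht => (hasDerivWithinAt_Ici_of_Icc ht
      (hγ.deriv t (Ico_subset_Icc_self ht))).prodMk (hasDerivWithinAt_const _ _ _))
    (fun t ht => mem_cornerBall.2 ⟨hγ.mem t (Ico_subset_Icc_self ht), hz, hzS⟩)
    (hγ'.continuousOn.prodMk continuousOn_const)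
    (fun t ht => (hasDerivWithinAt_Ici_of_Icc ht
      (hγ'.deriv t (Ico_subset_Icc_self ht))).prodMk (hasDerivWithinAt_const _ _ _))
    (fun t ht => mem_cornerBall.2 ⟨hγ'.mem t (Ico_subset_Icc_self ht), hz', hzS'⟩)
    (by simp [hγ.start, hγ'.start]) r hr
  refine key.trans ?_
  gcongr
  have : (0 : ℝ) ≤ C := C.2
  nlinarith [hr.2]

/-- The tangent lift of the field `v`: solutions of the lifted equation are solutions of the
original one together with their variations. -/
def tangentField (v : X × P → X) (D : Set (X × P)) (q : (X × X) × (P × P)) : X × X :=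
  (v (q.1.1, q.2.1), fderivWithin ℝ v D (q.1.1, q.2.1) (q.1.2, q.2.2))

theorem contDiffOn_tangentField {v : X × P → X} {U : Set (X × P)} {S : Set P} (hU : IsOpen U)
    (hSu : UniqueDiffOn ℝ S) (hv : ContDiffOn ℝ ∞ v (U ∩ univ ×ˢ S)) :
    ContDiffOn ℝ ∞ (tangentField v (U ∩ univ ×ˢ S))
      ({q : (X × X) × (P × P) | (q.1.1, q.2.1) ∈ U} ∩ univ ×ˢ (S ×ˢ univ)) := by
  have hpr : ContDiff ℝ ∞ fun q : (X × X) × (P × P) => (q.1.1, q.2.1) := by fun_prop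
  have hmaps : MapsTo (fun q : (X × X) × (P × P) => (q.1.1, q.2.1))
      ({q : (X × X) × (P × P) | (q.1.1, q.2.1) ∈ U} ∩ univ ×ˢ (S ×ˢ univ))
      (U ∩ univ ×ˢ S) := fun q hq => ⟨hq.1, trivial, hq.2.2.1⟩
  refine (hv.comp hpr.contDiffOn hmaps).prodMk ?_
  have h1 : ContDiffOn ℝ ∞ (fderivWithin ℝ v (U ∩ univ ×ˢ S)) (U ∩ univ ×ˢ S) :=
    hv.fderivWithin (uniqueDiffOn_inter_univ_prod hU hSu) (by simp)
  exact (h1.comp hpr.contDiffOn hmaps).clm_apply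
    (by fun_prop : ContDiff ℝ ∞ fun q : (X × X) × (P × P) => (q.1.2, q.2.2)).contDiffOn

/-- With `v` its tangent lift vanishes at the parameter `p`, which is what the induction on the
order of differentiability needs. -/
theorem fderivWithin_apply_eq_zero {v : X × P → X} {U : Set (X × P)} {S : Set P} (hU : IsOpen U)
    (hv : ContDiffOn ℝ ∞ v (U ∩ univ ×ˢ S)) {p : P} (hp : p ∈ S)
    (h0 : ∀ x, (x, p) ∈ U → v (x, p) = 0) {x : X} (hx : (x, p) ∈ U) (ξ : X) :
    fderivWithin ℝ v (U ∩ univ ×ˢ S) (x, p) (ξ, 0) = 0 := by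
  have h1 : HasFDerivWithinAt v (fderivWithin ℝ v (U ∩ univ ×ˢ S) (x, p)) (U ∩ univ ×ˢ S)
      (x, p) := hasFDerivWithinAt_of_contDiffOn hv ⟨hx, trivial, hp⟩
  have hev : ∀ᶠ y in 𝓝 x, (y, p) ∈ U :=
    (by fun_prop : Continuous fun y : X => (y, p)).continuousAt.eventually (hU.mem_nhds hx)
  have h2 := h1.comp (f := fun y : X => (y, p)) (s := {y | (y, p) ∈ U}) x
    (hasFDerivAt_prodMk_left x p).hasFDerivWithinAt (fun y hy => ⟨hy, trivial, hp⟩)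
  have h3 := h2.hasFDerivAt hev
  have h4 : HasFDerivAt (v ∘ fun y : X => (y, p)) (0 : X →L[ℝ] X) x := by
    refine (hasFDerivAt_const (0 : X) x).congr_of_eventuallyEq ?_
    filter_upwards [hev] with y hy using h0 y hy
  have := congrArg (fun A : X →L[ℝ] X => A ξ) (h3.unique h4)
  simpa using this

/-- A first-order Taylor estimate which is uniform on a compact convex set. -/
theorem exists_norm_sub_sub_le {Y : Type*} [NormedAddCommGroup Y]
    [NormedSpace ℝ Y] {v : X → Y} {D K : Set X} (hv : ContDiffOn ℝ ∞ v D)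
    (hD : UniqueDiffOn ℝ D) (hK : IsCompact K) (hKc : Convex ℝ K) (hKD : K ⊆ D)
    {δ : ℝ} (hδ : 0 < δ) :
    ∃ ρ > 0, ∀ a ∈ K, ∀ b ∈ K, dist b a < ρ →
      ‖v b - v a - fderivWithin ℝ v D a (b - a)‖ ≤ δ * ‖b - a‖ := by
  have hc : ContinuousOn (fderivWithin ℝ v D) K :=
    (hv.continuousOn_fderivWithin hD (by simp)).mono hKD
  have hu := hK.uniformContinuousOn_of_continuous hc
  obtain ⟨ρ, hρ, h⟩ := Metric.uniformContinuousOn_iff.1 hu δ hδ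
  refine ⟨ρ, hρ, fun a ha b hb hab => ?_⟩
  refine Convex.norm_image_sub_le_of_norm_hasFDerivWithin_le' (s := K ∩ ball a ρ)
    (f' := fderivWithin ℝ v D)
    (fun x hx => (hasFDerivWithinAt_of_contDiffOn hv (hKD hx.1)).mono
      (inter_subset_left.trans hKD)) (fun x hx => ?_) (hKc.inter (convex_ball a ρ))
    ⟨ha, mem_ball_self hρ⟩ ⟨hb, hab⟩
  rw [← dist_eq_norm]
  exact (h x hx.1 a ha hx.2).le

end ODEDependence

universe u w

/-- Smooth dependence on initial values and parameters, where the parameter ranges over a closed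
convex set. The proof is by induction on the order of differentiability: the derivative of the
time-one map is the time-one map of the tangent lift of the field. -/
theorem exists_contDiffOn_timeOne (n : ℕ) : ∀ {X : Type u} {P : Type w} [NormedAddCommGroup X]
    [NormedSpace ℝ X] [NormedAddCommGroup P] [NormedSpace ℝ P] [FiniteDimensional ℝ X]
    [FiniteDimensional ℝ P] {v : X × P → X} {U : Set (X × P)} {S : Set P} (_ : IsOpen U)
    (_ : IsClosed S) (_ : Convex ℝ S) (_ : UniqueDiffOn ℝ S)
    (_ : ContDiffOn ℝ ∞ v (U ∩ univ ×ˢ S)) {z₀ : X × P} (_ : z₀.2 ∈ S)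
    (_ : ∀ x, (x, z₀.2) ∈ U → v (x, z₀.2) = 0) {R : ℝ} (_ : 0 < R) (_ : closedBall z₀ R ⊆ U)
    {W : Set (X × P)} (_ : W ∈ 𝓝 z₀) {φ : X × P → ℝ → X}
    (_ : ∀ z ∈ W, z.2 ∈ S → z.2 ∈ closedBall z₀.2 R ∧
      IsUnitSol v (closedBall z₀.1 R) z.2 z.1 (φ z)),
    ∃ W' ∈ 𝓝 z₀, ContDiffOn ℝ n (fun z => φ z 1) (W' ∩ univ ×ˢ S) := by
  induction n with
  | zero =>
    intro X P _ _ _ _ _ _ v U S hU hSc hSv hSu hv z₀ hz₀ h0 R hR hRU W hW φ hφ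
    have hKD : cornerBall S z₀ R ⊆ U ∩ univ ×ˢ S := inter_subset_inter_left _ hRU
    obtain ⟨C, hC1, hC, -⟩ := exists_lipschitzOnWith_of_isCompact_convex hv
      (uniqueDiffOn_inter_univ_prod hU hSu) (isCompact_cornerBall hSc z₀ R)
      (convex_cornerBall hSv z₀ R) hKD
    refine ⟨W, hW, ?_⟩
    rw [Nat.cast_zero, contDiffOn_zero]
    refine LipschitzOnWith.continuousOn (K := (Real.exp C).toNNReal)
      (LipschitzOnWith.of_dist_le_mul fun z hz z' hz' => ?_)
    have hz1 := hφ z hz.1 hz.2.2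
    have hz2 := hφ z' hz'.1 hz'.2.2
    have := hz1.2.dist_le hC hz1.1 hz.2.2 hz2.1 hz'.2.2 hz2.2 (r := 1) (by simp)
    rw [Real.coe_toNNReal _ (Real.exp_pos _).le, mul_comm]
    exact (le_max_left _ _).trans this
  | succ n ih =>
    intro X P _ _ _ _ _ _ v U S hU hSc hSv hSu hv z₀ hz₀ h0 R hR hRU W hW φ hφ
    have hKD : cornerBall S z₀ R ⊆ U ∩ univ ×ˢ S := inter_subset_inter_left _ hRU
    have hDu := uniqueDiffOn_inter_univ_prod hU hSu
    obtain ⟨C, hC1, hC, hC'⟩ := exists_lipschitzOnWith_of_isCompact_convex hv hDu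
      (isCompact_cornerBall hSc z₀ R) (convex_cornerBall hSv z₀ R) hKD
    set D := U ∩ univ ×ˢ S with hD
    -- solutions of the tangent equation
    have hU' : IsOpen {q : (X × X) × (P × P) | (q.1.1, q.2.1) ∈ U} :=
      hU.preimage (by fun_prop : Continuous fun q : (X × X) × (P × P) => (q.1.1, q.2.1))
    have hSc' : IsClosed (S ×ˢ (univ : Set P)) := hSc.prod isClosed_univ
    have hSv' : Convex ℝ (S ×ˢ (univ : Set P)) := hSv.prod convex_univ
    have hSu' : UniqueDiffOn ℝ (S ×ˢ (univ : Set P)) := hSu.prod uniqueDiffOn_univ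
    have hv' := contDiffOn_tangentField hU hSu hv
    set q₀ : (X × X) × (P × P) := ((z₀.1, 0), (z₀.2, 0)) with hq₀
    have h0' : ∀ x, (x, q₀.2) ∈ {q : (X × X) × (P × P) | (q.1.1, q.2.1) ∈ U} →
        tangentField v D (x, q₀.2) = 0 := fun x hx =>
      Prod.ext (h0 _ hx) (fderivWithin_apply_eq_zero hU hv hz₀ h0 hx _)
    have hRU' : closedBall q₀ R ⊆ {q : (X × X) × (P × P) | (q.1.1, q.2.1) ∈ U} := by
      intro q hq
      refine hRU ?_
      simp only [hq₀, mem_closedBall, Prod.dist_eq, sup_le_iff] at hq ⊢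
      exact ⟨hq.1.1, hq.2.1⟩
    obtain ⟨W₁, hW₁, hζ⟩ := exists_isUnitSol hU' hSc' hSv' hSu' hv' (z₀ := q₀)
      ⟨hz₀, trivial⟩ h0' hR hRU'
    choose! hζR ζ hζ using hζ
    obtain ⟨W₂, hW₂, hζn⟩ := ih hU' hSc' hSv' hSu' hv' (z₀ := q₀) ⟨hz₀, trivial⟩ h0' hR hRU'
      hW₁ (φ := ζ) (fun q hq hqS => ⟨hζR q hq hqS, hζ q hq hqS⟩)
    obtain ⟨ρ, hρ, hρW⟩ := Metric.mem_nhds_iff.1 (inter_mem hW₁ hW₂)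
    obtain ⟨ρ', hρ', hρW'⟩ := Metric.mem_nhds_iff.1 hW
    -- variations depend linearly on the direction, so that the basis vectors may be shrunk by `c`
    -- until the tangent equation has solutions up to time one
    let e := Module.finBasis ℝ (X × P)
    obtain ⟨M, hM⟩ : ∃ M : ℝ, ∀ i, ‖e i‖ ≤ M := by
      obtain ⟨M, hM⟩ := (finite_range fun i => ‖e i‖).bddAbove
      exact ⟨M, fun i => hM ⟨i, rfl⟩⟩
    set c : ℝ := ρ / (2 * (|M| + 1)) with hc
    have hc0 : 0 < c := by positivity
    have hce : ∀ i, ‖c • e i‖ < ρ := by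
      intro i
      rw [norm_smul, Real.norm_of_nonneg hc0.le]
      have h1 : ‖e i‖ ≤ |M| + 1 := (hM i).trans ((le_abs_self M).trans (by linarith))
      calc c * ‖e i‖ ≤ c * (|M| + 1) := by gcongr
        _ = ρ / 2 := by rw [hc]; field_simp
        _ < ρ := by linarith
    -- the tangent vectors at `z` in the directions of the basis
    let Q : _ → X × P → (X × X) × (P × P) := fun i z =>
      ((z.1, (c • e i).1), (z.2, (c • e i).2))
    have hQc : ∀ i, ContDiff ℝ ∞ (Q i) := fun i => by fun_prop
    set W' := ball z₀ (min ρ ρ') with hW'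
    have hQW : ∀ i, ∀ z ∈ W', Q i z ∈ W₁ ∩ W₂ := by
      intro i z hz
      apply hρW
      have h1 := hce i
      rw [Prod.norm_def, max_lt_iff] at h1
      have h2 : dist z z₀ < ρ := lt_of_lt_of_le hz (min_le_left _ _)
      rw [Prod.dist_eq, max_lt_iff] at h2
      simp only [Q, hq₀, mem_ball, Prod.dist_eq, max_lt_iff, dist_zero_right]
      exact ⟨⟨h2.1, h1.1⟩, h2.2, h1.2⟩
    have hW'W : W' ⊆ W := (ball_subset_ball (min_le_right _ _)).trans hρW'
    -- the candidate for the derivative of `z ↦ φ z r`, combined from the variations in the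
    -- directions of the basis
    let Lz : X × P → ℝ → (X × P) →L[ℝ] X := fun z r => ∑ i,
      (LinearMap.toContinuousLinearMap (e.coord i)).smulRight (c⁻¹ • (ζ (Q i z) r).2)
    -- the base point of a solution of the tangent equation is a solution of the equation
    have hfst : ∀ i, ∀ z ∈ W', z.2 ∈ S → ∀ r ∈ Icc (0 : ℝ) 1, (ζ (Q i z) r).1 = φ z r := by
      intro i z hz hzS r hr
      have h1 := hζ _ (hQW i z hz).1 ⟨hzS, trivial⟩
      have h2 := hφ z (hW'W hz) hzS
      have h3 : IsUnitSol v (closedBall z₀.1 R) z.2 z.1 fun r => (ζ (Q i z) r).1 := by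
        refine ⟨by rw [h1.start], fun r hr => ?_, fun r hr => ?_⟩
        · have := h1.mem r hr
          simp only [hq₀, mem_closedBall, Prod.dist_eq, sup_le_iff] at this
          exact this.1
        · have h := (h1.deriv r hr).hasFDerivWithinAt
          exact h.fst.hasDerivWithinAt.congr_deriv (by simp [tangentField, Q])
      have := h3.dist_le hC h2.1 hzS h2.1 hzS h2.2 hr
      rw [dist_self, zero_mul] at this
      have := dist_le_zero.1 this
      exact congrArg Prod.fst this
    have hLz0 : ∀ z ∈ W', z.2 ∈ S → ∀ h, Lz z 0 h = h.1 := by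
      intro z hz hzS h
      have h1 : ∀ i, (ζ (Q i z) 0).2 = c • (e i).1 := fun i => by
        rw [(hζ _ (hQW i z hz).1 ⟨hzS, trivial⟩).start]; rfl
      simp only [Lz, _root_.sum_apply, ContinuousLinearMap.smulRight_apply, h1,
        smul_smul, inv_mul_cancel₀ hc0.ne', one_smul]
      conv_rhs => rw [← e.sum_repr h]
      simp [Prod.fst_sum, -Module.Basis.sum_repr]
    have hLzd : ∀ z ∈ W', z.2 ∈ S → ∀ h, ∀ r ∈ Icc (0 : ℝ) 1,
        HasDerivWithinAt (fun r => Lz z r h) (fderivWithin ℝ v D (φ z r, z.2) (Lz z r h, h.2))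
          (Icc 0 1) r := by
      intro z hz hzS h r hr
      have h1 : ∀ i, HasDerivWithinAt (fun r => e.repr h i • (c⁻¹ • (ζ (Q i z) r).2))
          (e.repr h i • (c⁻¹ • fderivWithin ℝ v D (φ z r, z.2)
            ((ζ (Q i z) r).2, (c • e i).2))) (Icc 0 1) r := by
        intro i
        have hd := ((hζ _ (hQW i z hz).1 ⟨hzS, trivial⟩).deriv r hr).hasFDerivWithinAt
        refine ((hd.snd.hasDerivWithinAt.congr_deriv ?_).const_smul c⁻¹).const_smul (e.repr h i)
        simp only [tangentField, ContinuousLinearMap.comp_apply,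
          ContinuousLinearMap.toSpanSingleton_apply, one_smul, ContinuousLinearMap.coe_snd']
        rw [← hfst i z hz hzS r hr]
      have h2 := HasDerivWithinAt.fun_sum (u := Finset.univ) fun i _ => h1 i
      refine (h2.congr_deriv ?_).congr_of_mem (fun r _ => ?_) hr
      · simp only [← map_smul, ← map_sum]
        congr 1
        refine Prod.ext ?_ ?_
        · simp [Lz, Prod.fst_sum]
        · conv_rhs => rw [← e.sum_repr h]
          simp [Prod.snd_sum, smul_smul, inv_mul_cancel₀ hc0.ne', -Module.Basis.sum_repr]
      · simp [Lz]
    -- Grönwall's inequality, applied to the remainder `φ z' r - φ z r - Lz z r (z' - z)`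
    have hder : ∀ z ∈ W' ∩ univ ×ˢ S,
        HasFDerivWithinAt (fun z => φ z 1) (Lz z 1) (W' ∩ univ ×ˢ S) z := by
      intro z hz
      have hzφ := hφ z (hW'W hz.1) hz.2.2
      refine .of_isLittleO ?_
      rw [Asymptotics.isLittleO_iff]
      intro δ hδ
      -- one factor `exp C` comes from the distance of the solutions, another from Grönwall's bound
      set δ' := δ * Real.exp (-(2 * C)) with hδ'
      obtain ⟨σ, hσ, hT⟩ := exists_norm_sub_sub_le hv hDu (isCompact_cornerBall hSc z₀ R)
        (convex_cornerBall hSv z₀ R) hKD (δ := δ') (by positivity)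
      have hσ' : ∀ᶠ z' in 𝓝[W' ∩ univ ×ˢ S] z, dist z' z < σ * Real.exp (-C) :=
        nhdsWithin_le_nhds (ball_mem_nhds z (by positivity))
      filter_upwards [hσ', self_mem_nhdsWithin] with z' hz'σ hz'
      have hzφ' := hφ z' (hW'W hz'.1) hz'.2.2
      set h := z' - z with hh
      have hd : ∀ r ∈ Icc (0 : ℝ) 1,
          dist (φ z' r, z'.2) (φ z r, z.2) ≤ dist z' z * Real.exp C := fun r hr =>
        hzφ'.2.dist_le hC hzφ'.1 hz'.2.2 hzφ.1 hz.2.2 hzφ.2 hr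
      have hC1' : (1 : ℝ) ≤ C := by exact_mod_cast hC1
      have hG := norm_le_gronwallBound_of_norm_deriv_right_le (a := 0) (b := 1)
        (f := fun r => φ z' r - φ z r - Lz z r h)
        (f' := fun r => v (φ z' r, z'.2) - v (φ z r, z.2)
          - fderivWithin ℝ v D (φ z r, z.2) (Lz z r h, h.2)) (δ := 0) (K := C)
        (ε := δ' * (dist z' z * Real.exp C))
        ((hzφ'.2.continuousOn.sub hzφ.2.continuousOn).sub
          fun r hr => (hLzd z hz.1 hz.2.2 h r hr).continuousWithinAt)
        (fun r hr => ((hasDerivWithinAt_Ici_of_Icc hr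
            (hzφ'.2.deriv r (Ico_subset_Icc_self hr))).sub
          (hasDerivWithinAt_Ici_of_Icc hr (hzφ.2.deriv r (Ico_subset_Icc_self hr)))).sub
          (hasDerivWithinAt_Ici_of_Icc hr
            (hLzd z hz.1 hz.2.2 h r (Ico_subset_Icc_self hr))))
        (by simp [hLz0 z hz.1 hz.2.2, hzφ.2.start, hzφ'.2.start, hh])
        (fun r hr => by
          have hr' := Ico_subset_Icc_self hr
          have ha : (φ z r, z.2) ∈ cornerBall S z₀ R :=
            mem_cornerBall.2 ⟨hzφ.2.mem r hr', hzφ.1, hz.2.2⟩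
          have hb : (φ z' r, z'.2) ∈ cornerBall S z₀ R :=
            mem_cornerBall.2 ⟨hzφ'.2.mem r hr', hzφ'.1, hz'.2.2⟩
          have hlt : dist (φ z' r, z'.2) (φ z r, z.2) < σ := by
            refine (hd r hr').trans_lt ?_
            calc dist z' z * Real.exp C < σ * Real.exp (-C) * Real.exp C := by gcongr
              _ = σ := by rw [mul_assoc, ← Real.exp_add]; simp
          have h1 := hT _ ha _ hb hlt
          have h2 := (fderivWithin ℝ v D (φ z r, z.2)).le_of_opNorm_le (hC' _ ha)
            (φ z' r - φ z r - Lz z r h, 0)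
          have h3 : v (φ z' r, z'.2) - v (φ z r, z.2)
              - fderivWithin ℝ v D (φ z r, z.2) (Lz z r h, h.2)
              = (v (φ z' r, z'.2) - v (φ z r, z.2) - fderivWithin ℝ v D (φ z r, z.2)
                  ((φ z' r, z'.2) - (φ z r, z.2)))
                + fderivWithin ℝ v D (φ z r, z.2) (φ z' r - φ z r - Lz z r h, 0) := by
            rw [sub_add, ← map_sub]
            congr 2
            simp [hh]
          rw [h3]
          refine (norm_add_le _ _).trans ?_
          rw [add_comm]
          refine add_le_add (h2.trans ?_) (h1.trans ?_)
          · simp [Prod.norm_def]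
          · rw [← dist_eq_norm]
            have := hd r hr'
            gcongr)
        1 (by simp)
      refine hG.trans ?_
      rw [gronwallBound_of_K_ne_0 (by positivity), ← dist_eq_norm]
      have hexp : Real.exp (C * (1 - 0)) - 1 ≤ Real.exp C := by
        rw [sub_zero, mul_one]; linarith
      calc 0 * Real.exp (C * (1 - 0))
            + δ' * (dist z' z * Real.exp C) / C * (Real.exp (C * (1 - 0)) - 1)
          ≤ 0 + δ' * (dist z' z * Real.exp C) / 1 * Real.exp C := by
            rw [zero_mul]
            have : 0 ≤ Real.exp (C * (1 - 0)) - 1 := by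
              rw [sub_nonneg]; exact Real.one_le_exp (by linarith)
            gcongr
        _ = δ * dist z' z * (Real.exp (-(2 * C)) * Real.exp C * Real.exp C) := by
            rw [hδ']; ring
        _ = δ * dist z' z := by
            rw [← Real.exp_add, ← Real.exp_add]
            ring_nf
            simp
    refine ⟨W', ball_mem_nhds _ (by positivity), ?_⟩
    rw [Nat.cast_succ, contDiffOn_succ_iff_hasFDerivWithinAt_of_uniqueDiffOn
      (uniqueDiffOn_inter_univ_prod isOpen_ball hSu)]
    refine ⟨by simp, fun z => Lz z 1, ?_, hder⟩
    refine ContDiffOn.sum fun i _ => ?_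
    have h1 : ContDiffOn ℝ n (fun z => (ζ (Q i z) 1).2) (W' ∩ univ ×ˢ S) :=
      contDiff_snd.comp_contDiffOn (hζn.comp ((hQc i).of_le (by exact_mod_cast le_top)).contDiffOn
        fun z hz => ⟨(hQW i z hz.1).2, trivial, hz.2.2, trivial⟩)
    exact contDiffOn_const.smulRight (h1.const_smul c⁻¹)

/-! ### Local flows with parameters in a manifold with corners -/

section LocalFlow

variable {X EP HP P : Type*} [NormedAddCommGroup X] [NormedSpace ℝ X] [FiniteDimensional ℝ X]
  [NormedAddCommGroup EP] [NormedSpace ℝ EP] [FiniteDimensional ℝ EP] [TopologicalSpace HP]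
  {IP : ModelWithCorners ℝ EP HP} [TopologicalSpace P] [ChartedSpace HP P] [IsManifold IP ∞ P]

/-- Two solutions of a smooth equation that meet at time `r₀` agree near `r₀`. -/
theorem eventuallyEq_of_hasDerivAt_of_contDiffAt {v : X → X} {γ₁ γ₂ : ℝ → X} {r₀ : ℝ}
    (hv : ContDiffAt ℝ 1 v (γ₁ r₀)) (h₁ : ∀ᶠ r in 𝓝 r₀, HasDerivAt γ₁ (v (γ₁ r)) r)
    (h₂ : ∀ᶠ r in 𝓝 r₀, HasDerivAt γ₂ (v (γ₂ r)) r) (h : γ₁ r₀ = γ₂ r₀) : γ₁ =ᶠ[𝓝 r₀] γ₂ := by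
  obtain ⟨K, s, hs, hK⟩ := hv.exists_lipschitzOnWith
  refine ODE_solution_unique_of_eventually (v := fun _ => v) (s := fun _ => s) (K := K)
    (Eventually.of_forall fun _ => hK) (h₁.and ?_) (h₂.and ?_) h
  · exact h₁.self_of_nhds.continuousAt.eventually hs
  · exact h₂.self_of_nhds.continuousAt.eventually (h ▸ hs)

/-- The chart `id × extChartAt p₀` transports a smooth field with parameters in `P` to a field with
parameters in the closed convex set `range IP`. -/
theorem exists_isOpen_contDiffOn_extChartAt_symm {Y : Type*} [NormedAddCommGroup Y]
    [NormedSpace ℝ Y] {v : X × P → Y} {O : Set (X × P)}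
    (hO : IsOpen O) (hv : ContMDiffOn (𝓘(ℝ, X).prod IP) 𝓘(ℝ, Y) ∞ v O) (p₀ : P) :
    ∃ U : Set (X × EP), IsOpen U ∧
      (∀ x, (x, p₀) ∈ O → (x, extChartAt IP p₀ p₀) ∈ U) ∧
      (∀ z ∈ U ∩ univ ×ˢ range IP, z.2 ∈ (extChartAt IP p₀).target ∧
        (z.1, (extChartAt IP p₀).symm z.2) ∈ O) ∧
      ContDiffOn ℝ ∞ (fun z : X × EP => v (z.1, (extChartAt IP p₀).symm z.2))
        (U ∩ univ ×ˢ range IP) := by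
  have hIc : Continuous fun z : X × EP => (z.1, IP.symm z.2) :=
    continuous_fst.prodMk (IP.continuous_symm.comp continuous_snd)
  have hcs : ContinuousOn (fun z : X × HP => (z.1, (chartAt HP p₀).symm z.2))
      (univ ×ˢ (chartAt HP p₀).target) :=
    continuousOn_fst.prodMk ((chartAt HP p₀).symm.continuousOn.comp continuousOn_snd
      fun z hz => hz.2)
  have h1 : IsOpen ((univ ×ˢ (chartAt HP p₀).target) ∩
      (fun z : X × HP => (z.1, (chartAt HP p₀).symm z.2)) ⁻¹' O) :=
    hcs.isOpen_inter_preimage (isOpen_univ.prod (chartAt HP p₀).open_target) hO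
  have hmem : ∀ z ∈ ((fun z : X × EP => (z.1, IP.symm z.2)) ⁻¹'
      ((univ ×ˢ (chartAt HP p₀).target) ∩
      (fun z : X × HP => (z.1, (chartAt HP p₀).symm z.2)) ⁻¹' O)) ∩ univ ×ˢ range IP,
      z.2 ∈ (extChartAt IP p₀).target ∧ (z.1, (extChartAt IP p₀).symm z.2) ∈ O := by
    rintro z ⟨⟨hz1, hz2⟩, -, hz3⟩
    refine ⟨?_, hz2⟩
    rw [extChartAt_target]
    exact ⟨hz1.2, hz3⟩
  refine ⟨_, h1.preimage hIc, ?_, hmem, ?_⟩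
  · intro x hx
    have := mem_chart_source HP p₀
    simp [extChartAt, this, (chartAt HP p₀).map_source, hx]
  · rw [← contMDiffOn_iff_contDiffOn]
    have h2 : ContMDiff 𝓘(ℝ, X × EP) 𝓘(ℝ, X) ∞ (Prod.fst : X × EP → X) := contDiff_fst.contMDiff
    have h3 : ContMDiff 𝓘(ℝ, X × EP) 𝓘(ℝ, EP) ∞ (Prod.snd : X × EP → EP) := contDiff_snd.contMDiff
    have h4 := (contMDiffOn_extChartAt_symm (I := IP) (n := ∞) p₀).comp h3.contMDiffOn
      fun z hz => (hmem z hz).1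
    exact hv.comp (h2.contMDiffOn.prodMk h4) fun z hz => (hmem z hz).2

/-- The local flow of a smooth vector field on `X` that depends smoothly on a parameter in a
manifold with corners. -/
theorem exists_local_flow (n : ℕ) {v : X × P → X} {O : Set (X × P)}
    (hO : IsOpen O) (hv : ContMDiffOn (𝓘(ℝ, X).prod IP) 𝓘(ℝ, X) ∞ v O) {x₀ : X} {p₀ : P}
    (h₀ : (x₀, p₀) ∈ O) :
    ∃ ε > 0, ∃ W ∈ 𝓝 (x₀, p₀), ∃ φ : (X × P) × ℝ → X,
      (∀ z ∈ W, φ (z, 0) = z.1 ∧ ∀ r ∈ Ioo (-ε) ε, (φ (z, r), z.2) ∈ O ∧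
        HasDerivAt (fun r => φ (z, r)) (v (φ (z, r), z.2)) r) ∧
      ContMDiffOn ((𝓘(ℝ, X).prod IP).prod 𝓘(ℝ, ℝ)) 𝓘(ℝ, X) n φ (W ×ˢ Ioo (-ε) ε) := by
  obtain ⟨U, hU, hpU, hUO, hvU⟩ := exists_isOpen_contDiffOn_extChartAt_symm hO hv p₀
  set y₀ := extChartAt IP p₀ p₀ with hy₀
  -- the time-one map of `c • v` is the time-`c` map of `v`
  set w : X × (EP × ℝ) → X := fun z => z.2.2 • v (z.1, (extChartAt IP p₀).symm z.2.1) with hw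
  set U' : Set (X × (EP × ℝ)) := (fun z => (z.1, z.2.1)) ⁻¹' U with hU'
  set S : Set (EP × ℝ) := range IP ×ˢ univ with hS
  have hU'o : IsOpen U' := hU.preimage (by fun_prop)
  have hSc : IsClosed S := IP.isClosed_range.prod isClosed_univ
  have hSv : Convex ℝ S := IP.convex_range.prod convex_univ
  have hSu : UniqueDiffOn ℝ S := IP.uniqueDiffOn.prod uniqueDiffOn_univ
  have hwU : ContDiffOn ℝ ∞ w (U' ∩ univ ×ˢ S) := by
    refine ContDiffOn.smul (by fun_prop) ?_
    exact hvU.comp (f := fun z : X × (EP × ℝ) => (z.1, z.2.1))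
      (by fun_prop : ContDiff ℝ ∞ fun z : X × (EP × ℝ) => (z.1, z.2.1)).contDiffOn
      fun z hz => ⟨hz.1, trivial, hz.2.2.1⟩
  set z₀ : X × (EP × ℝ) := (x₀, (y₀, 0)) with hz₀
  have hz₀S : z₀.2 ∈ S := ⟨⟨_, rfl⟩, trivial⟩
  have hz₀U : z₀ ∈ U' := hpU x₀ h₀
  have hw0 : ∀ x, (x, z₀.2) ∈ U' → w (x, z₀.2) = 0 := fun x _ => by simp [hw, hz₀]
  obtain ⟨R, hR, hRU⟩ := Metric.nhds_basis_closedBall.mem_iff.1 (hU'o.mem_nhds hz₀U)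
  obtain ⟨W₁, hW₁, hζ⟩ := exists_isUnitSol hU'o hSc hSv hSu hwU hz₀S hw0 hR hRU
  choose! hζR ζ hζ using hζ
  obtain ⟨W₂, hW₂, hζn⟩ := exists_contDiffOn_timeOne n hU'o hSc hSv hSu hwU hz₀S hw0 hR hRU
    hW₁ fun z hz hzS => ⟨hζR z hz hzS, hζ z hz hzS⟩
  obtain ⟨C, -, hC, -⟩ := exists_lipschitzOnWith_of_isCompact_convex hwU
    (uniqueDiffOn_inter_univ_prod hU'o hSu) (isCompact_cornerBall hSc z₀ R)
    (convex_cornerBall hSv z₀ R) (inter_subset_inter_left _ hRU)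
  obtain ⟨ρ, hρ, hρW⟩ := Metric.nhds_basis_closedBall.mem_iff.1 (inter_mem hW₁ hW₂)
  set W : Set (X × P) := {z | z.2 ∈ (chartAt HP p₀).source ∧
    (z.1, extChartAt IP p₀ z.2) ∈ closedBall (x₀, y₀) ρ} with hW
  have hWn : W ∈ 𝓝 (x₀, p₀) := by
    refine inter_mem ?_ ?_
    · exact continuous_snd.continuousAt.preimage_mem_nhds (chart_source_mem_nhds HP p₀)
    · refine ContinuousAt.preimage_mem_nhds (f := fun z : X × P => (z.1, extChartAt IP p₀ z.2)) ?_
        (closedBall_mem_nhds _ hρ)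
      exact continuousAt_fst.prodMk
        (ContinuousAt.comp (g := extChartAt IP p₀) (continuousAt_extChartAt p₀) continuousAt_snd)
  -- the parameter `(z, c)` in the chart
  set Q : (X × P) × ℝ → X × (EP × ℝ) := fun q => (q.1.1, (extChartAt IP p₀ q.1.2, q.2)) with hQ
  have hQW : ∀ z ∈ W, ∀ c ∈ Icc (-ρ) ρ, Q (z, c) ∈ W₁ ∩ W₂ := by
    intro z hz c hc
    apply hρW
    have h1 := hz.2
    simp only [mem_closedBall, Prod.dist_eq, sup_le_iff] at h1
    simp only [hQ, hz₀, mem_closedBall, Prod.dist_eq, sup_le_iff]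
    exact ⟨h1.1, h1.2, by simpa [abs_le] using hc⟩
  have hQS : ∀ q, (Q q).2 ∈ S := fun q => ⟨by simp [hQ, extChartAt], trivial⟩
  have hsol : ∀ z ∈ W, ∀ c ∈ Icc (-ρ) ρ,
      IsUnitSol w (closedBall x₀ R) (Q (z, c)).2 z.1 (ζ (Q (z, c))) := fun z hz c hc =>
    hζ _ (hQW z hz c hc).1 (hQS _)
  have hsymm : ∀ z ∈ W, (extChartAt IP p₀).symm (extChartAt IP p₀ z.2) = z.2 := fun z hz =>
    (extChartAt IP p₀).left_inv (by rw [extChartAt_source]; exact hz.1)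
  -- rescaling of time
  have hscale : ∀ z ∈ W, ∀ c ∈ Icc (-ρ) ρ, ∀ r ∈ Icc (0 : ℝ) 1,
      ζ (Q (z, c * r)) 1 = ζ (Q (z, c)) r := by
    intro z hz c hc r hr
    have hcr : c * r ∈ Icc (-ρ) ρ := by
      have hc : |c| ≤ ρ := abs_le.2 hc
      refine abs_le.1 ?_
      rw [abs_mul, abs_of_nonneg hr.1]
      nlinarith [abs_nonneg c, hr.2]
    have h1 := hsol z hz c hc
    have h2 : IsUnitSol w (closedBall x₀ R) (Q (z, c * r)).2 z.1 fun t => ζ (Q (z, c)) (r * t) := by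
      have hm : ∀ t ∈ Icc (0 : ℝ) 1, r * t ∈ Icc (0 : ℝ) 1 := fun t ht =>
        ⟨mul_nonneg hr.1 ht.1, mul_le_one₀ hr.2 ht.1 ht.2⟩
      refine ⟨by simp [h1.start], fun t ht => h1.mem _ (hm t ht), fun t ht => ?_⟩
      have h3 := (h1.deriv _ (hm t ht)).scomp t (h := fun t => r * t)
        ((hasDerivAt_id t).const_mul r).hasDerivWithinAt hm
      refine h3.congr_deriv ?_
      simp [hw, hQ, smul_smul, mul_comm]
    have h3 := (hsol z hz _ hcr).dist_le (z := Q (z, c * r)) (z' := Q (z, c * r)) hC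
      (hζR _ (hQW z hz _ hcr).1 (hQS _)) (hQS _) (hζR _ (hQW z hz _ hcr).1 (hQS _)) (hQS _)
      h2 (r := 1) (by simp)
    rw [dist_self, zero_mul] at h3
    simpa using congrArg Prod.fst (dist_le_zero.1 h3)
  refine ⟨ρ, hρ, W, hWn, fun q => ζ (Q q) 1, fun z hz => ⟨?_, fun r hr => ⟨?_, ?_⟩⟩, ?_⟩
  · have := hscale z hz 0 (by constructor <;> linarith) 0 (by simp)
    rw [mul_zero] at this
    simp only
    rw [this, (hsol z hz 0 (by constructor <;> linarith)).start]
  · have hr' := Ioo_subset_Icc_self hr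
    have h1 := (hsol z hz r hr').mem 1 (by simp)
    have h2 := hζR _ (hQW z hz r hr').1 (hQS _)
    have h3 : (ζ (Q (z, r)) 1, (Q (z, r)).2) ∈ U' := hRU (by
      simp only [mem_closedBall, Prod.dist_eq, sup_le_iff] at h1 h2 ⊢
      exact ⟨h1, h2⟩)
    have h4 := (hUO (ζ (Q (z, r)) 1, extChartAt IP p₀ z.2) ⟨h3, trivial, by simp [extChartAt]⟩).2
    rwa [hsymm z hz] at h4
  · -- the derivative in time, from both sides
    have hside : ∀ c ∈ Icc (-ρ) ρ, c ≠ 0 → ∀ t ∈ Icc (0 : ℝ) 1,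
        HasDerivWithinAt (fun r => ζ (Q (z, r)) 1) (v (ζ (Q (z, c * t)) 1, z.2))
          ((fun r => c⁻¹ * r) ⁻¹' Icc (0 : ℝ) 1) (c * t) := by
      intro c hc hc0 t ht
      have h1 := (hsol z hz c hc).deriv t ht
      have h2 : c⁻¹ * (c * t) = t := by field_simp
      rw [← h2] at h1
      have h3 := h1.scomp (c * t) (h := fun r => c⁻¹ * r)
        (((hasDerivAt_id (c * t)).const_mul c⁻¹).hasDerivWithinAt
          (s := (fun r => c⁻¹ * r) ⁻¹' Icc (0 : ℝ) 1)) (fun r hr => hr)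
      refine (h3.congr_deriv ?_).congr_of_mem (fun r hr => ?_) ?_
      · rw [h2, hscale z hz c hc t ht]
        simp only [hw, hQ, smul_smul, hsymm z hz, mul_one, inv_mul_cancel₀ hc0, one_smul]
      · have := hscale z hz c hc _ hr
        rw [mul_inv_cancel_left₀ hc0] at this
        exact this
      · rw [mem_preimage, h2]
        exact ht
    have hpos : (fun r => ρ⁻¹ * r) ⁻¹' Icc (0 : ℝ) 1 = Icc 0 ρ := by
      ext r
      simp only [mem_preimage, mem_Icc, inv_mul_le_iff₀ hρ, mul_one]
      rw [mul_nonneg_iff_of_pos_left (inv_pos.2 hρ)]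
    have hneg : (fun r => (-ρ)⁻¹ * r) ⁻¹' Icc (0 : ℝ) 1 = Icc (-ρ) 0 := by
      ext r
      have : (-ρ)⁻¹ * r = ρ⁻¹ * (-r) := by rw [inv_neg]; ring
      simp only [mem_preimage, mem_Icc, this, inv_mul_le_iff₀ hρ, mul_one]
      rw [mul_nonneg_iff_of_pos_left (inv_pos.2 hρ)]
      constructor <;> rintro ⟨h1, h2⟩ <;> constructor <;> linarith
    have hder : ∀ c ∈ Icc (-ρ) ρ, c ≠ 0 → HasDerivWithinAt (fun r => ζ (Q (z, r)) 1)
        (v (ζ (Q (z, r)) 1, z.2)) ((fun r => c⁻¹ * r) ⁻¹' Icc (0 : ℝ) 1) r := by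
      intro c hc hc0
      by_cases hrc : c⁻¹ * r ∈ Icc (0 : ℝ) 1
      · have := hside c hc hc0 _ hrc
        rwa [mul_inv_cancel_left₀ hc0] at this
      · refine HasFDerivWithinAt.of_notMem_closure ?_
        have : IsClosed ((fun r => c⁻¹ * r) ⁻¹' Icc (0 : ℝ) 1) :=
          isClosed_Icc.preimage (by fun_prop)
        rwa [this.closure_eq]
    have h1 := hder ρ ⟨by linarith, le_rfl⟩ hρ.ne'
    have h2 := hder (-ρ) ⟨le_rfl, by linarith⟩ (by linarith)
    rw [hpos] at h1
    rw [hneg] at h2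
    have h3 := h2.union h1
    rw [Icc_union_Icc_eq_Icc (by linarith) hρ.le] at h3
    exact h3.hasDerivAt (Icc_mem_nhds hr.1 hr.2)
  · have h1 : ContMDiffOn 𝓘(ℝ, X × (EP × ℝ)) 𝓘(ℝ, X) n (fun z => ζ z 1) (W₂ ∩ univ ×ˢ S) :=
      hζn.contMDiffOn
    refine h1.comp (f := Q) ?_ fun q hq =>
      ⟨(hQW q.1 hq.1 q.2 (Ioo_subset_Icc_self hq.2)).2, trivial, hQS q⟩
    have hext : ContMDiffOn IP 𝓘(ℝ, EP) n (extChartAt IP p₀) (chartAt HP p₀).source :=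
      (contMDiffOn_extChartAt (I := IP) (n := ∞)).of_le (by exact_mod_cast le_top)
    refine (contMDiff_fst.comp contMDiff_fst).contMDiffOn.prodMk_space
      (ContMDiffOn.prodMk_space ?_ contMDiffOn_snd)
    exact hext.comp (contMDiff_snd.comp contMDiff_fst).contMDiffOn fun q hq => hq.1.1

end LocalFlow

/-! ### Product charts and lifts of paths in the base -/

section Charts

variable {E EB HB EN HN B N : Type*}
  [NormedAddCommGroup E] [NormedSpace ℝ E]
  [NormedAddCommGroup EB] [NormedSpace ℝ EB] [TopologicalSpace HB]
  [NormedAddCommGroup EN] [NormedSpace ℝ EN] [TopologicalSpace HN]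
  {I : ModelWithCorners ℝ EB HB} {J : ModelWithCorners ℝ EN HN}
  [TopologicalSpace B] [ChartedSpace HB B] [TopologicalSpace N] [ChartedSpace HN N]

/-- The local product charts of a family, as a type. -/
structure SmoothFamily.ProductChart (F : SmoothFamily E I J N B) where
  toHomeo : OpenPartialHomeomorph N (E × B)
  isProductChart : IsProductChart I J F.proj toHomeo

namespace SmoothFamily.ProductChart

variable {F : SmoothFamily E I J N B} (c c' : F.ProductChart)

/-- The fibre coordinate of a point. -/
def coord (q : N) : E := (c.toHomeo q).1

/-- The point of `N` with fibre coordinate `z.1` over `z.2`. -/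
def pt (z : E × B) : N := c.toHomeo.symm z

/-- The change of fibre coordinates from `c` to `c'`. -/
def change (z : E × B) : E := c'.coord (c.pt z)

/-- The part of the range of `c` on which the change of coordinates to `c'` is defined. -/
def overlap : Set (E × B) := {z | z ∈ c.toHomeo.target ∧ c.pt z ∈ c'.toHomeo.source}

variable {c c'}

theorem apply_eq {q : N} (hq : q ∈ c.toHomeo.source) : c.toHomeo q = (c.coord q, F.proj q) :=
  Prod.ext rfl (c.isProductChart.snd_eq q hq)

theorem mem_target {q : N} (hq : q ∈ c.toHomeo.source) :
    (c.coord q, F.proj q) ∈ c.toHomeo.target := by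
  rw [← apply_eq hq]; exact c.toHomeo.map_source hq

theorem pt_coord {q : N} (hq : q ∈ c.toHomeo.source) : c.pt (c.coord q, F.proj q) = q := by
  rw [pt, ← apply_eq hq]; exact c.toHomeo.left_inv hq

theorem pt_mem {z : E × B} (hz : z ∈ c.toHomeo.target) : c.pt z ∈ c.toHomeo.source :=
  c.toHomeo.map_target hz

theorem coord_pt {z : E × B} (hz : z ∈ c.toHomeo.target) : c.coord (c.pt z) = z.1 := by
  rw [coord, pt, c.toHomeo.right_inv hz]

theorem proj_pt {z : E × B} (hz : z ∈ c.toHomeo.target) : F.proj (c.pt z) = z.2 :=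
  c.isProductChart.proj_symm hz

theorem mem_overlap {q : N} (hq : q ∈ c.toHomeo.source) (hq' : q ∈ c'.toHomeo.source) :
    (c.coord q, F.proj q) ∈ c.overlap c' := ⟨mem_target hq, by rwa [pt_coord hq]⟩

theorem change_mem_target {z : E × B} (hz : z ∈ c.overlap c') :
    (c.change c' z, z.2) ∈ c'.toHomeo.target := by
  have := mem_target hz.2
  rwa [proj_pt hz.1] at this

theorem pt_change {z : E × B} (hz : z ∈ c.overlap c') : c'.pt (c.change c' z, z.2) = c.pt z := by
  have := pt_coord hz.2
  rwa [proj_pt hz.1] at this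

theorem change_mem_overlap {z : E × B} (hz : z ∈ c.overlap c') :
    (c.change c' z, z.2) ∈ c'.overlap c :=
  ⟨change_mem_target hz, by rw [pt_change hz]; exact pt_mem hz.1⟩

theorem change_change {z : E × B} (hz : z ∈ c.overlap c') {c'' : F.ProductChart} :
    c'.change c'' (c.change c' z, z.2) = c.change c'' z := by
  rw [change, pt_change hz]; rfl

theorem change_self {z : E × B} (hz : z ∈ c.toHomeo.target) : c.change c z = z.1 := coord_pt hz

theorem contMDiffOn_coord : ContMDiffOn J 𝓘(ℝ, E) ∞ c.coord c.toHomeo.source :=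
  contMDiff_fst.comp_contMDiffOn c.isProductChart.smooth

theorem contMDiffOn_pt : ContMDiffOn (𝓘(ℝ, E).prod I) J ∞ c.pt c.toHomeo.target :=
  c.isProductChart.smooth_symm

theorem continuousAt_coord {q : N} (hq : q ∈ c.toHomeo.source) : ContinuousAt c.coord q :=
  continuousAt_fst.comp (c.toHomeo.continuousAt hq)

theorem continuousAt_pt {z : E × B} (hz : z ∈ c.toHomeo.target) : ContinuousAt c.pt z :=
  c.toHomeo.symm.continuousAt hz

theorem isOpen_overlap : IsOpen (c.overlap c') :=
  c.toHomeo.symm.isOpen_inter_preimage c'.toHomeo.open_source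

theorem contMDiffOn_change :
    ContMDiffOn (𝓘(ℝ, E).prod I) 𝓘(ℝ, E) ∞ (c.change c') (c.overlap c') :=
  contMDiffOn_coord.comp (contMDiffOn_pt.mono fun _ hz => hz.1) fun _ hz => hz.2

end SmoothFamily.ProductChart

/-- Every point lies in the domain of a local product chart. -/
theorem SmoothFamily.exists_productChart (F : SmoothFamily E I J N B) (q : N) :
    ∃ c : F.ProductChart, q ∈ c.toHomeo.source :=
  let ⟨φ, hφ, hq⟩ := F.exists_chart q
  ⟨⟨φ, hφ⟩, hq⟩

end Charts

section Lifts

variable {E EB HB EN HN B N : Type*}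
  [NormedAddCommGroup E] [NormedSpace ℝ E]
  [NormedAddCommGroup EB] [NormedSpace ℝ EB] [TopologicalSpace HB]
  [NormedAddCommGroup EN] [NormedSpace ℝ EN] [TopologicalSpace HN]
  {I : ModelWithCorners ℝ EB HB} {J : ModelWithCorners ℝ EN HN}
  [TopologicalSpace B] [ChartedSpace HB B] [TopologicalSpace N] [ChartedSpace HN N]
  {EP HP P : Type*} [NormedAddCommGroup EP] [NormedSpace ℝ EP] [TopologicalSpace HP]
  {IP : ModelWithCorners ℝ EP HP} [TopologicalSpace P] [ChartedSpace HP P]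
  {F : SmoothFamily E I J N B} {h : P × ℝ → B}

namespace SmoothFamily.ProductChart

/-- The coordinates of the pairs `(q, p)` with `q` in the chart domain and `proj q = h p`, that is,
the range of the chart that `c` induces on the pull-back of the family under `h`. -/
def dom (c : F.ProductChart) (h : P × ℝ → B) : Set (E × (P × ℝ)) :=
  {z | (z.1, h z.2) ∈ c.toHomeo.target}

/-- The change of coordinates, along the curve `s ↦ h (p, s)` in the base. -/
def changeAlong (c c' : F.ProductChart) (h : P × ℝ → B) (p : P) (z : E × ℝ) : E :=
  c.change c' (z.1, h (p, z.2))

end SmoothFamily.ProductChart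

open SmoothFamily.ProductChart

theorem isOpen_dom (hh : Continuous h) (c : F.ProductChart) : IsOpen (c.dom h) :=
  c.toHomeo.open_target.preimage
    (by fun_prop : Continuous fun z : E × (P × ℝ) => (z.1, h z.2))

theorem contMDiff_lift (hh : ContMDiff (IP.prod 𝓘(ℝ, ℝ)) I ∞ h) :
    ContMDiff (𝓘(ℝ, E).prod (IP.prod 𝓘(ℝ, ℝ))) (𝓘(ℝ, E).prod I) ∞
      fun z : E × (P × ℝ) => (z.1, h z.2) :=
  contMDiff_fst.prodMk (hh.comp contMDiff_snd)

theorem contMDiff_curve (p : P) :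
    ContMDiff 𝓘(ℝ, E × ℝ) (𝓘(ℝ, E).prod (IP.prod 𝓘(ℝ, ℝ))) ∞
      fun z : E × ℝ => (z.1, (p, z.2)) := by
  have h1 : ContMDiff 𝓘(ℝ, E × ℝ) 𝓘(ℝ, E) ∞ (Prod.fst : E × ℝ → E) := contDiff_fst.contMDiff
  have h2 : ContMDiff 𝓘(ℝ, E × ℝ) 𝓘(ℝ, ℝ) ∞ (Prod.snd : E × ℝ → ℝ) := contDiff_snd.contMDiff
  exact h1.prodMk (contMDiff_const.prodMk h2)

/-- A smooth function on a chart of the pull-back is smooth in `(e, s)` when the parameter is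
frozen. -/
theorem contDiffAt_of_contMDiffOn {Y : Type*} [NormedAddCommGroup Y] [NormedSpace ℝ Y]
    {f : E × (P × ℝ) → Y} {O : Set (E × (P × ℝ))} (hO : IsOpen O)
    (hf : ContMDiffOn (𝓘(ℝ, E).prod (IP.prod 𝓘(ℝ, ℝ))) 𝓘(ℝ, Y) ∞ f O) {e : E} {p : P} {s : ℝ}
    (hz : (e, (p, s)) ∈ O) : ContDiffAt ℝ ∞ (fun z : E × ℝ => f (z.1, (p, z.2))) (e, s) := by
  rw [← contMDiffAt_iff_contDiffAt]
  exact ContMDiffAt.comp (g := f) (f := fun z : E × ℝ => (z.1, (p, z.2))) (e, s)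
    (hf.contMDiffAt (hO.mem_nhds hz)) (contMDiff_curve p).contMDiffAt

theorem contDiffAt_changeAlong (hh : ContMDiff (IP.prod 𝓘(ℝ, ℝ)) I ∞ h) {c c' : F.ProductChart}
    {e : E} {p : P} {s : ℝ} (hz : (e, h (p, s)) ∈ c.overlap c') :
    ContDiffAt ℝ ∞ (c.changeAlong c' h p) (e, s) :=
  contDiffAt_of_contMDiffOn (isOpen_overlap.preimage (contMDiff_lift hh).continuous)
    (contMDiffOn_change.comp (contMDiff_lift hh).contMDiffOn fun _ hz => hz) hz

variable (IP F h) in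
/-- A lift of the vector field `∂/∂s` on the base of the pull-back of the family under
`h : P × ℝ → B`, given by its components in all product charts. -/
structure LiftField where
  coef : F.ProductChart → E × (P × ℝ) → E
  smooth : ∀ c, ContMDiffOn (𝓘(ℝ, E).prod (IP.prod 𝓘(ℝ, ℝ))) 𝓘(ℝ, E) ∞ (coef c) (c.dom h)
  compat : ∀ (c c' : F.ProductChart) (e : E) (p : P) (s : ℝ), (e, h (p, s)) ∈ c.overlap c' →
    coef c' (c.changeAlong c' h p (e, s), (p, s)) =
      fderiv ℝ (c.changeAlong c' h p) (e, s) (coef c (e, (p, s)), 1)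

variable (IP F h) in
/-- A function on the pull-back of the family under `h` which is smooth in all product charts. It
is given by a function of all pairs `(q, p)`, of which only those with `proj q = h p` matter. -/
def IsSmoothOnPullback (g : N → P × ℝ → ℝ) : Prop :=
  ∀ c : F.ProductChart, ContMDiffOn (𝓘(ℝ, E).prod (IP.prod 𝓘(ℝ, ℝ))) 𝓘(ℝ, ℝ) ∞
    (fun z => g (c.pt (z.1, h z.2)) z.2) (c.dom h)

/-- `γ` is, at time `s`, an integral curve of the lift `A` over the curve `s ↦ h (p, s)`. -/
structure IsIntegralAt (A : LiftField IP F h) (p : P) (γ : ℝ → N) (s : ℝ) : Prop where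
  continuousAt : ContinuousAt γ s
  proj_eq : ∀ᶠ s' in 𝓝 s, F.proj (γ s') = h (p, s')
  deriv : ∀ c : F.ProductChart, γ s ∈ c.toHomeo.source →
    HasDerivAt (fun s' => c.coord (γ s')) (A.coef c (c.coord (γ s), (p, s))) s

variable {A : LiftField IP F h} {p : P} {γ γ' : ℝ → N} {s : ℝ}

theorem IsIntegralAt.proj (hγ : IsIntegralAt A p γ s) : F.proj (γ s) = h (p, s) :=
  hγ.proj_eq.self_of_nhds

/-- It suffices to check the differential equation in one chart. -/
theorem IsIntegralAt.of_chart (hh : ContMDiff (IP.prod 𝓘(ℝ, ℝ)) I ∞ h) (hc : ContinuousAt γ s)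
    (hp : ∀ᶠ s' in 𝓝 s, F.proj (γ s') = h (p, s')) (c : F.ProductChart)
    (hs : γ s ∈ c.toHomeo.source)
    (hd : HasDerivAt (fun s' => c.coord (γ s')) (A.coef c (c.coord (γ s), (p, s))) s) :
    IsIntegralAt A p γ s := by
  refine ⟨hc, hp, fun c' hs' => ?_⟩
  have hov : (c.coord (γ s), h (p, s)) ∈ c.overlap c' := by
    rw [← hp.self_of_nhds]; exact mem_overlap hs hs'
  have hT := (contDiffAt_changeAlong hh hov).differentiableAt (by simp)
  have h1 := hT.hasFDerivAt.comp_hasDerivAt s (f := fun s' => (c.coord (γ s'), s'))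
    (hd.prodMk (hasDerivAt_id s))
  have hval : ∀ s', γ s' ∈ c.toHomeo.source → F.proj (γ s') = h (p, s') →
      c.changeAlong c' h p (c.coord (γ s'), s') = c'.coord (γ s') := by
    intro s' hs'' hp'
    simp only [changeAlong, change]
    rw [← hp', pt_coord hs'']
  rw [← A.compat c c' _ _ _ hov, hval s hs hp.self_of_nhds] at h1
  refine h1.congr_of_eventuallyEq ?_
  filter_upwards [hp, hc.eventually (c.toHomeo.open_source.mem_nhds hs)] with s' h2 h3
  exact (hval s' h3 h2).symm

theorem IsIntegralAt.congr (hγ : IsIntegralAt A p γ s) (he : γ' =ᶠ[𝓝 s] γ) :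
    IsIntegralAt A p γ' s := by
  refine ⟨hγ.continuousAt.congr he.symm, ?_, fun c hc => ?_⟩
  · filter_upwards [hγ.proj_eq, he] with s' h1 h2
    rw [h2, h1]
  · rw [he.self_of_nhds] at hc ⊢
    exact (hγ.deriv c hc).congr_of_eventuallyEq (he.fun_comp c.coord)

theorem contDiffAt_coef (hh : ContMDiff (IP.prod 𝓘(ℝ, ℝ)) I ∞ h) (A : LiftField IP F h)
    {c : F.ProductChart} {e : E} (hz : (e, (p, s)) ∈ c.dom h) :
    ContDiffAt ℝ ∞ (fun z : E × ℝ => A.coef c (z.1, (p, z.2))) (e, s) :=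
  contDiffAt_of_contMDiffOn (isOpen_dom hh.continuous c) (A.smooth c) hz

/-- Integral curves that meet agree nearby. -/
theorem IsIntegralAt.eventuallyEq [FiniteDimensional ℝ E]
    (hh : ContMDiff (IP.prod 𝓘(ℝ, ℝ)) I ∞ h)
    (hγ : ∀ᶠ s' in 𝓝 s, IsIntegralAt A p γ s') (hγ' : ∀ᶠ s' in 𝓝 s, IsIntegralAt A p γ' s')
    (heq : γ s = γ' s) : γ =ᶠ[𝓝 s] γ' := by
  obtain ⟨c, hc⟩ := F.exists_productChart (γ s)
  have hdom : (c.coord (γ s), (p, s)) ∈ c.dom h := by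
    have := mem_target hc
    rwa [hγ.self_of_nhds.proj] at this
  have hv : ContDiffAt ℝ 1 (fun z : E × ℝ => (A.coef c (z.1, (p, z.2)), (1 : ℝ)))
      (c.coord (γ s), s) :=
    ((contDiffAt_coef hh A hdom).of_le (by exact_mod_cast le_top)).prodMk contDiffAt_const
  have key : ∀ γ₁ : ℝ → N, (∀ᶠ s' in 𝓝 s, IsIntegralAt A p γ₁ s') → γ₁ s ∈ c.toHomeo.source →
      ∀ᶠ s' in 𝓝 s, γ₁ s' ∈ c.toHomeo.source ∧ HasDerivAt (fun s' => (c.coord (γ₁ s'), s'))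
        (A.coef c (c.coord (γ₁ s'), (p, s')), (1 : ℝ)) s' := by
    intro γ₁ h1 h2
    filter_upwards [h1, h1.self_of_nhds.continuousAt.eventually
      (c.toHomeo.open_source.mem_nhds h2)] with s' h3 h4
    exact ⟨h4, (h3.deriv c h4).prodMk (hasDerivAt_id s')⟩
  have h1 := key γ hγ hc
  have h2 := key γ' hγ' (heq ▸ hc)
  have h3 := eventuallyEq_of_hasDerivAt_of_contDiffAt
    (γ₁ := fun s' => (c.coord (γ s'), s')) (γ₂ := fun s' => (c.coord (γ' s'), s'))
    hv (h1.mono fun _ h => h.2) (h2.mono fun _ h => h.2) (congrArg (fun q => (c.coord q, s)) heq)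
  filter_upwards [h1, h2, h3, hγ, hγ'] with s' h1 h2 h3 h4 h5
  rw [← pt_coord h1.1, ← pt_coord h2.1, h4.proj, h5.proj]
  exact congrArg (fun z : E × ℝ => c.pt (z.1, h (p, s'))) h3

/-- Uniqueness of integral curves. -/
theorem IsIntegralAt.eqOn [FiniteDimensional ℝ E] [T2Space N]
    (hh : ContMDiff (IP.prod 𝓘(ℝ, ℝ)) I ∞ h) {T : Set ℝ} (hT : IsOpen T) (hTc : IsPreconnected T)
    (hγ : ∀ s ∈ T, IsIntegralAt A p γ s) (hγ' : ∀ s ∈ T, IsIntegralAt A p γ' s)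
    {s₀ : ℝ} (hs₀ : s₀ ∈ T) (heq : γ s₀ = γ' s₀) : EqOn γ γ' T := by
  have hopen : IsOpen {s | s ∈ T ∧ γ s = γ' s} := by
    rw [isOpen_iff_mem_nhds]
    rintro s ⟨hs, he⟩
    have h1 := IsIntegralAt.eventuallyEq hh
      (Filter.mem_of_superset (hT.mem_nhds hs) hγ) (Filter.mem_of_superset (hT.mem_nhds hs) hγ') he
    filter_upwards [h1, hT.mem_nhds hs] with s' h2 h3 using ⟨h3, h2⟩
  have hopen' : IsOpen {s | s ∈ T ∧ γ s ≠ γ' s} := by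
    rw [isOpen_iff_mem_nhds]
    rintro s ⟨hs, he⟩
    have := ((hγ s hs).continuousAt.prodMk (hγ' s hs).continuousAt).eventually
      (isOpen_ne_fun continuous_fst continuous_snd |>.mem_nhds he)
    filter_upwards [this, hT.mem_nhds hs] with s' h2 h3 using ⟨h3, h2⟩
  intro s hs
  by_contra hne
  obtain ⟨x, hx, h1, h2⟩ := hTc _ _ hopen hopen' (fun x hx => by
    by_cases he : γ x = γ' x
    · exact Or.inl ⟨hx, he⟩
    · exact Or.inr ⟨hx, he⟩) ⟨s₀, hs₀, hs₀, heq⟩ ⟨s, hs, hs, hne⟩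
  exact h2.2 h1.2

end Lifts

open SmoothFamily.ProductChart

/-! ### Existence and smooth dependence of integral curves of a lift -/

section Flow

variable {E EB HB EN HN B N : Type*}
  [NormedAddCommGroup E] [NormedSpace ℝ E] [FiniteDimensional ℝ E]
  [NormedAddCommGroup EB] [NormedSpace ℝ EB] [TopologicalSpace HB]
  [NormedAddCommGroup EN] [NormedSpace ℝ EN] [TopologicalSpace HN]
  {I : ModelWithCorners ℝ EB HB} {J : ModelWithCorners ℝ EN HN}
  [TopologicalSpace B] [ChartedSpace HB B] [TopologicalSpace N] [ChartedSpace HN N]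
  {EP HP P : Type*} [NormedAddCommGroup EP] [NormedSpace ℝ EP] [FiniteDimensional ℝ EP]
  [TopologicalSpace HP]
  {IP : ModelWithCorners ℝ EP HP} [TopologicalSpace P] [ChartedSpace HP P] [IsManifold IP ∞ P]
  {F : SmoothFamily E I J N B} {h : P × ℝ → B}

/-- The local flow of a lift, together with the integral of a function along the flow lines, in a
product chart. The components of the state in `E × (ℝ × ℝ)` are the fibre coordinate, the time and
the integral. -/
theorem exists_local_integral_flow (n : ℕ) (hh : ContMDiff (IP.prod 𝓘(ℝ, ℝ)) I ∞ h)
    (A : LiftField IP F h) {g : N → P × ℝ → ℝ} (hg : IsSmoothOnPullback IP F h g)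
    (c : F.ProductChart) {q₀ : N} {p₀ : P} {s₀ : ℝ} (hq₀ : q₀ ∈ c.toHomeo.source)
    (h₀ : F.proj q₀ = h (p₀, s₀)) {G : Set N} (hG : G ∈ 𝓝 q₀) :
    ∃ ε > 0, ∃ W ∈ 𝓝 ((c.coord q₀, (s₀, (0 : ℝ))), p₀), ∃ φ : ((E × (ℝ × ℝ)) × P) × ℝ → E × (ℝ × ℝ),
      ContMDiffOn ((𝓘(ℝ, E × (ℝ × ℝ)).prod IP).prod 𝓘(ℝ, ℝ)) 𝓘(ℝ, E × (ℝ × ℝ)) n φ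
        (W ×ˢ Ioo (-ε) ε) ∧
      ∀ q p s, F.proj q = h (p, s) → q ∈ c.toHomeo.source → ((c.coord q, (s, 0)), p) ∈ W →
        ∃ γ : ℝ → N, γ s = q ∧ ∀ s' ∈ Ioo (s - ε) (s + ε), IsIntegralAt A p γ s' ∧
          γ s' ∈ c.toHomeo.source ∧ γ s' ∈ G ∧
          c.coord (γ s') = (φ (((c.coord q, (s, 0)), p), s' - s)).1 ∧
          ∫ u in s..s', g (γ u) (p, u) = (φ (((c.coord q, (s, 0)), p), s' - s)).2.2 := by
  obtain ⟨G', hG'G, hG'o, hqG'⟩ := mem_nhds_iff.1 hG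
  set O : Set ((E × (ℝ × ℝ)) × P) := {z | (z.1.1, (z.2, z.1.2.1)) ∈ c.dom h ∧
    c.pt (z.1.1, h (z.2, z.1.2.1)) ∈ G'} with hO
  have hproj : Continuous fun z : (E × (ℝ × ℝ)) × P => (z.1.1, (z.2, z.1.2.1)) := by fun_prop
  have hOo : IsOpen O := by
    have h1 : IsOpen (c.toHomeo.target ∩ c.pt ⁻¹' G') :=
      c.toHomeo.symm.isOpen_inter_preimage hG'o
    exact h1.preimage ((contMDiff_lift (E := E) hh).continuous.comp hproj)
  have hprojm : ContMDiff (𝓘(ℝ, E × (ℝ × ℝ)).prod IP) (𝓘(ℝ, E).prod (IP.prod 𝓘(ℝ, ℝ))) ∞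
      fun z : (E × (ℝ × ℝ)) × P => (z.1.1, (z.2, z.1.2.1)) := by
    have h1 : ContMDiff 𝓘(ℝ, E × (ℝ × ℝ)) 𝓘(ℝ, E) ∞ (fun z : E × (ℝ × ℝ) => z.1) :=
      contDiff_fst.contMDiff
    have h2 : ContMDiff 𝓘(ℝ, E × (ℝ × ℝ)) 𝓘(ℝ, ℝ) ∞ (fun z : E × (ℝ × ℝ) => z.2.1) :=
      (contDiff_fst.comp contDiff_snd).contMDiff
    exact (h1.comp contMDiff_fst).prodMk (contMDiff_snd.prodMk (h2.comp contMDiff_fst))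
  set v : (E × (ℝ × ℝ)) × P → E × (ℝ × ℝ) := fun z => (A.coef c (z.1.1, (z.2, z.1.2.1)),
    ((1 : ℝ), g (c.pt (z.1.1, h (z.2, z.1.2.1))) (z.2, z.1.2.1))) with hv
  have hvO : ContMDiffOn (𝓘(ℝ, E × (ℝ × ℝ)).prod IP) 𝓘(ℝ, E × (ℝ × ℝ)) ∞ v O :=
    ((A.smooth c).comp hprojm.contMDiffOn fun z hz => hz.1).prodMk_space
      (contMDiffOn_const.prodMk_space ((hg c).comp hprojm.contMDiffOn fun z hz => hz.1))
  have h₀O : ((c.coord q₀, (s₀, (0 : ℝ))), p₀) ∈ O := by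
    have h1 := mem_target hq₀
    have h2 := pt_coord hq₀
    rw [h₀] at h1 h2
    exact ⟨h1, by simp only; rwa [h2]⟩
  obtain ⟨ε, hε, W, hW, φ, hφ, hφn⟩ := exists_local_flow n hOo hvO h₀O
  refine ⟨ε, hε, W, hW, φ, hφn, fun q p s hq hqc hqW => ?_⟩
  set z : (E × (ℝ × ℝ)) × P := ((c.coord q, (s, 0)), p) with hz
  obtain ⟨hφ0, hφd⟩ := hφ z hqW
  have hI0 : (0 : ℝ) ∈ Ioo (-ε) ε := ⟨by linarith, hε⟩
  have hφ0' : φ (z, 0) = (c.coord q, (s, 0)) := hφ0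
  -- the second component of the state is the time
  have htime : ∀ r ∈ Ioo (-ε) ε, (φ (z, r)).2.1 = s + r := by
    have h1 : ∀ r ∈ Ioo (-ε) ε, HasDerivAt (fun r => (φ (z, r)).2.1) 1 r := fun r hr => by
      have := (hφd r hr).2.hasFDerivAt.snd.fst.hasDerivAt
      simpa [hv] using this
    have h2 : ∀ r ∈ Ioo (-ε) ε, HasDerivAt (fun r => s + r) 1 r := fun r _ =>
      (hasDerivAt_id r).const_add s
    refine isOpen_Ioo.eqOn_of_deriv_eq isPreconnected_Ioo
      (fun r hr => (h1 r hr).differentiableAt.differentiableWithinAt)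
      (fun r hr => (h2 r hr).differentiableAt.differentiableWithinAt)
      (fun r hr => by rw [(h1 r hr).deriv, (h2 r hr).deriv]) hI0 ?_
    simp [hφ0']
  set γ : ℝ → N := fun s' => c.pt ((φ (z, s' - s)).1, h (p, s')) with hγ
  have hshift : ∀ s' ∈ Ioo (s - ε) (s + ε), s' - s ∈ Ioo (-ε) ε := fun s' hs' =>
    ⟨by linarith [hs'.1], by linarith [hs'.2]⟩
  have hmem : ∀ s' ∈ Ioo (s - ε) (s + ε),
      ((φ (z, s' - s)).1, h (p, s')) ∈ c.toHomeo.target ∧ γ s' ∈ G' := by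
    intro s' hs'
    have h1 := (hφd _ (hshift s' hs')).1
    have h2 := htime _ (hshift s' hs')
    rw [add_sub_cancel] at h2
    simp only [hO, mem_ofPred_eq, h2] at h1
    exact h1
  have hcoord : ∀ s' ∈ Ioo (s - ε) (s + ε), c.coord (γ s') = (φ (z, s' - s)).1 := fun s' hs' =>
    coord_pt (hmem s' hs').1
  have hder : ∀ s' ∈ Ioo (s - ε) (s + ε), HasDerivAt (fun s' => φ (z, s' - s))
      (A.coef c ((φ (z, s' - s)).1, (p, s')), ((1 : ℝ), g (γ s') (p, s'))) s' := by
    intro s' hs'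
    have h1 := (hφd _ (hshift s' hs')).2.comp_sub_const s' s
    have h2 := htime _ (hshift s' hs')
    rw [add_sub_cancel] at h2
    simpa only [hv, h2] using h1
  have hint : ∀ s' ∈ Ioo (s - ε) (s + ε), IsIntegralAt A p γ s' := by
    intro s' hs'
    have hev : ∀ᶠ s'' in 𝓝 s', s'' ∈ Ioo (s - ε) (s + ε) := Ioo_mem_nhds hs'.1 hs'.2
    refine IsIntegralAt.of_chart hh ?_ ?_ c (pt_mem (hmem s' hs').1) ?_
    · refine ContinuousAt.comp (g := c.pt) (continuousAt_pt (hmem s' hs').1) ?_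
      have h1 : Continuous fun s' : ℝ => h (p, s') := hh.continuous.comp (by fun_prop)
      exact ((hder s' hs').continuousAt.fst).prodMk h1.continuousAt
    · filter_upwards [hev] with s'' hs'' using proj_pt (hmem s'' hs'').1
    · rw [hcoord s' hs']
      have h1 := (hder s' hs').hasFDerivAt.fst.hasDerivAt
      have h2 : HasDerivAt (fun s' => (φ (z, s' - s)).1) (A.coef c ((φ (z, s' - s)).1, (p, s')))
          s' := by simpa using h1
      refine h2.congr_of_eventuallyEq ?_
      filter_upwards [hev] with s'' hs'' using hcoord s'' hs''
  refine ⟨γ, ?_, fun s' hs' => ⟨hint s' hs', pt_mem (hmem s' hs').1, hG'G (hmem s' hs').2,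
    hcoord s' hs', ?_⟩⟩
  · simp only [hγ, sub_self, hφ0']
    rw [← hq, pt_coord hqc]
  · have hsub : uIcc s s' ⊆ Ioo (s - ε) (s + ε) :=
      ordConnected_Ioo.uIcc_subset ⟨by linarith, by linarith⟩ hs'
    have h1 : ∀ u ∈ uIcc s s', HasDerivAt (fun u => (φ (z, u - s)).2.2) (g (γ u) (p, u)) u := by
      intro u hu
      have := (hder u (hsub hu)).hasFDerivAt.snd.snd.hasDerivAt
      simpa using this
    have h2 : ContinuousOn (fun u => g (γ u) (p, u)) (uIcc s s') := by
      have h3 : ContinuousOn (fun u => ((φ (z, u - s)).1, (p, u))) (uIcc s s') := fun u hu =>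
        ((hder u (hsub hu)).continuousAt.fst.prodMk
          (continuousAt_const.prodMk continuousAt_id)).continuousWithinAt
      exact (hg c).continuousOn.comp h3 fun u hu => (hmem u (hsub hu)).1
    rw [intervalIntegral.integral_eq_sub_of_hasDerivAt h1 h2.intervalIntegrable]
    simp [hφ0']

/-- Through every point there passes an integral curve for a short time, uniformly near the point
and staying in a prescribed neighbourhood. -/
theorem exists_local_integral_curve (hh : ContMDiff (IP.prod 𝓘(ℝ, ℝ)) I ∞ h)
    (A : LiftField IP F h) {q₀ : N} {p₀ : P} {s₀ : ℝ}
    (h₀ : F.proj q₀ = h (p₀, s₀)) {G : Set N} (hG : G ∈ 𝓝 q₀) :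
    ∃ ε > 0, ∀ᶠ z : N × ℝ in 𝓝 (q₀, s₀), F.proj z.1 = h (p₀, z.2) →
      ∃ γ : ℝ → N, γ z.2 = z.1 ∧ ∀ s' ∈ Ioo (z.2 - ε) (z.2 + ε),
        IsIntegralAt A p₀ γ s' ∧ γ s' ∈ G := by
  obtain ⟨c, hc⟩ := F.exists_productChart q₀
  obtain ⟨ε, hε, W, hW, φ, -, H⟩ := exists_local_integral_flow 0 hh A
    (g := fun _ _ => 0) (fun c => contMDiffOn_const) c hc h₀ hG
  refine ⟨ε, hε, ?_⟩
  have h1 : ContinuousAt (fun z : N × ℝ => ((c.coord z.1, (z.2, (0 : ℝ))), p₀)) (q₀, s₀) := by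
    have : ContinuousAt (fun z : N × ℝ => c.coord z.1) (q₀, s₀) :=
      ContinuousAt.comp (g := c.coord) (f := Prod.fst) (continuousAt_coord hc) continuousAt_fst
    exact (this.prodMk (continuousAt_snd.prodMk continuousAt_const)).prodMk continuousAt_const
  have h2 : ∀ᶠ z : N × ℝ in 𝓝 (q₀, s₀), z.1 ∈ c.toHomeo.source :=
    continuousAt_fst.eventually (c.toHomeo.open_source.mem_nhds hc)
  filter_upwards [h1.eventually hW, h2] with z hz1 hz2 hz3
  obtain ⟨γ, hγ, hγ'⟩ := H z.1 p₀ z.2 hz3 hz2 hz1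
  exact ⟨γ, hγ, fun s' hs' => ⟨(hγ' s' hs').1, (hγ' s' hs').2.2.1⟩⟩

variable {EY HY Y : Type*} [NormedAddCommGroup EY] [NormedSpace ℝ EY] [TopologicalSpace HY]
  {IY : ModelWithCorners ℝ EY HY} [TopologicalSpace Y] [ChartedSpace HY Y]

/-- Smooth dependence for short times, uniformly in the initial time: near every time `s₁` there is
a time interval such that smoothness at one time of the interval implies smoothness on the whole
interval. -/
theorem exists_forall_contMDiffAt_integralCurve (n : ℕ)
    (hh : ContMDiff (IP.prod 𝓘(ℝ, ℝ)) I ∞ h) [T2Space N]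
    {A : LiftField IP F h} {g : N → P × ℝ → ℝ} (hg : IsSmoothOnPullback IP F h g)
    {γ : Y → ℝ → N} {τ : Y → P} {y₀ : Y} {T : Set ℝ} (hT : IsOpen T)
    (hγ : ∀ᶠ y in 𝓝 y₀, ∀ s ∈ T, IsIntegralAt A (τ y) (γ y) s)
    (hτ : ContMDiffAt IY IP n τ y₀) {s₁ : ℝ} (hs₁ : s₁ ∈ T) :
    ∃ δ > 0, ∀ σ : Y → ℝ, ContMDiffAt IY 𝓘(ℝ, ℝ) n σ y₀ →
      ContMDiffAt IY J n (fun y => γ y (σ y)) y₀ → σ y₀ ∈ Ioo (s₁ - δ) (s₁ + δ) →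
      ∀ s ∈ Ioo (s₁ - δ) (s₁ + δ), s ∈ T ∧
        ContMDiffAt (IY.prod 𝓘(ℝ, ℝ)) J n (fun z : Y × ℝ => γ z.1 z.2) (y₀, s) ∧
        ContMDiffAt (IY.prod 𝓘(ℝ, ℝ)) 𝓘(ℝ, ℝ) n
          (fun z : Y × ℝ => ∫ u in σ z.1..z.2, g (γ z.1 u) (τ z.1, u)) (y₀, s) := by
  have hγ₀ := hγ.self_of_nhds
  obtain ⟨c, hc⟩ := F.exists_productChart (γ y₀ s₁)
  obtain ⟨ε, hε, W, hW, φ, hφn, H⟩ := exists_local_integral_flow n hh A hg c hc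
    (hγ₀ s₁ hs₁).proj (univ_mem)
  obtain ⟨W', hW'W, hW'o, hW'⟩ := mem_nhds_iff.1 hW
  obtain ⟨δ₁, hδ₁, hδT⟩ := Metric.isOpen_iff.1 hT s₁ hs₁
  have hcont : ContinuousAt (fun s => ((c.coord (γ y₀ s), (s, (0 : ℝ))), τ y₀)) s₁ := by
    have : ContinuousAt (fun s => c.coord (γ y₀ s)) s₁ :=
      ContinuousAt.comp (g := c.coord) (continuousAt_coord hc) (hγ₀ s₁ hs₁).continuousAt
    exact (this.prodMk (continuousAt_id.prodMk continuousAt_const)).prodMk continuousAt_const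
  have hnear := (hcont.eventually (hW'o.mem_nhds hW')).and
    ((hγ₀ s₁ hs₁).continuousAt.eventually (c.toHomeo.open_source.mem_nhds hc))
  obtain ⟨δ₂, hδ₂, hδW⟩ := Metric.eventually_nhds_iff_ball.1 hnear
  set δ := min (min δ₁ δ₂) (ε / 2) with hδ
  have hδ0 : 0 < δ := by positivity
  have hδ1 : δ ≤ δ₁ := (min_le_left _ _).trans (min_le_left _ _)
  have hδ2 : δ ≤ δ₂ := (min_le_left _ _).trans (min_le_right _ _)
  have hδ3 : δ ≤ ε / 2 := min_le_right _ _
  have hTδ : ∀ s ∈ Ioo (s₁ - δ) (s₁ + δ), s ∈ T := fun s hs => hδT (by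
    rw [Real.ball_eq_Ioo]; exact ⟨by linarith [hs.1], by linarith [hs.2]⟩)
  refine ⟨δ, hδ0, fun σ hσ hγσ hσδ s hs => ⟨hTδ s hs, ?_⟩⟩
  have hσW := hδW (σ y₀) (by
    rw [Real.ball_eq_Ioo]; exact ⟨by linarith [hσδ.1], by linarith [hσδ.2]⟩)
  have hcs : ContMDiffAt IY 𝓘(ℝ, E) n (fun y => c.coord (γ y (σ y))) y₀ :=
    ContMDiffAt.comp (g := c.coord) y₀ (((contMDiffOn_coord (c := c)).contMDiffAt
      (c.toHomeo.open_source.mem_nhds hσW.2)).of_le (by exact_mod_cast le_top)) hγσ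
  -- the initial data of the local flow
  set D : Y × ℝ → ((E × (ℝ × ℝ)) × P) × ℝ := fun z =>
    (((c.coord (γ z.1 (σ z.1)), (σ z.1, 0)), τ z.1), z.2 - σ z.1) with hD
  have hfst : ContMDiffAt (IY.prod 𝓘(ℝ, ℝ)) IY n (Prod.fst : Y × ℝ → Y) (y₀, s) :=
    contMDiffAt_fst
  have hσ' : ContMDiffAt (IY.prod 𝓘(ℝ, ℝ)) 𝓘(ℝ, ℝ) n (fun z : Y × ℝ => σ z.1) (y₀, s) :=
    ContMDiffAt.comp (g := σ) (y₀, s) hσ hfst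
  have hτ' : ContMDiffAt (IY.prod 𝓘(ℝ, ℝ)) IP n (fun z : Y × ℝ => τ z.1) (y₀, s) :=
    ContMDiffAt.comp (g := τ) (y₀, s) hτ hfst
  have hDs : ContMDiffAt (IY.prod 𝓘(ℝ, ℝ)) ((𝓘(ℝ, E × (ℝ × ℝ)).prod IP).prod 𝓘(ℝ, ℝ)) n D
      (y₀, s) := by
    refine ((ContMDiffAt.prodMk_space ?_ (hσ'.prodMk_space contMDiffAt_const)).prodMk
      hτ').prodMk (contMDiffAt_snd.sub hσ')
    exact ContMDiffAt.comp (g := fun y => c.coord (γ y (σ y))) (y₀, s) hcs hfst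
  have hDmem : D (y₀, s) ∈ W' ×ˢ Ioo (-ε) ε :=
    ⟨hσW.1, by simp only [hD]; linarith [hσδ.2, hs.1], by simp only [hD]; linarith [hσδ.1, hs.2]⟩
  have hφD : ContMDiffAt (IY.prod 𝓘(ℝ, ℝ)) 𝓘(ℝ, E × (ℝ × ℝ)) n (fun z => φ (D z)) (y₀, s) :=
    ContMDiffAt.comp (g := φ) (y₀, s) (hφn.contMDiffAt (Filter.mem_of_superset
      ((hW'o.prod isOpen_Ioo).mem_nhds hDmem) (prod_mono hW'W subset_rfl))) hDs
  have hev : ∀ᶠ z : Y × ℝ in 𝓝 (y₀, s), D z ∈ W' ×ˢ Ioo (-ε) ε :=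
    hDs.continuousAt.eventually ((hW'o.prod isOpen_Ioo).mem_nhds hDmem)
  have hev2 : ∀ᶠ z : Y × ℝ in 𝓝 (y₀, s), γ z.1 (σ z.1) ∈ c.toHomeo.source :=
    Filter.Tendsto.eventually (f := fun z : Y × ℝ => γ z.1 (σ z.1))
      (ContinuousAt.comp (g := fun y => γ y (σ y)) (f := Prod.fst) hγσ.continuousAt
        continuousAt_fst) (c.toHomeo.open_source.mem_nhds hσW.2)
  have hev3 : ∀ᶠ z : Y × ℝ in 𝓝 (y₀, s), z.2 ∈ Ioo (s₁ - δ) (s₁ + δ) :=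
    continuousAt_snd.eventually (Ioo_mem_nhds hs.1 hs.2)
  have hev4 : ∀ᶠ z : Y × ℝ in 𝓝 (y₀, s), σ z.1 ∈ Ioo (s₁ - δ) (s₁ + δ) :=
    hσ'.continuousAt.eventually (Ioo_mem_nhds hσδ.1 hσδ.2)
  have hev5 : ∀ᶠ z : Y × ℝ in 𝓝 (y₀, s), ∀ s ∈ T, IsIntegralAt A (τ z.1) (γ z.1) s :=
    (continuousAt_fst (p := (y₀, s))).tendsto.eventually
      (p := fun y => ∀ s ∈ T, IsIntegralAt A (τ y) (γ y) s) hγ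
  have main : ∀ᶠ z : Y × ℝ in 𝓝 (y₀, s),
      ((φ (D z)).1, h (τ z.1, z.2)) ∈ c.toHomeo.target ∧
      γ z.1 z.2 = c.pt ((φ (D z)).1, h (τ z.1, z.2)) ∧
      ∫ u in σ z.1..z.2, g (γ z.1 u) (τ z.1, u) = (φ (D z)).2.2 := by
    filter_upwards [hev, hev2, hev3, hev4, hev5] with z h1 h2 h3 h4 h5
    obtain ⟨η, hη, hη'⟩ := H _ (τ z.1) (σ z.1) (h5 _ (hTδ _ h4)).proj h2 (hW'W h1.1)
    set T' := Ioo (s₁ - δ) (s₁ + δ) with hT'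
    have hsub : ∀ u ∈ T', u ∈ Ioo (σ z.1 - ε) (σ z.1 + ε) := fun u hu =>
      ⟨by linarith [hu.1, h4.2], by linarith [hu.2, h4.1]⟩
    have heq : EqOn (γ z.1) η T' := IsIntegralAt.eqOn hh isOpen_Ioo isPreconnected_Ioo
      (fun u hu => h5 u (hTδ u hu)) (fun u hu => (hη' u (hsub u hu)).1) h4 hη.symm
    obtain ⟨hi, hm, -, hco, hin⟩ := hη' z.2 (hsub _ h3)
    have hpt := pt_coord hm
    have htg := mem_target hm
    rw [hi.proj, hco] at hpt htg
    refine ⟨htg, by rw [heq h3]; exact hpt.symm, ?_⟩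
    rw [← hin]
    refine intervalIntegral.integral_congr fun u hu => ?_
    have : u ∈ T' := ordConnected_Ioo.uIcc_subset h4 h3 hu
    simp only [heq this]
  constructor
  · refine ContMDiffAt.congr_of_eventuallyEq (f := fun z : Y × ℝ =>
      c.pt ((φ (D z)).1, h (τ z.1, z.2))) ?_ (main.mono fun z hz => hz.2.1)
    refine ContMDiffAt.comp (g := c.pt) (y₀, s) (((contMDiffOn_pt (c := c)).contMDiffAt
      (c.toHomeo.open_target.mem_nhds main.self_of_nhds.1)).of_le (by exact_mod_cast le_top)) ?_
    refine ContMDiffAt.prodMk ?_ ?_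
    · exact ContMDiffAt.comp (g := fun x : E × (ℝ × ℝ) => x.1) (y₀, s)
        contDiff_fst.contMDiff.contMDiffAt hφD
    · exact ContMDiffAt.comp (g := h) (y₀, s) (hh.contMDiffAt.of_le (by exact_mod_cast le_top))
        (hτ'.prodMk contMDiffAt_snd)
  · refine ContMDiffAt.congr_of_eventuallyEq (f := fun z : Y × ℝ => (φ (D z)).2.2) ?_
      (main.mono fun z hz => hz.2.2)
    exact ContMDiffAt.comp (g := fun x : E × (ℝ × ℝ) => x.2.2) (y₀, s)
      (contDiff_snd.snd.contMDiff.contMDiffAt) hφD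

theorem IsIntegralAt.continuousAt_integrand (hh : Continuous h) {A : LiftField IP F h}
    {g : N → P × ℝ → ℝ} (hg : IsSmoothOnPullback IP F h g) {p : P} {γ : ℝ → N} {s : ℝ}
    (hγ : IsIntegralAt A p γ s) : ContinuousAt (fun u => g (γ u) (p, u)) s := by
  obtain ⟨c, hc⟩ := F.exists_productChart (γ s)
  have hdom : (c.coord (γ s), (p, s)) ∈ c.dom h := by
    have := mem_target hc
    rwa [hγ.proj] at this
  have h1 : ContinuousAt (fun u => (c.coord (γ u), (p, u))) s :=
    ((continuousAt_coord hc).comp hγ.continuousAt).prodMk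
      (continuousAt_const.prodMk continuousAt_id)
  have h2 := ContinuousAt.comp (f := fun u => (c.coord (γ u), (p, u)))
    ((hg c).continuousOn.continuousAt ((isOpen_dom hh c).mem_nhds hdom)) h1
  refine h2.congr ?_
  filter_upwards [hγ.proj_eq, hγ.continuousAt.eventually (c.toHomeo.open_source.mem_nhds hc)]
    with u h3 h4
  simp only [Function.comp]
  rw [← h3, pt_coord h4]

/-- Smooth dependence of integral curves, and of integrals along them, on the initial data. -/
theorem contMDiffAt_integralCurve (hh : ContMDiff (IP.prod 𝓘(ℝ, ℝ)) I ∞ h) [T2Space N]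
    {A : LiftField IP F h} {g : N → P × ℝ → ℝ} (hg : IsSmoothOnPullback IP F h g)
    {γ : Y → ℝ → N} {τ : Y → P} {y₀ : Y} {T : Set ℝ} (hT : IsOpen T) (hTo : T.OrdConnected)
    (hγ : ∀ᶠ y in 𝓝 y₀, ∀ s ∈ T, IsIntegralAt A (τ y) (γ y) s)
    (hτ : ContMDiffAt IY IP ∞ τ y₀) {σ : Y → ℝ} (hσ : ContMDiffAt IY 𝓘(ℝ, ℝ) ∞ σ y₀)
    (hσT : σ y₀ ∈ T) (hγσ : ContMDiffAt IY J ∞ (fun y => γ y (σ y)) y₀) {s : ℝ} (hs : s ∈ T) :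
    ContMDiffAt (IY.prod 𝓘(ℝ, ℝ)) J ∞ (fun z : Y × ℝ => γ z.1 z.2) (y₀, s) ∧
      ContMDiffAt (IY.prod 𝓘(ℝ, ℝ)) 𝓘(ℝ, ℝ) ∞
        (fun z : Y × ℝ => ∫ u in σ z.1..z.2, g (γ z.1 u) (τ z.1, u)) (y₀, s) := by
  rw [contMDiffAt_infty, contMDiffAt_infty, ← forall_and]
  intro n
  have hn : (n : WithTop ℕ∞) ≤ ∞ := by exact_mod_cast le_top
  have hτn := hτ.of_le hn
  -- the times at which both claims hold form a nonempty open and closed subset of `T`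
  set S : Set ℝ := {s | ContMDiffAt (IY.prod 𝓘(ℝ, ℝ)) J n (fun z : Y × ℝ => γ z.1 z.2) (y₀, s) ∧
    ContMDiffAt (IY.prod 𝓘(ℝ, ℝ)) 𝓘(ℝ, ℝ) n
      (fun z : Y × ℝ => ∫ u in σ z.1..z.2, g (γ z.1 u) (τ z.1, u)) (y₀, s)} with hS
  have hloc : ∀ s₁ ∈ T, ∃ δ > 0, (∃ s' ∈ Ioo (s₁ - δ) (s₁ + δ), s' ∈ S) →
      ∀ s ∈ Ioo (s₁ - δ) (s₁ + δ), s ∈ S := by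
    intro s₁ hs₁
    obtain ⟨δ, hδ, H⟩ := exists_forall_contMDiffAt_integralCurve n hh hg hT hγ hτn hs₁
    refine ⟨δ, hδ, fun ⟨s', hs', hs'S⟩ s hs => ?_⟩
    have hpair : ContMDiffAt IY (IY.prod 𝓘(ℝ, ℝ)) n (fun y => (y, s')) y₀ :=
      contMDiffAt_id.prodMk contMDiffAt_const
    have h1 := H (fun _ => s') contMDiffAt_const
      (ContMDiffAt.comp (g := fun z : Y × ℝ => γ z.1 z.2) y₀ hs'S.1 hpair) hs'
    refine ⟨(h1 s hs).2.1, ?_⟩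
    have h2 : ContMDiffAt (IY.prod 𝓘(ℝ, ℝ)) 𝓘(ℝ, ℝ) n
        (fun z : Y × ℝ => ∫ u in σ z.1..s', g (γ z.1 u) (τ z.1, u)) (y₀, s) :=
      ContMDiffAt.comp (g := fun z : Y × ℝ => ∫ u in σ z.1..z.2, g (γ z.1 u) (τ z.1, u))
        (f := fun z : Y × ℝ => (z.1, s')) (y₀, s) hs'S.2
        (contMDiffAt_fst.prodMk contMDiffAt_const)
    refine (h2.add (h1 s hs).2.2).congr_of_eventuallyEq ?_
    have hev3 : ∀ᶠ z : Y × ℝ in 𝓝 (y₀, s), z.2 ∈ T :=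
      continuousAt_snd.eventually (hT.mem_nhds (h1 s hs).1)
    have hev4 : ∀ᶠ z : Y × ℝ in 𝓝 (y₀, s), σ z.1 ∈ T :=
      Filter.Tendsto.eventually (f := fun z : Y × ℝ => σ z.1)
        (ContinuousAt.comp (g := σ) (f := Prod.fst) hσ.continuousAt
        continuousAt_fst) (hT.mem_nhds hσT)
    have hev5 : ∀ᶠ z : Y × ℝ in 𝓝 (y₀, s), ∀ s ∈ T, IsIntegralAt A (τ z.1) (γ z.1) s :=
      (continuousAt_fst (p := (y₀, s))).tendsto.eventually
        (p := fun y => ∀ s ∈ T, IsIntegralAt A (τ y) (γ y) s) hγ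
    filter_upwards [hev3, hev4, hev5] with z h3 h4 h5
    have hc : ContinuousOn (fun u => g (γ z.1 u) (τ z.1, u)) T := fun u hu =>
      ((h5 u hu).continuousAt_integrand hh.continuous hg).continuousWithinAt
    have hs'T := (h1 s' hs').1
    exact (intervalIntegral.integral_add_adjacent_intervals
      (hc.mono (hTo.uIcc_subset h4 hs'T)).intervalIntegrable
      (hc.mono (hTo.uIcc_subset hs'T h3)).intervalIntegrable).symm
  have hstart : σ y₀ ∈ S := by
    obtain ⟨δ, hδ, H⟩ := exists_forall_contMDiffAt_integralCurve n hh hg hT hγ hτn hσT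
    have hm : σ y₀ ∈ Ioo (σ y₀ - δ) (σ y₀ + δ) := ⟨by linarith, by linarith⟩
    exact (H σ (hσ.of_le hn) (hγσ.of_le hn) hm _ hm).2
  have ho : IsOpen {s | s ∈ T ∧ s ∈ S} := by
    rw [isOpen_iff_mem_nhds]
    rintro s₁ ⟨hs₁, hs₁S⟩
    obtain ⟨δ, hδ, H⟩ := hloc s₁ hs₁
    filter_upwards [hT.mem_nhds hs₁, Ioo_mem_nhds (by linarith : s₁ - δ < s₁)
      (by linarith : s₁ < s₁ + δ)] with s h1 h2
    exact ⟨h1, H ⟨s₁, ⟨by linarith, by linarith⟩, hs₁S⟩ s h2⟩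
  have ho' : IsOpen {s | s ∈ T ∧ s ∉ S} := by
    rw [isOpen_iff_mem_nhds]
    rintro s₁ ⟨hs₁, hs₁S⟩
    obtain ⟨δ, hδ, H⟩ := hloc s₁ hs₁
    filter_upwards [hT.mem_nhds hs₁, Ioo_mem_nhds (by linarith : s₁ - δ < s₁)
      (by linarith : s₁ < s₁ + δ)] with s h1 h2
    exact ⟨h1, fun h3 => hs₁S (H ⟨s, h2, h3⟩ s₁ ⟨by linarith, by linarith⟩)⟩
  by_contra hns
  obtain ⟨x, -, h1, h2⟩ := hTo.isPreconnected _ _ ho ho' (fun x hx => by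
    by_cases hxS : x ∈ S
    · exact Or.inl ⟨hx, hxS⟩
    · exact Or.inr ⟨hx, hxS⟩) ⟨σ y₀, hσT, hσT, hstart⟩ ⟨s, hs, hs, hns⟩
  exact h2.2 h1.2

/-- If short integral curves exist uniformly over each time, then integral curves exist for all
times. -/
theorem exists_global_integralCurve (hh : ContMDiff (IP.prod 𝓘(ℝ, ℝ)) I ∞ h) [T2Space N]
    {A : LiftField IP F h} {p : P}
    (H : ∀ s₁ : ℝ, ∃ ε > 0, ∀ s ∈ Ioo (s₁ - ε) (s₁ + ε), ∀ q, F.proj q = h (p, s) →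
      ∃ γ : ℝ → N, γ s = q ∧ ∀ s' ∈ Ioo (s₁ - ε) (s₁ + ε), IsIntegralAt A p γ s')
    {q : N} {s₀ : ℝ} (hq : F.proj q = h (p, s₀)) :
    ∃ γ : ℝ → N, γ s₀ = q ∧ ∀ s, IsIntegralAt A p γ s := by
  -- the times which are reached form a nonempty open and closed set
  set S : Set ℝ := {s | ∃ (T : Set ℝ) (γ : ℝ → N), IsOpen T ∧ T.OrdConnected ∧ s₀ ∈ T ∧ s ∈ T ∧
    γ s₀ = q ∧ ∀ s ∈ T, IsIntegralAt A p γ s} with hS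
  have hloc : ∀ s₁ : ℝ, ∃ ε > 0, (∃ s' ∈ Ioo (s₁ - ε) (s₁ + ε), s' ∈ S) →
      ∀ s ∈ Ioo (s₁ - ε) (s₁ + ε), s ∈ S := by
    classical
    intro s₁
    obtain ⟨ε, hε, H⟩ := H s₁
    refine ⟨ε, hε, ?_⟩
    rintro ⟨s', hs', T, γ, hT, hTo, hs₀T, hs'T, hγq, hγ⟩ s hs
    obtain ⟨η, hη, hη'⟩ := H s' hs' (γ s') (hγ s' hs'T).proj
    set T' := Ioo (s₁ - ε) (s₁ + ε) with hT'
    have hoc : (T ∩ T').OrdConnected := hTo.inter ordConnected_Ioo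
    have heq : EqOn γ η (T ∩ T') := IsIntegralAt.eqOn hh (hT.inter isOpen_Ioo) hoc.isPreconnected
      (fun u hu => hγ u hu.1) (fun u hu => hη' u hu.2) ⟨hs'T, hs'⟩ hη.symm
    refine ⟨T ∪ T', T.piecewise γ η, hT.union isOpen_Ioo, ?_, Or.inl hs₀T, Or.inr hs,
      by rw [piecewise_eq_of_mem _ _ _ hs₀T, hγq], ?_⟩
    · exact (isPreconnected_iff_ordConnected.1 ((hTo.isPreconnected).union s' hs'T hs'
        isPreconnected_Ioo))
    · rintro u (hu | hu)
      · refine (hγ u hu).congr ?_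
        filter_upwards [hT.mem_nhds hu] with u' hu' using piecewise_eq_of_mem _ _ _ hu'
      · refine (hη' u hu).congr ?_
        filter_upwards [isOpen_Ioo.mem_nhds hu] with u' hu'
        by_cases hu'T : u' ∈ T
        · rw [piecewise_eq_of_mem _ _ _ hu'T, heq ⟨hu'T, hu'⟩]
        · rw [piecewise_eq_of_notMem _ _ _ hu'T]
  have hstart : s₀ ∈ S := by
    obtain ⟨ε, hε, H⟩ := H s₀
    have hm : s₀ ∈ Ioo (s₀ - ε) (s₀ + ε) := ⟨by linarith, by linarith⟩
    obtain ⟨γ, h1, h2⟩ := H s₀ hm q hq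
    exact ⟨_, γ, isOpen_Ioo, ordConnected_Ioo, hm, hm, h1, h2⟩
  have hSo : IsOpen S := by
    rw [isOpen_iff_mem_nhds]
    intro s₁ hs₁
    obtain ⟨ε, hε, H⟩ := hloc s₁
    filter_upwards [Ioo_mem_nhds (by linarith : s₁ - ε < s₁) (by linarith : s₁ < s₁ + ε)] with s h2
    exact H ⟨s₁, ⟨by linarith, by linarith⟩, hs₁⟩ s h2
  have hSc : IsClosed S := by
    rw [← isOpen_compl_iff, isOpen_iff_mem_nhds]
    intro s₁ hs₁
    obtain ⟨ε, hε, H⟩ := hloc s₁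
    filter_upwards [Ioo_mem_nhds (by linarith : s₁ - ε < s₁) (by linarith : s₁ < s₁ + ε)] with s h2
    exact fun h3 => hs₁ (H ⟨s, h2, h3⟩ s₁ ⟨by linarith, by linarith⟩)
  have hall : ∀ s, s ∈ S := fun s => by
    rw [IsClopen.eq_univ ⟨hSc, hSo⟩ ⟨s₀, hstart⟩]; trivial
  choose T γ hT hTo hs₀T hsT hγq hγ using hall
  refine ⟨fun s => γ s s, hγq s₀, fun s => (hγ s s (hsT s)).congr ?_⟩
  filter_upwards [(hT s).mem_nhds (hsT s)] with s' hs'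
  exact IsIntegralAt.eqOn hh ((hT s').inter (hT s)) ((hTo s').inter (hTo s)).isPreconnected
    (fun u hu => hγ s' u hu.1) (fun u hu => hγ s u hu.2) ⟨hs₀T s', hs₀T s⟩
    ((hγq s').trans (hγq s).symm) ⟨hsT s', hs'⟩

end Flow

-- spaces of iterated continuous linear maps need a deeper instance search
set_option maxSynthPendingDepth 3

/-! ### One-forms on vector spaces -/

section Forms

variable {V V' : Type*} [NormedAddCommGroup V] [NormedSpace ℝ V]
  [NormedAddCommGroup V'] [NormedSpace ℝ V']

/-- The exterior derivative of a one-form on a vector space, as a bilinear form. -/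
def dForm (l : V → V →L[ℝ] ℝ) (x : V) : V →L[ℝ] V →L[ℝ] ℝ :=
  fderiv ℝ l x - (fderiv ℝ l x).flip

theorem dForm_apply (l : V → V →L[ℝ] ℝ) (x a b : V) :
    dForm l x a b = fderiv ℝ l x a b - fderiv ℝ l x b a := rfl

theorem dForm_swap (l : V → V →L[ℝ] ℝ) (x a b : V) : dForm l x a b = -dForm l x b a := by
  simp [dForm_apply]

theorem dForm_self (l : V → V →L[ℝ] ℝ) (x a : V) : dForm l x a a = 0 := by
  simp [dForm_apply]

/-- The exterior derivative commutes with pull-backs. -/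
theorem dForm_pullback {l : V → V →L[ℝ] ℝ} {l' : V' → V' →L[ℝ] ℝ} {f : V → V'} {x : V}
    (hf : ContDiffAt ℝ 2 f x) (hl' : DifferentiableAt ℝ l' (f x))
    (hl : ∀ᶠ y in 𝓝 x, l y = (l' (f y)).comp (fderiv ℝ f y)) (a b : V) :
    dForm l x a b = dForm l' (f x) (fderiv ℝ f x a) (fderiv ℝ f x b) := by
  have hf1 : HasFDerivAt f (fderiv ℝ f x) x := (hf.differentiableAt (by simp)).hasFDerivAt
  have hf2 : HasFDerivAt (fderiv ℝ f) (fderiv ℝ (fderiv ℝ f) x) x :=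
    ((hf.fderiv_right (m := 1) (by norm_num)).differentiableAt (by simp)).hasFDerivAt
  have h1 := (hl'.hasFDerivAt.comp x hf1).clm_comp hf2
  have h2 : fderiv ℝ l x = _ := (h1.congr_of_eventuallyEq hl).fderiv
  have hsym : IsSymmSndFDerivAt ℝ f x := hf.isSymmSndFDerivAt (by simp)
  rw [dForm_apply, h2, dForm_apply]
  simp only [add_apply, ContinuousLinearMap.comp_apply,
    ContinuousLinearMap.compL_apply, ContinuousLinearMap.flip_apply, Function.comp]
  rw [hsym.eq a b]
  ring

variable (V) in
/-- Interchanging the arguments of a bilinear form, as a continuous linear map. -/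
def flipCLM : (V →L[ℝ] V →L[ℝ] ℝ) →L[ℝ] (V →L[ℝ] V →L[ℝ] ℝ) :=
  (ContinuousLinearMap.flipₗᵢ ℝ V V ℝ).toContinuousLinearEquiv

theorem contDiffAt_dForm {l : V → V →L[ℝ] ℝ} {x : V} (hl : ContDiffAt ℝ ∞ l x) :
    ContDiffAt ℝ ∞ (dForm l) x := by
  have h1 : ContDiffAt ℝ ∞ (fderiv ℝ l) x := hl.fderiv_right (by simp)
  have h2 : ContDiffAt ℝ ∞ (fun y => flipCLM V (fderiv ℝ l y)) x :=
    h1.continuousLinearMap_comp (flipCLM V)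
  exact h1.sub h2

/-- An exterior derivative is closed. -/
theorem fderiv_dForm_cyclic {l : V → V →L[ℝ] ℝ} {x : V} (hl : ContDiffAt ℝ ∞ l x) (a b c : V) :
    fderiv ℝ (dForm l) x a b c + fderiv ℝ (dForm l) x b c a + fderiv ℝ (dForm l) x c a b = 0 := by
  have h1 : ContDiffAt ℝ ∞ (fderiv ℝ l) x := hl.fderiv_right (by simp)
  have h2 : HasFDerivAt (fderiv ℝ l) (fderiv ℝ (fderiv ℝ l) x) x :=
    (h1.differentiableAt (by simp)).hasFDerivAt
  have h3 : HasFDerivAt (dForm l) (fderiv ℝ (fderiv ℝ l) x -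
      (flipCLM V).comp (fderiv ℝ (fderiv ℝ l) x)) x :=
    h2.sub (HasFDerivAt.comp (g := flipCLM V) (g' := flipCLM V) x (flipCLM V).hasFDerivAt h2)
  have h4 : fderiv ℝ (dForm l) x = _ := h3.fderiv
  have hsym : IsSymmSndFDerivAt ℝ l x :=
    (hl.of_le (m := 2) (WithTop.coe_le_coe.2 (le_top : (2 : ℕ∞) ≤ ⊤))).isSymmSndFDerivAt (by simp)
  have key : ∀ a b c, fderiv ℝ (dForm l) x a b c =
      fderiv ℝ (fderiv ℝ l) x a b c - fderiv ℝ (fderiv ℝ l) x a c b := by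
    intro a b c
    rw [h4]; rfl
  rw [key, key, key, hsym.eq a b, hsym.eq a c, hsym.eq b c]
  ring

/-- If `i_v dλ = 0`, `i_z dλ = λ` and `λ (v) = 0` near `x`, then the Lie bracket of `v` and `z`
lies in the kernel of `dλ`. -/
theorem dForm_bracket_eq_zero {l : V → V →L[ℝ] ℝ} {v z : V → V} {x : V}
    (hl : ContDiffAt ℝ ∞ l x) (hv : DifferentiableAt ℝ v x) (hz : DifferentiableAt ℝ z x)
    (h1 : ∀ᶠ y in 𝓝 x, dForm l y (v y) = 0) (h2 : ∀ᶠ y in 𝓝 x, dForm l y (z y) = l y)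
    (h3 : ∀ᶠ y in 𝓝 x, l y (v y) = 0) :
    dForm l x (fderiv ℝ z x (v x) - fderiv ℝ v x (z x)) = 0 := by
  have hω : HasFDerivAt (dForm l) (fderiv ℝ (dForm l) x) x :=
    ((contDiffAt_dForm hl).differentiableAt (by simp)).hasFDerivAt
  have hL : HasFDerivAt l (fderiv ℝ l x) x := (hl.differentiableAt (by simp)).hasFDerivAt
  have e1 := (hω.clm_apply hv.hasFDerivAt).unique
    ((hasFDerivAt_const (0 : V →L[ℝ] ℝ) x).congr_of_eventuallyEq h1)
  have e2 := (hω.clm_apply hz.hasFDerivAt).unique (hL.congr_of_eventuallyEq h2)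
  have e3 := (hL.clm_apply hv.hasFDerivAt).unique
    ((hasFDerivAt_const (0 : ℝ) x).congr_of_eventuallyEq h3)
  have E1 : ∀ a b, dForm l x (fderiv ℝ v x a) b + fderiv ℝ (dForm l) x a (v x) b = 0 := by
    intro a b
    simpa using congrArg (fun T => T a b) e1
  have E2 : ∀ a b, dForm l x (fderiv ℝ z x a) b + fderiv ℝ (dForm l) x a (z x) b
      = fderiv ℝ l x a b := by
    intro a b
    simpa using congrArg (fun T => T a b) e2
  have E3 : ∀ a, l x (fderiv ℝ v x a) + fderiv ℝ l x a (v x) = 0 := by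
    intro a
    simpa using congrArg (fun T => T a) e3
  have hsw : ∀ a b c, fderiv ℝ (dForm l) x a b c = - fderiv ℝ (dForm l) x a c b := by
    intro a b c
    have h4 : HasFDerivAt (fun y => dForm l y b c + dForm l y c b) _ x :=
      ((hω.clm_apply (hasFDerivAt_const b x)).clm_apply (hasFDerivAt_const c x)).add
      ((hω.clm_apply (hasFDerivAt_const c x)).clm_apply (hasFDerivAt_const b x))
    have h5 : (fun y => dForm l y b c + dForm l y c b) = fun _ => (0 : ℝ) := by
      ext y; rw [dForm_swap l y b c]; ring
    rw [h5] at h4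
    have := congrArg (fun T => T a) (h4.unique (hasFDerivAt_const (0 : ℝ) x))
    simp at this
    linarith
  ext w
  have c1 := fderiv_dForm_cyclic hl (v x) (z x) w
  have c2 := E2 (v x) w
  have c3 := E1 (z x) w
  have c4 := E1 w (z x)
  have c5 : dForm l x (z x) (fderiv ℝ v x w) = l x (fderiv ℝ v x w) := by rw [h2.self_of_nhds]
  have c6 := E3 w
  have c7 : dForm l x (v x) w = 0 := by rw [h1.self_of_nhds]; rfl
  rw [dForm_apply] at c7
  rw [dForm_swap] at c5
  have c8 := hsw (z x) w (v x)
  simp only [map_sub, sub_apply, zero_apply]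
  linarith

end Forms

/-! ### The forms and the Liouville field in product charts -/

section PartialDerivatives

variable {EM HM M V Y : Type*}
  [NormedAddCommGroup EM] [NormedSpace ℝ EM] [TopologicalSpace HM]
  {IM : ModelWithCorners ℝ EM HM} [TopologicalSpace M] [ChartedSpace HM M]
  [NormedAddCommGroup V] [NormedSpace ℝ V] [NormedAddCommGroup Y] [NormedSpace ℝ Y]

/-- Partial derivatives in the direction of a vector space are smooth. -/
theorem contMDiffAt_fderiv [IsManifold IM ∞ M] {f : M → V → Y} {g : M → V} {x : M}
    (hf : ContMDiffAt (IM.prod 𝓘(ℝ, V)) 𝓘(ℝ, Y) ∞ (Function.uncurry f) (x, g x))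
    (hg : ContMDiffAt IM 𝓘(ℝ, V) ∞ g x) :
    ContMDiffAt IM 𝓘(ℝ, V →L[ℝ] Y) ∞ (fun x => fderiv ℝ (f x) (g x)) x := by
  have : IsManifold IM 1 M := IsManifold.of_le (n := ∞)
    (WithTop.coe_le_coe.2 (le_top : (1 : ℕ∞) ≤ ⊤))
  have h := ContMDiffAt.mfderiv f g hf hg (m := ∞) (by simp)
  refine h.congr_of_eventuallyEq (Filter.Eventually.of_forall fun y => ?_)
  exact (mfderiv_eq_fderiv (f := f y) (x := g y)).symm.trans
    (congrFun (inTangentCoordinates_model_space g (fun x => f x (g x))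
      (fun x => mfderiv 𝓘(ℝ, V) 𝓘(ℝ, Y) (f x) (g x)) x) y).symm

/-- A nondegenerate bilinear form on a finite-dimensional space is an isomorphism onto the dual. -/
theorem isInvertible_of_nondegenerate [FiniteDimensional ℝ V] {b : V →L[ℝ] V →L[ℝ] ℝ}
    (h : ∀ v, (∀ w, b v w = 0) → v = 0) : b.IsInvertible := by
  have hinj : Function.Injective b := by
    rw [injective_iff_map_eq_zero]
    intro v hv
    exact h v fun w => by rw [hv]; rfl
  have hdim : Module.finrank ℝ V = Module.finrank ℝ (V →L[ℝ] ℝ) := by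
    rw [← (LinearMap.toContinuousLinearMap (𝕜 := ℝ) (E := V) (F' := ℝ)).finrank_eq]
    exact (Subspace.dual_finrank_eq (K := ℝ) (V := V)).symm
  refine ⟨(LinearEquiv.ofInjectiveOfFinrankEq (b : V →ₗ[ℝ] V →L[ℝ] ℝ) hinj
    hdim).toContinuousLinearEquiv, ?_⟩
  ext v w
  rfl

end PartialDerivatives

section ChartForms

variable {E EB HB EN HN B N : Type*}
  [NormedAddCommGroup E] [NormedSpace ℝ E]
  [NormedAddCommGroup EB] [NormedSpace ℝ EB] [TopologicalSpace HB]
  [NormedAddCommGroup EN] [NormedSpace ℝ EN] [TopologicalSpace HN]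
  {I : ModelWithCorners ℝ EB HB} {J : ModelWithCorners ℝ EN HN}
  [TopologicalSpace B] [ChartedSpace HB B] [TopologicalSpace N] [ChartedSpace HN N]
  {F : SmoothFamily E I J N B}

/-- The product chart that underlies the preferred chart of the fibre at `q`. -/
def SmoothFamily.chartOf (F : SmoothFamily E I J N B) (q : N) : F.ProductChart :=
  ⟨(F.exists_chart q).choose, (F.exists_chart q).choose_spec.1⟩

theorem mem_chartOf (q : N) : q ∈ (F.chartOf q).toHomeo.source :=
  (F.exists_chart q).choose_spec.2

namespace SmoothFamily.ProductChart

variable {c c' c'' : F.ProductChart}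

theorem contDiffAt_change {z : E × B} (hz : z ∈ c.overlap c') :
    ContDiffAt ℝ ∞ (fun e => c.change c' (e, z.2)) z.1 := by
  rw [← contMDiffAt_iff_contDiffAt]
  have h1 : ContMDiffAt 𝓘(ℝ, E) (𝓘(ℝ, E).prod I) ∞ (fun e : E => (e, z.2)) z.1 :=
    contMDiffAt_id.prodMk contMDiffAt_const
  exact ContMDiffAt.comp (g := c.change c') z.1
    (contMDiffOn_change.contMDiffAt (isOpen_overlap.mem_nhds hz)) h1

theorem eventually_mem_overlap {z : E × B} (hz : z ∈ c.overlap c') :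
    ∀ᶠ e in 𝓝 z.1, (e, z.2) ∈ c.overlap c' :=
  (by fun_prop : ContinuousAt (fun e : E => (e, z.2)) z.1).eventually
    (isOpen_overlap.mem_nhds hz)

/-- The derivative of the change of coordinates in the direction of the fibre. -/
def fibDeriv (c c' : F.ProductChart) (z : E × B) : E →L[ℝ] E :=
  fderiv ℝ (fun e => c.change c' (e, z.2)) z.1

theorem fibDeriv_comp {z : E × B} (hz : z ∈ c.overlap c') (hz' : z ∈ c.overlap c'') :
    c.fibDeriv c'' z = (c'.fibDeriv c'' (c.change c' z, z.2)).comp (c.fibDeriv c' z) := by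
  have h1 : (c.change c' z, z.2) ∈ c'.overlap c'' :=
    ⟨change_mem_target hz, by rw [pt_change hz]; exact hz'.2⟩
  have h2 := ((contDiffAt_change h1).differentiableAt (by simp)).hasFDerivAt
  have h3 := h2.comp z.1 (f := fun e => c.change c' (e, z.2))
    ((contDiffAt_change hz).differentiableAt (by simp)).hasFDerivAt
  refine (h3.congr_of_eventuallyEq ?_).fderiv
  filter_upwards [eventually_mem_overlap hz] with e he
  exact (change_change he).symm

theorem fibDeriv_self {z : E × B} (hz : z ∈ c.toHomeo.target) :
    c.fibDeriv c z = ContinuousLinearMap.id ℝ E := by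
  have h : (fun e => c.change c (e, z.2)) =ᶠ[𝓝 z.1] id := by
    filter_upwards [eventually_mem_overlap (c' := c) ⟨hz, pt_mem hz⟩] with e he
    exact change_self he.1
  rw [fibDeriv, h.fderiv_eq, fderiv_id]

theorem fibDeriv_leftInverse {z : E × B} (hz : z ∈ c.overlap c') (v : E) :
    c'.fibDeriv c (c.change c' z, z.2) (c.fibDeriv c' z v) = v := by
  have h := fibDeriv_comp (c'' := c) hz ⟨hz.1, pt_mem hz.1⟩
  rw [fibDeriv_self hz.1] at h
  exact (congrArg (fun T => T v) h).symm

theorem fibDeriv_rightInverse {z : E × B} (hz : z ∈ c.overlap c') (v : E) :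
    c.fibDeriv c' z (c'.fibDeriv c (c.change c' z, z.2) v) = v := by
  have h := fibDeriv_leftInverse (change_mem_overlap hz) v
  rw [change_change hz] at h
  simp only [change_self hz.1] at h
  exact h

/-- The coefficients of the forms `θ_t` in the product chart `c`. -/
def form (c : F.ProductChart) (θ : F.OneForms) (z : E × B) : E →L[ℝ] ℝ :=
  SmoothFamily.OneForms.inChart θ c.toHomeo c.isProductChart z

end SmoothFamily.ProductChart

variable {EM HM M : Type*}
  [NormedAddCommGroup EM] [NormedSpace ℝ EM] [TopologicalSpace HM]
  {IM : ModelWithCorners ℝ EM HM} [TopologicalSpace M] [ChartedSpace HM M]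

theorem fiberChart_mem_atlas (c : F.ProductChart) (t : B) :
    F.fiberChart c.toHomeo c.isProductChart t ∈ atlas E (F.Fiber t) := ⟨_, _, rfl⟩

theorem mdifferentiableAt_coord (c : F.ProductChart) {t : B} {x : F.Fiber t}
    (hx : x.incl ∈ c.toHomeo.source) :
    MDifferentiableAt 𝓘(ℝ, E) 𝓘(ℝ, E) (fun x : F.Fiber t => c.coord x.incl) x :=
  mdifferentiableAt_atlas (fiberChart_mem_atlas c t) hx

/-- The tangent space of a fibre is identified with `E` by the preferred chart. -/
theorem mfderiv_fiber {t : B} {m : M → F.Fiber t} {y : M} (hm : MDifferentiableAt IM 𝓘(ℝ, E) m y) :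
    mfderiv IM 𝓘(ℝ, E) m y =
      mfderiv IM 𝓘(ℝ, E) (fun y' => (F.chartOf (m y).incl).coord (m y').incl) y := by
  have h1 : ContinuousAt (fun y' => (F.chartOf (m y).incl).coord (m y').incl) y :=
    ContinuousAt.comp (g := fun x : F.Fiber t => (F.chartOf (m y).incl).coord x.incl)
      (mdifferentiableAt_coord _ (mem_chartOf _)).continuousAt hm.continuousAt
  exact (HasMFDerivAt.mfderiv (f := fun y' => (F.chartOf (m y).incl).coord (m y').incl)
    ⟨h1, hm.hasMFDerivAt.2⟩).symm

theorem mdifferentiableAt_fiberParam (c : F.ProductChart) {t : B} {e : E}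
    (he : (e, t) ∈ c.toHomeo.target) :
    MDifferentiableAt 𝓘(ℝ, E) 𝓘(ℝ, E) (F.fiberParam c.toHomeo c.isProductChart t) e :=
  mdifferentiableAt_atlas_symm (fiberChart_mem_atlas c t) he

theorem form_eq_comp_fibDeriv (c : F.ProductChart) (θ : F.OneForms) {t : B} {e : E} {x : F.Fiber t}
    (he : (e, t) ∈ c.toHomeo.target) (hx : x.incl = c.pt (e, t)) :
    c.form θ (e, t) = (θ t x : E →L[ℝ] ℝ).comp (c.fibDeriv (F.chartOf x.incl) (e, t)) := by
  have hx' : x = F.fiberParam c.toHomeo c.isProductChart t e :=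
    SmoothFamily.Fiber.ext (by rw [F.incl_fiberParam _ _ he]; exact hx)
  subst hx'
  have h := mfderiv_fiber (mdifferentiableAt_fiberParam c he)
  rw [mfderiv_eq_fderiv] at h
  have h2 : (fun y' => (F.chartOf (F.fiberParam c.toHomeo c.isProductChart t e).incl).coord
      (F.fiberParam c.toHomeo c.isProductChart t y').incl) =ᶠ[𝓝 e] fun y' =>
      c.change (F.chartOf (F.fiberParam c.toHomeo c.isProductChart t e).incl) (y', t) := by
    filter_upwards [eventually_mem_overlap (c := c) (c' := c) ⟨he, pt_mem he⟩] with y hy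
    rw [F.incl_fiberParam _ _ hy.1]
    rfl
  rw [h2.fderiv_eq] at h
  exact congrArg ((θ t _ : E →L[ℝ] ℝ).comp) h

/-- In the preferred chart, the coefficients at the base point are the covector itself. -/
theorem apply_eq_form (θ : F.OneForms) {t : B} (x : F.Fiber t) :
    (θ t x : E →L[ℝ] ℝ) = (F.chartOf x.incl).form θ ((F.chartOf x.incl).coord x.incl, t) := by
  have h1 := mem_target (mem_chartOf (F := F) x.incl)
  have h2 := pt_coord (mem_chartOf (F := F) x.incl)
  rw [x.proj_incl] at h1 h2
  rw [form_eq_comp_fibDeriv _ θ h1 h2.symm, fibDeriv_self h1]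
  rfl

theorem form_eq_comp {c c' : F.ProductChart} (θ : F.OneForms) {z : E × B}
    (hz : z ∈ c.overlap c') :
    c.form θ z = (c'.form θ (c.change c' z, z.2)).comp (c.fibDeriv c' z) := by
  set x : F.Fiber z.2 := ⟨c.pt z, proj_pt hz.1⟩
  rw [form_eq_comp_fibDeriv c θ (x := x) hz.1 rfl,
    form_eq_comp_fibDeriv c' θ (x := x) (change_mem_target hz) (pt_change hz).symm,
    fibDeriv_comp (c' := c') hz ⟨hz.1, mem_chartOf _⟩]
  rfl

/-- The pull-back of `θ_t` under a map into a fibre, computed in any product chart. -/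
theorem apply_mfderiv_eq_form (θ : F.OneForms) {t : B} {m : M → F.Fiber t} {y : M}
    (hm : MDifferentiableAt IM 𝓘(ℝ, E) m y) (c : F.ProductChart)
    (hc : (m y).incl ∈ c.toHomeo.source) (v : EM) :
    θ t (m y) (mfderiv IM 𝓘(ℝ, E) m y v) = c.form θ (c.coord (m y).incl, t)
      (mfderiv IM 𝓘(ℝ, E) (fun y' => c.coord (m y').incl) y v) := by
  set c₀ := F.chartOf (m y).incl with hc₀
  have hov : (c.coord (m y).incl, t) ∈ c.overlap c₀ := by
    have := mem_overlap hc (mem_chartOf (F := F) (m y).incl)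
    rwa [(m y).proj_incl] at this
  have h2 := mdifferentiableAt_coord c hc
  have h3 : MDifferentiableAt IM 𝓘(ℝ, E) (fun y' => c.coord (m y').incl) y :=
    MDifferentiableAt.comp (g := fun x : F.Fiber t => c.coord x.incl) (f := m) y h2 hm
  have hT : MDifferentiableAt 𝓘(ℝ, E) 𝓘(ℝ, E) (fun e => c.change c₀ (e, t))
      (c.coord (m y).incl) :=
    ((contDiffAt_change hov).differentiableAt (by simp)).mdifferentiableAt
  have h4 : (fun y' => c₀.coord (m y').incl) =ᶠ[𝓝 y]
      (fun e => c.change c₀ (e, t)) ∘ fun y' => c.coord (m y').incl := by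
    have h5 : ContinuousAt (fun y' => (m y').incl) y :=
      (SmoothFamily.Fiber.isInducing_incl F t).continuous.continuousAt.comp hm.continuousAt
    filter_upwards [h5.eventually (c.toHomeo.open_source.mem_nhds hc)] with y' hy'
    have := pt_coord hy'
    rw [(m y').proj_incl] at this
    simp only [Function.comp, change, this]
  have e1 := mfderiv_fiber hm
  rw [h4.mfderiv_eq, mfderiv_comp y hT h3] at e1
  have e2 : (mfderiv IM 𝓘(ℝ, E) m y v : E) = c.fibDeriv c₀ (c.coord (m y).incl, t)
      (mfderiv IM 𝓘(ℝ, E) (fun y' => c.coord (m y').incl) y v) :=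
    (congrArg (fun T : EM →L[ℝ] E => T v) e1).trans
      (congrArg (fun T : E →L[ℝ] E => T (mfderiv IM 𝓘(ℝ, E) (fun y' => c.coord (m y').incl) y v))
        mfderiv_eq_fderiv)
  have h6 : c.change c₀ (c.coord (m y).incl, t) = c₀.coord (m y).incl := by
    have := pt_coord hc
    rw [(m y).proj_incl] at this
    simp only [change, this]
  refine (congrArg (fun T : E →L[ℝ] ℝ => T (mfderiv IM 𝓘(ℝ, E) m y v))
    (apply_eq_form θ (m y))).trans ((congrArg (c₀.form θ (c₀.coord (m y).incl, t)) e2).trans ?_)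
  rw [form_eq_comp θ hov, h6]
  rfl

/-- The exterior derivative of the forms `θ_t` in the product chart `c`. -/
def SmoothFamily.ProductChart.symp (c : F.ProductChart) (θ : F.OneForms) (z : E × B) :
    E →L[ℝ] E →L[ℝ] ℝ :=
  dForm (fun e => c.form θ (e, z.2)) z.1

/-- The Liouville vector fields in the product chart `c`. -/
def SmoothFamily.ProductChart.liou (c : F.ProductChart) (θ : F.OneForms) (z : E × B) : E :=
  (c.symp θ z).inverse (c.form θ z)

variable {θ : F.OneForms}

theorem contMDiffOn_form (hθ : SmoothFamily.OneForms.IsSmooth θ) (c : F.ProductChart) :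
    ContMDiffOn (𝓘(ℝ, E).prod I) 𝓘(ℝ, E →L[ℝ] ℝ) ∞ (c.form θ) c.toHomeo.target :=
  hθ c.toHomeo c.isProductChart

theorem contDiffAt_form (hθ : SmoothFamily.OneForms.IsSmooth θ) {c : F.ProductChart} {z : E × B}
    (hz : z ∈ c.toHomeo.target) : ContDiffAt ℝ ∞ (fun e => c.form θ (e, z.2)) z.1 := by
  rw [← contMDiffAt_iff_contDiffAt]
  have h1 : ContMDiffAt 𝓘(ℝ, E) (𝓘(ℝ, E).prod I) ∞ (fun e : E => (e, z.2)) z.1 :=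
    contMDiffAt_id.prodMk contMDiffAt_const
  exact ContMDiffAt.comp (g := c.form θ) z.1
    ((contMDiffOn_form hθ c).contMDiffAt (c.toHomeo.open_target.mem_nhds hz)) h1

theorem symp_eq (hθ : SmoothFamily.OneForms.IsSmooth θ) {c c' : F.ProductChart} {z : E × B}
    (hz : z ∈ c.overlap c') (v w : E) :
    c.symp θ z v w = c'.symp θ (c.change c' z, z.2) (c.fibDeriv c' z v) (c.fibDeriv c' z w) := by
  refine dForm_pullback (f := fun e => c.change c' (e, z.2))
    ((contDiffAt_change hz).of_le (WithTop.coe_le_coe.2 (le_top : (2 : ℕ∞) ≤ ⊤)))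
    ((contDiffAt_form hθ (change_mem_target hz)).differentiableAt (by simp)) ?_ v w
  filter_upwards [eventually_mem_overlap hz] with e he
  exact form_eq_comp θ he

theorem d_eq_symp (θ : F.OneForms) {t : B} (x : F.Fiber t) (v w : E) :
    (θ t).d x v w =
      (F.chartOf x.incl).symp θ ((F.chartOf x.incl).coord x.incl, t) v w := rfl

/-- The forms `dθ_t` are nondegenerate in every product chart. -/
theorem symp_nondegenerate (hθ : F.IsLiouvilleFamily θ) {c : F.ProductChart} {z : E × B}
    (hz : z ∈ c.toHomeo.target) {v : E} (hv : ∀ w, c.symp θ z v w = 0) : v = 0 := by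
  set x : F.Fiber z.2 := ⟨c.pt z, proj_pt hz⟩
  set c₀ := F.chartOf x.incl with hc₀
  have hov : z ∈ c.overlap c₀ := ⟨hz, mem_chartOf _⟩
  have h1 := ((hθ.isLiouvilleManifold z.2).exactSymplectic.nondegenerate x (c.fibDeriv c₀ z v)
    fun w => ?_)
  · have h2 := fibDeriv_leftInverse hov v
    rwa [show c.fibDeriv c₀ z v = 0 from h1, map_zero, eq_comm] at h2
  · refine (d_eq_symp θ x _ w).trans ?_
    have h2 := hv (c₀.fibDeriv c (c.change c₀ z, z.2) w)
    rw [symp_eq hθ.smooth hov] at h2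
    have h3 := fibDeriv_rightInverse hov w
    exact (congrArg (c₀.symp θ (c.change c₀ z, z.2) (c.fibDeriv c₀ z v)) h3).symm.trans h2

variable [FiniteDimensional ℝ E]

theorem isInvertible_symp (hθ : F.IsLiouvilleFamily θ) {c : F.ProductChart} {z : E × B}
    (hz : z ∈ c.toHomeo.target) : (c.symp θ z).IsInvertible :=
  isInvertible_of_nondegenerate fun _ hv => symp_nondegenerate hθ hz hv

theorem symp_liou (hθ : F.IsLiouvilleFamily θ) {c : F.ProductChart} {z : E × B}
    (hz : z ∈ c.toHomeo.target) : c.symp θ z (c.liou θ z) = c.form θ z :=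
  (isInvertible_symp hθ hz).self_apply_inverse _

theorem eq_of_symp_eq (hθ : F.IsLiouvilleFamily θ) {c : F.ProductChart} {z : E × B}
    (hz : z ∈ c.toHomeo.target) {v v' : E} (h : ∀ w, c.symp θ z v w = c.symp θ z v' w) : v = v' :=
  (isInvertible_symp hθ hz).injective (ContinuousLinearMap.ext h)

theorem liou_change (hθ : F.IsLiouvilleFamily θ) {c c' : F.ProductChart} {z : E × B}
    (hz : z ∈ c.overlap c') :
    c'.liou θ (c.change c' z, z.2) = c.fibDeriv c' z (c.liou θ z) := by
  refine eq_of_symp_eq hθ (change_mem_target hz) fun w => ?_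
  rw [symp_liou hθ (change_mem_target hz), ← fibDeriv_rightInverse hz w,
    ← symp_eq hθ.smooth hz, symp_liou hθ hz.1, form_eq_comp θ hz]
  rfl

/-- The Liouville vector field, read in the preferred chart. -/
theorem liouvilleField_eq (hθ : F.IsLiouvilleFamily θ) {t : B} (x : F.Fiber t) :
    (liouvilleField (θ t) x : E) =
      (F.chartOf x.incl).liou θ ((F.chartOf x.incl).coord x.incl, t) := by
  have h1 := mem_target (mem_chartOf (F := F) x.incl)
  rw [x.proj_incl] at h1
  have hex : ∃ z : TangentSpace 𝓘(ℝ, E) x, ∀ w, (θ t).d x z w = θ t x w := by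
    refine ⟨(F.chartOf x.incl).liou θ ((F.chartOf x.incl).coord x.incl, t), fun w => ?_⟩
    refine (d_eq_symp θ x _ w).trans ?_
    rw [symp_liou hθ h1]
    exact congrArg (fun T => T w) (apply_eq_form θ x).symm
  have h2 := Classical.epsilon_spec hex
  refine eq_of_symp_eq hθ h1 fun w => ?_
  rw [symp_liou hθ h1]
  exact ((d_eq_symp θ x _ w).symm.trans (h2 w)).trans (congrArg (fun T => T w) (apply_eq_form θ x))

variable [IsManifold I ∞ B]

theorem contMDiffOn_symp (hθ : SmoothFamily.OneForms.IsSmooth θ) (c : F.ProductChart) :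
    ContMDiffOn (𝓘(ℝ, E).prod I) 𝓘(ℝ, E →L[ℝ] E →L[ℝ] ℝ) ∞ (c.symp θ) c.toHomeo.target := by
  intro z hz
  refine ContMDiffAt.contMDiffWithinAt ?_
  have h1 : ContMDiffAt ((𝓘(ℝ, E).prod I).prod 𝓘(ℝ, E)) (𝓘(ℝ, E).prod I) ∞
      (fun w : (E × B) × E => (w.2, w.1.2)) (z, z.1) :=
    contMDiffAt_snd.prodMk (contMDiffAt_snd.comp _ contMDiffAt_fst)
  have h2 : ContMDiffAt ((𝓘(ℝ, E).prod I).prod 𝓘(ℝ, E)) 𝓘(ℝ, E →L[ℝ] ℝ) ∞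
      (Function.uncurry fun (w : E × B) (e : E) => c.form θ (e, w.2)) (z, z.1) :=
    ContMDiffAt.comp (g := c.form θ) (z, z.1)
      ((contMDiffOn_form hθ c).contMDiffAt (c.toHomeo.open_target.mem_nhds hz)) h1
  have h3 := contMDiffAt_fderiv h2 contMDiffAt_fst
  have h4 : ContMDiffAt (𝓘(ℝ, E).prod I) 𝓘(ℝ, E →L[ℝ] E →L[ℝ] ℝ) ∞
      (fun w : E × B => flipCLM E (fderiv ℝ (fun e => c.form θ (e, w.2)) w.1)) z :=
    ContMDiffAt.comp (g := flipCLM E) z (flipCLM E).contDiff.contMDiff.contMDiffAt h3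
  exact h3.sub h4

/-- The solution of `symp (A, ·) = η` depends smoothly on `η` and the point. -/
theorem contMDiffAt_inverse_symp (hθ : F.IsLiouvilleFamily θ) (c : F.ProductChart) {g : M → E × B}
    {η : M → E →L[ℝ] ℝ} {x : M} (hg : ContMDiffAt IM (𝓘(ℝ, E).prod I) ∞ g x)
    (hη : ContMDiffAt IM 𝓘(ℝ, E →L[ℝ] ℝ) ∞ η x) (hx : g x ∈ c.toHomeo.target) :
    ContMDiffAt IM 𝓘(ℝ, E) ∞ (fun y => (c.symp θ (g y)).inverse (η y)) x := by
  have h1 : ContMDiffAt IM 𝓘(ℝ, E →L[ℝ] E →L[ℝ] ℝ) ∞ (fun y => c.symp θ (g y)) x :=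
    ContMDiffAt.comp (g := c.symp θ) x ((contMDiffOn_symp hθ.smooth c).contMDiffAt
      (c.toHomeo.open_target.mem_nhds hx)) hg
  have h2 : ContMDiffAt IM 𝓘(ℝ, (E →L[ℝ] ℝ) →L[ℝ] E) ∞ (fun y => (c.symp θ (g y)).inverse) x :=
    ContMDiffAt.comp (g := ContinuousLinearMap.inverse) x
      ((isInvertible_symp hθ hx).contDiffAt_map_inverse).contMDiffAt h1
  exact h2.clm_apply hη

theorem contMDiffOn_liou (hθ : F.IsLiouvilleFamily θ) (c : F.ProductChart) :
    ContMDiffOn (𝓘(ℝ, E).prod I) 𝓘(ℝ, E) ∞ (c.liou θ) c.toHomeo.target := fun _ hz =>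
  (contMDiffAt_inverse_symp hθ c contMDiffAt_id ((contMDiffOn_form hθ.smooth c).contMDiffAt
    (c.toHomeo.open_target.mem_nhds hz)) hz).contMDiffWithinAt

end ChartForms

/-! ### The Liouville flow of the family -/

section LiouvilleFlow

variable {E EB HB EN HN B N : Type*}
  [NormedAddCommGroup E] [NormedSpace ℝ E] [FiniteDimensional ℝ E]
  [NormedAddCommGroup EB] [NormedSpace ℝ EB] [TopologicalSpace HB]
  [NormedAddCommGroup EN] [NormedSpace ℝ EN] [TopologicalSpace HN]
  {I : ModelWithCorners ℝ EB HB} {J : ModelWithCorners ℝ EN HN}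
  [TopologicalSpace B] [ChartedSpace HB B] [TopologicalSpace N] [ChartedSpace HN N]
  [IsManifold I ∞ B]
  {EP HP P : Type*} [NormedAddCommGroup EP] [NormedSpace ℝ EP]
  [TopologicalSpace HP]
  {IP : ModelWithCorners ℝ EP HP} [TopologicalSpace P] [ChartedSpace HP P]
  {F : SmoothFamily E I J N B} {θ : F.OneForms}

theorem fderiv_changeAlong_const {h₀ : P → B} {c c' : F.ProductChart} {e : E} {p : P} {s : ℝ}
    (hz : (e, h₀ p) ∈ c.overlap c') (v : E) (r : ℝ) :
    fderiv ℝ (c.changeAlong c' (fun z : P × ℝ => h₀ z.1) p) (e, s) (v, r) =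
      c.fibDeriv c' (e, h₀ p) v := by
  have h1 := ((contDiffAt_change hz).differentiableAt (by simp)).hasFDerivAt.comp (e, s)
    (f := (Prod.fst : E × ℝ → E)) hasFDerivAt_fst
  exact congrArg (fun T => T (v, r)) h1.fderiv

/-- The Liouville vector fields as a lift of the zero vector field on the base: the map to the base
does not depend on the time. -/
def liouvilleLift (hθ : F.IsLiouvilleFamily θ) {h₀ : P → B} (hh₀ : ContMDiff IP I ∞ h₀) :
    LiftField IP F (fun z : P × ℝ => h₀ z.1) where
  coef c z := c.liou θ (z.1, h₀ z.2.1)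
  smooth c := by
    have h1 : ContMDiff (𝓘(ℝ, E).prod (IP.prod 𝓘(ℝ, ℝ))) (𝓘(ℝ, E).prod I) ∞
        fun z : E × (P × ℝ) => (z.1, h₀ z.2.1) :=
      contMDiff_fst.prodMk (hh₀.comp (contMDiff_fst.comp contMDiff_snd))
    exact (contMDiffOn_liou hθ c).comp h1.contMDiffOn fun z hz => hz
  compat c c' e p s hz := by
    rw [fderiv_changeAlong_const hz]
    exact liou_change hθ hz

theorem contMDiff_comp_fst {h₀ : P → B} (hh₀ : ContMDiff IP I ∞ h₀) :
    ContMDiff (IP.prod 𝓘(ℝ, ℝ)) I ∞ fun z : P × ℝ => h₀ z.1 := hh₀.comp contMDiff_fst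

/-- Liouville curves in the total space, with the base itself as parameter space. -/
def IsLiouvilleCurveAt (hθ : F.IsLiouvilleFamily θ) (t : B) (γ : ℝ → N) (s : ℝ) : Prop :=
  IsIntegralAt (liouvilleLift hθ (IP := I) (h₀ := id) contMDiff_id) t γ s

theorem IsLiouvilleCurveAt.isIntegralAt {hθ : F.IsLiouvilleFamily θ} {h₀ : P → B}
    {hh₀ : ContMDiff IP I ∞ h₀} {p : P} {γ : ℝ → N} {s : ℝ}
    (hγ : IsLiouvilleCurveAt hθ (h₀ p) γ s) : IsIntegralAt (liouvilleLift hθ hh₀) p γ s :=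
  ⟨hγ.1, hγ.2, hγ.3⟩

theorem IsLiouvilleCurveAt.shift {hθ : F.IsLiouvilleFamily θ} {t : B} {γ : ℝ → N} {s a : ℝ}
    (hγ : IsLiouvilleCurveAt hθ t γ (s + a)) :
    IsLiouvilleCurveAt hθ t (fun u => γ (u + a)) s := by
  have hc : ContinuousAt (fun u : ℝ => u + a) s := by fun_prop
  exact ⟨ContinuousAt.comp (f := fun u : ℝ => u + a) hγ.1 hc,
    hc.eventually (p := fun s' => F.proj (γ s') = t) hγ.2,
    fun c hs => (hγ.3 c hs).comp_add_const s a⟩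

/-- Integral curves of the Liouville field of a fibre are Liouville curves in the total space. -/
theorem isLiouvilleCurveAt_of_isMIntegralCurve (hθ : F.IsLiouvilleFamily θ) {t : B}
    {γ : ℝ → F.Fiber t} (hγ : IsMIntegralCurve γ (liouvilleField (θ t))) (s : ℝ) :
    IsLiouvilleCurveAt hθ t (fun s => (γ s).incl) s := by
  have hc : ContinuousAt (fun s => (γ s).incl) s :=
    (SmoothFamily.Fiber.isInducing_incl F t).continuous.continuousAt.comp (hγ s).continuousAt
  have h1 := (hγ s).2
  simp only [writtenInExtChartAt, extChartAt_model_space_eq_id, PartialEquiv.refl_symm,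
    PartialEquiv.refl_coe, CompTriple.comp_eq, modelWithCornersSelf_coe, range_id] at h1
  refine IsIntegralAt.of_chart (contMDiff_comp_fst contMDiff_id) hc
    (Filter.Eventually.of_forall fun s' => (γ s').proj_incl) (F.chartOf (γ s).incl)
    (mem_chartOf _) ?_
  have h1' : HasFDerivWithinAt (fun s' => (F.chartOf (γ s).incl).coord (γ s').incl)
      (ContinuousLinearMap.smulRight (1 : ℝ →L[ℝ] ℝ) (liouvilleField (θ t) (γ s) : E)) univ s := h1
  have h2 := (h1'.hasFDerivAt univ_mem).hasDerivAt
  have h3 := liouvilleField_eq hθ (γ s)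
  change HasDerivAt _ ((F.chartOf (γ s).incl).liou θ ((F.chartOf (γ s).incl).coord (γ s).incl, t)) s
  rw [← h3]
  refine h2.congr_deriv ?_
  exact one_smul ℝ (liouvilleField (θ t) (γ s) : E)

/-- The Liouville flow on the total space of the family. -/
def liouvilleFlow (hθ : F.IsLiouvilleFamily θ) (u : ℝ) (q : N) : N :=
  (((hθ.isLiouvilleManifold (F.proj q)).complete ⟨q, rfl⟩).choose u).incl

variable (hθ : F.IsLiouvilleFamily θ)

theorem liouvilleFlow_zero (q : N) : liouvilleFlow hθ 0 q = q :=
  congrArg SmoothFamily.Fiber.incl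
    ((hθ.isLiouvilleManifold (F.proj q)).complete ⟨q, rfl⟩).choose_spec.2

theorem proj_liouvilleFlow (u : ℝ) (q : N) : F.proj (liouvilleFlow hθ u q) = F.proj q :=
  (((hθ.isLiouvilleManifold (F.proj q)).complete ⟨q, rfl⟩).choose u).proj_incl

theorem isLiouvilleCurveAt_liouvilleFlow (q : N) (s : ℝ) :
    IsLiouvilleCurveAt hθ (F.proj q) (fun u => liouvilleFlow hθ u q) s :=
  isLiouvilleCurveAt_of_isMIntegralCurve hθ
    ((hθ.isLiouvilleManifold (F.proj q)).complete ⟨q, rfl⟩).choose_spec.1 s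

/-- The Liouville flow within a fibre. -/
def fiberFlow {t : B} (x : F.Fiber t) (u : ℝ) : F.Fiber t :=
  ⟨liouvilleFlow hθ u x.incl, (proj_liouvilleFlow hθ u x.incl).trans x.proj_incl⟩

theorem isMIntegralCurve_fiberFlow {t : B} (x : F.Fiber t) :
    IsMIntegralCurve (fiberFlow hθ x) (liouvilleField (θ t)) := by
  obtain ⟨q, rfl⟩ := x
  exact ((hθ.isLiouvilleManifold (F.proj q)).complete ⟨q, rfl⟩).choose_spec.1

variable [T2Space N]

theorem eq_liouvilleFlow {t : B} {γ : ℝ → N} (hγ : ∀ s, IsLiouvilleCurveAt hθ t γ s) (a s : ℝ) :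
    γ s = liouvilleFlow hθ (s - a) (γ a) := by
  have ht : F.proj (γ a) = t := (hγ a).proj
  have h1 : ∀ s ∈ (univ : Set ℝ), IsLiouvilleCurveAt hθ t
      (fun u => liouvilleFlow hθ (u - a) (γ a)) s := fun s _ => by
    have := isLiouvilleCurveAt_liouvilleFlow hθ (γ a) (s + -a)
    rw [ht] at this
    exact this.shift
  exact IsIntegralAt.eqOn (contMDiff_comp_fst contMDiff_id) isOpen_univ isPreconnected_univ
    (fun s _ => hγ s) h1 (mem_univ a) (by simp [liouvilleFlow_zero]) (mem_univ s)

theorem liouvilleFlow_add (u v : ℝ) (q : N) :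
    liouvilleFlow hθ (u + v) q = liouvilleFlow hθ u (liouvilleFlow hθ v q) := by
  have := eq_liouvilleFlow hθ (isLiouvilleCurveAt_liouvilleFlow hθ q) v (u + v)
  rwa [add_sub_cancel_right] at this

theorem liouvilleFlow_neg (u : ℝ) (q : N) :
    liouvilleFlow hθ (-u) (liouvilleFlow hθ u q) = q := by
  rw [← liouvilleFlow_add, neg_add_cancel, liouvilleFlow_zero]

theorem liouvilleFlow_neg' (u : ℝ) (q : N) :
    liouvilleFlow hθ u (liouvilleFlow hθ (-u) q) = q := by
  rw [← liouvilleFlow_add, add_neg_cancel, liouvilleFlow_zero]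

variable [FiniteDimensional ℝ EB]

theorem contMDiff_liouvilleFlow :
    ContMDiff (J.prod 𝓘(ℝ, ℝ)) J ∞ fun z : N × ℝ => liouvilleFlow hθ z.2 z.1 := by
  rintro ⟨q, s⟩
  exact (contMDiffAt_integralCurve (contMDiff_comp_fst contMDiff_id)
    (A := liouvilleLift hθ (IP := I) (h₀ := id) contMDiff_id) (g := fun _ _ => 0)
    (fun c => contMDiffOn_const) (γ := fun q u => liouvilleFlow hθ u q) (τ := F.proj)
    (σ := fun _ => 0) isOpen_univ ordConnected_univ
    (Filter.Eventually.of_forall fun q s _ => isLiouvilleCurveAt_liouvilleFlow hθ q s)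
    F.smooth.contMDiffAt contMDiffAt_const (mem_univ _)
    (by simp only [liouvilleFlow_zero]; exact contMDiffAt_id) (mem_univ s)).1

theorem continuous_liouvilleFlow : Continuous fun z : ℝ × N => liouvilleFlow hθ z.1 z.2 :=
  (contMDiff_liouvilleFlow hθ).continuous.comp continuous_swap

theorem continuous_liouvilleFlow_apply (u : ℝ) : Continuous (liouvilleFlow hθ u) :=
  (continuous_liouvilleFlow hθ).comp (by fun_prop : Continuous fun q : N => (u, q))

end LiouvilleFlow

/-! ### Traps for the backward Liouville flow -/

section Traps

variable {E EB HB EN HN B N : Type*}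
  [NormedAddCommGroup E] [NormedSpace ℝ E] [FiniteDimensional ℝ E]
  [NormedAddCommGroup EB] [NormedSpace ℝ EB] [FiniteDimensional ℝ EB] [TopologicalSpace HB]
  [NormedAddCommGroup EN] [NormedSpace ℝ EN] [FiniteDimensional ℝ EN] [TopologicalSpace HN]
  {I : ModelWithCorners ℝ EB HB} {J : ModelWithCorners ℝ EN HN}
  [TopologicalSpace B] [ChartedSpace HB B] [TopologicalSpace N] [ChartedSpace HN N]
  [IsManifold I ∞ B] [T2Space N] [T2Space B]
  {F : SmoothFamily E I J N B} {θ : F.OneForms}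

theorem SmoothFamily.Fiber.incl_injective {t : B} :
    Function.Injective (SmoothFamily.Fiber.incl : F.Fiber t → N) := fun _ _ h =>
  SmoothFamily.Fiber.ext h

theorem SmoothFamily.Fiber.continuous_incl {t : B} :
    Continuous (SmoothFamily.Fiber.incl : F.Fiber t → N) :=
  (SmoothFamily.Fiber.isInducing_incl F t).continuous

instance SmoothFamily.Fiber.t2Space {t : B} : T2Space (F.Fiber t) :=
  T2Space.of_injective_continuous SmoothFamily.Fiber.incl_injective
    SmoothFamily.Fiber.continuous_incl

variable (hθ : F.IsLiouvilleFamily θ)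

theorem fiberFlow_zero {t : B} (x : F.Fiber t) : fiberFlow hθ x 0 = x :=
  SmoothFamily.Fiber.ext (liouvilleFlow_zero hθ x.incl)

theorem fiberFlow_add {t : B} (x : F.Fiber t) (u v : ℝ) :
    fiberFlow hθ x (u + v) = fiberFlow hθ (fiberFlow hθ x v) u :=
  SmoothFamily.Fiber.ext (liouvilleFlow_add hθ u v x.incl)

theorem continuous_fiberFlow {t : B} (x : F.Fiber t) : Continuous (fiberFlow hθ x) :=
  continuous_iff_continuousAt.2 fun s => (isMIntegralCurve_fiberFlow hθ x s).continuousAt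

variable {t : B} {M : Set (F.Fiber t)}

/-- The Liouville flow crosses the boundary of a Liouville domain outwards. -/
theorem IsGeneratingLiouvilleDomain.eventually_sides (hM : IsGeneratingLiouvilleDomain (θ t) M)
    {p : F.Fiber t} (hp : p ∈ frontier M) :
    ∀ᶠ u in 𝓝 (0 : ℝ), (u < 0 → fiberFlow hθ p u ∈ interior M) ∧
      (0 < u → fiberFlow hθ p u ∉ M) := by
  obtain ⟨g, hg⟩ := hM.smooth_boundary p hp
  have hout := hM.outward p hp g hg
  obtain ⟨⟨U, hU, hpU, hgU, hM'⟩, -⟩ := hg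
  have hside : ∀ q ∈ U, g q < 0 → q ∈ interior M := by
    intro q hq hgq
    have h1 : ∀ᶠ q' in 𝓝 q, q' ∈ U ∧ g q' < 0 := Filter.Eventually.and (hU.mem_nhds hq)
      ((hgU.continuousOn.continuousAt (hU.mem_nhds hq)).eventually (gt_mem_nhds hgq))
    exact mem_interior_iff_mem_nhds.2 (h1.mono fun q' h => (hM' q' h.1).2 h.2.le)
  have hpM : p ∈ M := hM.isCompact.isClosed.frontier_subset hp
  have hg0 : g p = 0 := by
    refine le_antisymm ((hM' p hpU).1 hpM) ?_
    by_contra hlt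
    exact hp.2 (hside p hpU (not_le.1 hlt))
  have hγ := isMIntegralCurve_fiberFlow hθ p 0
  have hgd : MDifferentiableAt 𝓘(ℝ, E) 𝓘(ℝ, ℝ) g (fiberFlow hθ p 0) := by
    rw [fiberFlow_zero]
    exact (hgU.contMDiffAt (hU.mem_nhds hpU)).mdifferentiableAt (by simp)
  let L : E →L[ℝ] ℝ := mfderiv 𝓘(ℝ, E) 𝓘(ℝ, ℝ) g (fiberFlow hθ p 0)
  let z : E := liouvilleField (θ t) (fiberFlow hθ p 0)
  have h2 : HasFDerivAt (g ∘ fiberFlow hθ p) (L.comp ((1 : ℝ →L[ℝ] ℝ).smulRight z)) 0 :=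
    (HasMFDerivAt.comp (0 : ℝ) hgd.hasMFDerivAt hγ).hasFDerivAt
  have h3 : 0 < deriv (g ∘ fiberFlow hθ p) 0 := by
    have h4 : deriv (g ∘ fiberFlow hθ p) 0 = L z :=
      h2.hasDerivAt.deriv.trans (congrArg L (one_smul ℝ z))
    rw [h4]
    have h6 : 0 < OneForm.ofFun E g (fiberFlow hθ p 0)
        (liouvilleField (θ t) (fiberFlow hθ p 0)) := by
      rw [fiberFlow_zero]
      exact hout
    exact h6
  have h5 : ∀ᶠ u in 𝓝 (0 : ℝ), fiberFlow hθ p u ∈ U :=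
    (continuous_fiberFlow hθ p).continuousAt.eventually
      (hU.mem_nhds (by rwa [fiberFlow_zero]))
  filter_upwards [h5, eventually_nhdsWithin_sign_eq_of_deriv_pos h3
    (by simp [fiberFlow_zero, hg0])] with u h6 h7
  rw [sub_zero] at h7
  refine ⟨fun hu => hside _ h6 ?_, fun hu hmem => ?_⟩
  · rw [sign_neg hu] at h7
    exact sign_eq_neg_one_iff.1 h7
  · rw [sign_pos hu] at h7
    exact absurd ((hM' _ h6).1 hmem) (not_le.2 (sign_eq_one_iff.1 h7))

/-- The backward Liouville flow maps a Liouville domain into its interior. -/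
theorem IsGeneratingLiouvilleDomain.fiberFlow_mem_interior
    (hM : IsGeneratingLiouvilleDomain (θ t) M) {x : F.Fiber t} (hx : x ∈ M) {u : ℝ} (hu : 0 < u) :
    fiberFlow hθ x (-u) ∈ interior M := by
  have hcl := hM.isCompact.isClosed
  have hcont : Continuous fun u => fiberFlow hθ x (-u) :=
    (continuous_fiberFlow hθ x).comp continuous_neg
  have hmem : ∀ v, 0 ≤ v → fiberFlow hθ x (-v) ∈ M := by
    intro v hv
    have h1 : Icc 0 v ⊆ {u | fiberFlow hθ x (-u) ∈ M} := by
      refine IsClosed.Icc_subset_of_forall_exists_gt ((hcl.preimage hcont).inter isClosed_Icc)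
        (by simpa [fiberFlow_zero] using hx) ?_
      rintro w ⟨hw, -⟩ y hy
      have hev : ∀ᶠ r in 𝓝 (0 : ℝ), 0 < r → fiberFlow hθ (fiberFlow hθ x (-w)) (-r) ∈ M := by
        by_cases hfr : fiberFlow hθ x (-w) ∈ frontier M
        · have h2 := hM.eventually_sides hθ hfr
          rw [← neg_zero] at h2
          filter_upwards [(continuous_neg.tendsto (0 : ℝ)).eventually h2] with r h3 hr
          exact interior_subset (h3.1 (by linarith))
        · have h2 : fiberFlow hθ x (-w) ∈ interior M := by
            by_contra h3
            exact hfr ⟨subset_closure hw, h3⟩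
          have h3 : ContinuousAt (fun r => fiberFlow hθ (fiberFlow hθ x (-w)) (-r)) 0 :=
            ((continuous_fiberFlow hθ _).comp continuous_neg).continuousAt
          have h4 := h3.eventually (isOpen_interior.mem_nhds
            (by simpa [fiberFlow_zero] using h2))
          exact h4.mono fun r h5 _ => interior_subset h5
      obtain ⟨ε, hε, h2⟩ := Metric.eventually_nhds_iff.1 hev
      have hd : 0 < min (ε / 2) (y - w) := lt_min (by linarith) (sub_pos.2 hy)
      refine ⟨w + min (ε / 2) (y - w), ?_, by linarith, by linarith [min_le_right (ε / 2) (y - w)]⟩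
      have h3 := h2 (y := min (ε / 2) (y - w)) (by
        rw [Real.dist_0_eq_abs, abs_of_pos hd]
        linarith [min_le_left (ε / 2) (y - w)]) hd
      rw [← fiberFlow_add] at h3
      rw [mem_ofPred_eq, neg_add_rev]
      exact h3
    exact h1 ⟨hv, le_rfl⟩
  by_contra hni
  have hfr : fiberFlow hθ x (-u) ∈ frontier M := ⟨subset_closure (hmem u hu.le), hni⟩
  obtain ⟨ε, hε, h2⟩ := Metric.eventually_nhds_iff.1 (hM.eventually_sides hθ hfr)
  have hd : 0 < min (ε / 2) u := lt_min (by linarith) hu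
  refine (h2 (y := min (ε / 2) u) (by
    rw [Real.dist_0_eq_abs, abs_of_pos hd]
    linarith [min_le_left (ε / 2) u])).2 hd ?_
  rw [← fiberFlow_add]
  have h3 := hmem (u - min (ε / 2) u) (by linarith [min_le_right (ε / 2) u])
  rwa [neg_sub, sub_eq_add_neg] at h3

theorem IsGeneratingLiouvilleDomain.exists_fiberFlow_mem
    (hM : IsGeneratingLiouvilleDomain (θ t) M) (x : F.Fiber t) :
    ∃ u : ℝ, 0 ≤ u ∧ fiberFlow hθ x (-u) ∈ M := by
  obtain ⟨γ, hγ, h0, s, hs, rfl⟩ := hM.generates x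
  refine ⟨s, hs, ?_⟩
  have h1 := eq_liouvilleFlow hθ (isLiouvilleCurveAt_of_isMIntegralCurve hθ hγ) s 0
  have h2 : fiberFlow hθ (γ s) (-s) = γ 0 := SmoothFamily.Fiber.ext (by
    rw [h1, zero_sub]; rfl)
  rwa [h2]

/-- A trap over `V`: a compact set which, over `V`, the backward Liouville flow does not leave and
eventually moves into its interior, and which the backward flow line of every point over `V`
reaches. -/
structure IsTrap (hθ : F.IsLiouvilleFamily θ) (V : Set B) (S : Set N) : Prop where
  isCompact : IsCompact S
  backward : ∀ q ∈ S, F.proj q ∈ V → ∀ u, 0 ≤ u → liouvilleFlow hθ (-u) q ∈ S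
  interior : ∀ q ∈ S, F.proj q ∈ V → liouvilleFlow hθ (-1) q ∈ interior S
  reaches : ∀ q, F.proj q ∈ V → ∃ u, 0 ≤ u ∧ liouvilleFlow hθ (-u) q ∈ S

theorem IsTrap.mono {V V' : Set B} {S : Set N} (hS : IsTrap hθ V S) (h : V' ⊆ V) :
    IsTrap hθ V' S :=
  ⟨hS.1, fun q hq hV => hS.2 q hq (h hV), fun q hq hV => hS.3 q hq (h hV),
    fun q hV => hS.4 q (h hV)⟩

/-- A compact set without points over `t` has no points over a neighbourhood of `t`. -/
theorem eventually_forall_proj_ne {K : Set N} (hK : IsCompact K) {t : B}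
    (h : ∀ q ∈ K, F.proj q ≠ t) : ∀ᶠ t' in 𝓝 t, ∀ q ∈ K, F.proj q ≠ t' := by
  have h1 : IsClosed (F.proj '' K) := (hK.image F.smooth.continuous).isClosed
  have h2 : t ∉ F.proj '' K := fun ⟨q, hq, he⟩ => h q hq he
  filter_upwards [h1.isOpen_compl.mem_nhds h2] with t' ht' q hq he
  exact ht' ⟨q, hq, he⟩

theorem SmoothFamily.locallyCompact_base (_F : SmoothFamily E I J N B) : LocallyCompactSpace B :=
  Manifold.locallyCompact_of_finiteDimensional I

theorem SmoothFamily.locallyCompact_total (_F : SmoothFamily E I J N B) : LocallyCompactSpace N :=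
  Manifold.locallyCompact_of_finiteDimensional J

/-- Traps exist locally over the base. -/
theorem exists_isTrap (hdom : F.LocallyHasGeneratingDomains θ) (t₀ : B) :
    ∃ V, IsOpen V ∧ t₀ ∈ V ∧ ∃ S, IsTrap hθ V S := by
  have := F.locallyCompact_base
  have := F.locallyCompact_total
  obtain ⟨V₀, hV₀, ht₀, M, hM⟩ := hdom t₀
  set K₀ : Set N := M ∩ F.proj ⁻¹' {t₀} with hK₀
  have hK₀c : IsCompact K₀ := hM.proper.2 _ (singleton_subset_iff.2 ht₀) isCompact_singleton
  have hM₀ := hM.isGeneratingLiouvilleDomain t₀ ht₀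
  obtain ⟨O, hO, hOM⟩ := (SmoothFamily.Fiber.isInducing_incl F t₀).isOpen_iff.1
    (isOpen_interior (s := {x : F.Fiber t₀ | x.incl ∈ M}))
  have hOM' : ∀ q ∈ O, F.proj q = t₀ → q ∈ M := by
    intro q hq hqt
    have h1 : (⟨q, hqt⟩ : F.Fiber t₀) ∈ SmoothFamily.Fiber.incl ⁻¹' O := hq
    rw [hOM] at h1
    have h2 := interior_subset h1
    exact h2
  have hKO : liouvilleFlow hθ (-1) '' K₀ ⊆ O := by
    rintro _ ⟨q, hq, rfl⟩
    have h1 := hM₀.fiberFlow_mem_interior hθ (x := ⟨q, hq.2⟩) hq.1 one_pos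
    rw [← hOM] at h1
    exact h1
  -- a compact neighbourhood of `Φ_{-1}(M_{t₀})` whose part over `t₀` lies inside `M`; the time `-1`
  -- map improves it, but smaller times need not preserve it
  obtain ⟨S₀, hS₀, hKS, hSO⟩ := exists_compact_between
    (hK₀c.image (continuous_liouvilleFlow_apply hθ (-1))) hO hKO
  set G : Set N := liouvilleFlow hθ (-1) ⁻¹' interior S₀ with hG
  have hGo : IsOpen G := isOpen_interior.preimage (continuous_liouvilleFlow_apply hθ (-1))
  have hKG : K₀ ⊆ G := fun q hq => hKS ⟨q, hq, rfl⟩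
  -- over a neighbourhood of `t₀`, the time `-1` map sends `M` and `S₀` into the interior of `S₀`
  obtain ⟨C, hC, ht₀C, hCV⟩ := exists_compact_subset hV₀ ht₀
  have hev1 : ∀ᶠ t in 𝓝 t₀, ∀ q ∈ (M ∩ F.proj ⁻¹' C) \ G, F.proj q ≠ t :=
    eventually_forall_proj_ne ((hM.proper.2 C hCV hC).diff hGo) fun q hq he =>
      hq.2 (hKG ⟨hq.1.1, he⟩)
  have hev2 : ∀ᶠ t in 𝓝 t₀, ∀ q ∈ S₀ \ G, F.proj q ≠ t :=
    eventually_forall_proj_ne (hS₀.diff hGo) fun q hq he =>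
      hq.2 (hKG ⟨hOM' q (hSO hq.1) he, he⟩)
  obtain ⟨V, hVsub, hV, ht₀V⟩ := mem_nhds_iff.1
    (hev1.and (hev2.and (isOpen_interior.mem_nhds ht₀C)))
  have hMG : ∀ q ∈ M, F.proj q ∈ V → liouvilleFlow hθ (-1) q ∈ interior S₀ := by
    intro q hq hqV
    by_contra hn
    exact (hVsub hqV).1 q ⟨⟨hq, (interior_subset (hVsub hqV).2.2 : F.proj q ∈ C)⟩, hn⟩ rfl
  have hSG : ∀ q ∈ S₀, F.proj q ∈ V → liouvilleFlow hθ (-1) q ∈ interior S₀ := by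
    intro q hq hqV
    by_contra hn
    exact (hVsub hqV).2.1 q ⟨hq, hn⟩ rfl
  -- the union over `[0, 1]` of the backward images of `S₀` is preserved by all backward times
  set S : Set N := (fun z : ℝ × N => liouvilleFlow hθ (-z.1) z.2) '' (Icc (0 : ℝ) 1 ×ˢ S₀) with hS
  have hScomp : IsCompact S := (isCompact_Icc.prod hS₀).image
    ((continuous_liouvilleFlow hθ).comp (by fun_prop : Continuous fun z : ℝ × N => (-z.1, z.2)))
  have hnat : ∀ (n : ℕ) (y : N), y ∈ S₀ → F.proj y ∈ V → liouvilleFlow hθ (-n) y ∈ S₀ := by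
    intro n
    induction n with
    | zero => intro y hy _; simpa [liouvilleFlow_zero] using hy
    | succ n ih =>
      intro y hy hyV
      have h1 := ih _ (interior_subset (hSG y hy hyV)) (by rwa [proj_liouvilleFlow])
      rw [← liouvilleFlow_add] at h1
      rw [Nat.cast_add, Nat.cast_one, neg_add]
      exact h1
  refine ⟨V, hV, ht₀V, S, hScomp, ?_, ?_, ?_⟩
  · rintro _ ⟨⟨r, y⟩, ⟨hr, hy⟩, rfl⟩ hqV u hu
    simp only [proj_liouvilleFlow] at hqV
    have h1 : 0 ≤ r + u := add_nonneg hr.1 hu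
    refine ⟨(r + u - ⌊r + u⌋₊, liouvilleFlow hθ (-⌊r + u⌋₊) y),
      ⟨⟨sub_nonneg.2 (Nat.floor_le h1), by linarith [Nat.lt_floor_add_one (r + u)]⟩,
        hnat _ _ hy hqV⟩, ?_⟩
    simp only [← liouvilleFlow_add]
    congr 1
    ring
  · rintro _ ⟨⟨r, y⟩, ⟨hr, hy⟩, rfl⟩ hqV
    simp only [proj_liouvilleFlow] at hqV
    have h1 : liouvilleFlow hθ r ⁻¹' interior S₀ ⊆ S := fun q hq =>
      ⟨(r, liouvilleFlow hθ r q), ⟨hr, interior_subset hq⟩, liouvilleFlow_neg hθ r q⟩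
    refine interior_maximal h1
      (isOpen_interior.preimage (continuous_liouvilleFlow_apply hθ r)) ?_
    simp only [mem_preimage, ← liouvilleFlow_add]
    convert hSG y hy hqV using 2
    ring
  · intro q hq
    obtain ⟨u, hu, hmem⟩ := (hM.isGeneratingLiouvilleDomain (F.proj q)
      (hCV (interior_subset (hVsub hq).2.2))).exists_fiberFlow_mem hθ ⟨q, rfl⟩
    refine ⟨1 + u, by linarith, (0, liouvilleFlow hθ (-1) (liouvilleFlow hθ (-u) q)),
      ⟨⟨le_rfl, zero_le_one⟩, interior_subset
        (hMG _ hmem (by rwa [proj_liouvilleFlow]))⟩, ?_⟩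
    simp only [neg_zero, liouvilleFlow_zero]
    rw [← liouvilleFlow_add, neg_add]

end Traps

/-! ### Cutoff functions along the Liouville flow -/

section Cutoff

variable {E EB HB EN HN B N : Type*}
  [NormedAddCommGroup E] [NormedSpace ℝ E] [FiniteDimensional ℝ E]
  [NormedAddCommGroup EB] [NormedSpace ℝ EB] [FiniteDimensional ℝ EB] [TopologicalSpace HB]
  [NormedAddCommGroup EN] [NormedSpace ℝ EN] [FiniteDimensional ℝ EN] [TopologicalSpace HN]
  {I : ModelWithCorners ℝ EB HB} {J : ModelWithCorners ℝ EN HN}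
  [TopologicalSpace B] [ChartedSpace HB B] [TopologicalSpace N] [ChartedSpace HN N]
  [IsManifold I ∞ B] [T2Space N] [T2Space B]
  {F : SmoothFamily E I J N B} {θ : F.OneForms} {hθ : F.IsLiouvilleFamily θ}

theorem image_liouvilleFlow (a : ℝ) (A : Set N) :
    liouvilleFlow hθ a '' A = liouvilleFlow hθ (-a) ⁻¹' A := by
  ext q
  constructor
  · rintro ⟨y, hy, rfl⟩
    rwa [mem_preimage, liouvilleFlow_neg]
  · exact fun h => ⟨_, h, liouvilleFlow_neg' hθ a q⟩

theorem preimage_interior_subset (a : ℝ) (A : Set N) :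
    liouvilleFlow hθ a ⁻¹' interior A ⊆ interior (liouvilleFlow hθ a ⁻¹' A) :=
  preimage_interior_subset_interior_preimage (continuous_liouvilleFlow_apply hθ a)

/-- Moving a trap forward by the Liouville flow gives a trap. -/
theorem IsTrap.preimage {V : Set B} {S : Set N} (hS : IsTrap hθ V S) {a : ℝ} (ha : 0 ≤ a) :
    IsTrap hθ V (liouvilleFlow hθ (-a) ⁻¹' S) := by
  have hcomm : ∀ u q, liouvilleFlow hθ (-a) (liouvilleFlow hθ (-u) q) =
      liouvilleFlow hθ (-u) (liouvilleFlow hθ (-a) q) := fun u q => by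
    rw [← liouvilleFlow_add, ← liouvilleFlow_add, add_comm]
  refine ⟨?_, fun q hq hV u hu => ?_, fun q hq hV => ?_, fun q hV => ?_⟩
  · rw [← image_liouvilleFlow]
    exact hS.isCompact.image (continuous_liouvilleFlow_apply hθ a)
  · rw [mem_preimage, hcomm]
    exact hS.backward _ hq (by rwa [proj_liouvilleFlow]) u hu
  · refine preimage_interior_subset (-a) S ?_
    rw [mem_preimage, hcomm]
    exact hS.interior _ hq (by rwa [proj_liouvilleFlow])
  · obtain ⟨u, hu, h⟩ := hS.reaches q hV
    refine ⟨u, hu, ?_⟩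
    exact hS.backward _ h (by rwa [proj_liouvilleFlow]) a ha

/-- Every compact set lies, locally over the base, in a trap. -/
theorem exists_isTrap_superset (hθ : F.IsLiouvilleFamily θ)
    (hdom : F.LocallyHasGeneratingDomains θ) (t₀ : B) {C : Set N} (hC : IsCompact C) :
    ∃ V, IsOpen V ∧ t₀ ∈ V ∧ ∃ S, IsTrap hθ V S ∧ ∀ q ∈ C, F.proj q ∈ V → q ∈ S := by
  have := F.locallyCompact_base
  obtain ⟨V, hV, ht₀, S, hS⟩ := exists_isTrap hθ hdom t₀
  obtain ⟨K, hK, ht₀K, hKV⟩ := exists_compact_subset hV ht₀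
  have hcomp : IsCompact (C ∩ F.proj ⁻¹' K) :=
    hC.inter_right (hK.isClosed.preimage F.smooth.continuous)
  obtain ⟨T, hT⟩ := hcomp.elim_finite_subcover
    (fun n : ℕ => liouvilleFlow hθ (-n) ⁻¹' interior S)
    (fun n => isOpen_interior.preimage (continuous_liouvilleFlow_apply hθ _)) (by
      rintro q ⟨-, hq⟩
      obtain ⟨u, hu, hmem⟩ := hS.reaches q (hKV hq)
      have h1 := hS.backward _ hmem (by rw [proj_liouvilleFlow]; exact hKV hq) (⌈u⌉₊ - u)
        (sub_nonneg.2 (Nat.le_ceil u))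
      have h2 := hS.interior _ h1 (by simp only [proj_liouvilleFlow]; exact hKV hq)
      refine mem_iUnion.2 ⟨⌈u⌉₊ + 1, ?_⟩
      simp only [← liouvilleFlow_add] at h2
      rw [mem_preimage]
      convert h2 using 2
      push_cast
      ring)
  refine ⟨V ∩ interior K, hV.inter isOpen_interior, ⟨ht₀, ht₀K⟩,
    liouvilleFlow hθ (-(T.sup id : ℕ)) ⁻¹' S, ((hS.preimage (Nat.cast_nonneg _)).mono hθ
      inter_subset_left), fun q hq hqV => ?_⟩
  obtain ⟨n, hn, hnq⟩ := mem_iUnion₂.1 (hT ⟨hq, (interior_subset hqV.2 : F.proj q ∈ K)⟩)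
  have h1 : n ≤ T.sup id := Finset.le_sup (f := id) hn
  have h2 := hS.backward _ (interior_subset hnq) (by rw [proj_liouvilleFlow]; exact hqV.1)
    ((T.sup id : ℕ) - n) (sub_nonneg.2 (by exact_mod_cast h1))
  rw [← liouvilleFlow_add] at h2
  rw [mem_preimage]
  convert h2 using 2
  ring

variable [SecondCountableTopology B] [SecondCountableTopology N] [IsManifold J ∞ N]

/-- A cutoff function which, locally over the base, equals one outside a compact set, and which
vanishes far back along every Liouville flow line. -/
theorem exists_cutoff (hθ : F.IsLiouvilleFamily θ) (hdom : F.LocallyHasGeneratingDomains θ) :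
    ∃ χ : N → ℝ, ContMDiff J 𝓘(ℝ, ℝ) ∞ χ ∧
      (∀ t₀, ∃ V, IsOpen V ∧ t₀ ∈ V ∧ ∃ C, IsCompact C ∧ ∀ q, F.proj q ∈ V → χ q ≠ 1 → q ∈ C) ∧
      ∀ q₀, ∃ T : ℝ, ∀ᶠ q in 𝓝 q₀, ∀ u, T ≤ u → χ (liouvilleFlow hθ (-u) q) = 0 := by
  have := F.locallyCompact_base
  have := F.locallyCompact_total
  choose V hV hmemV S hS using exists_isTrap hθ hdom
  choose C hC hSC using fun t => exists_compact_superset (hS t).isCompact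
  obtain ⟨ρ, hρ⟩ := SmoothPartitionOfUnity.exists_isSubordinate I (isClosed_univ (X := B)) V hV
    (fun t _ => mem_iUnion.2 ⟨t, hmemV t⟩)
  have hη : ∀ t, ∃ f : N → ℝ, ContMDiff J 𝓘(ℝ, ℝ) ∞ f ∧ (∀ q, f q ≠ 0 → q ∈ C t) ∧
      ∀ q ∈ S t, f q = 1 := by
    intro t
    obtain ⟨f, hf0, hf1, -⟩ := exists_contMDiffMap_zero_one_of_isClosed J (n := ⊤)
      (isOpen_interior (s := C t)).isClosed_compl (hS t).isCompact.isClosed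
      (disjoint_left.2 fun q hq hq' => hq (hSC t hq'))
    refine ⟨f, f.contMDiff, fun q hq => ?_, fun q hq => hf1 hq⟩
    by_contra h
    exact hq (hf0 fun h' => h (interior_subset h'))
  choose η hηs hη0 hη1 using hη
  -- `χ = 1 - w`, where `w` is compactly supported locally over `B`, and equals one at the points
  -- that lie in all traps which have a positive weight there
  set w : N → ℝ := fun q => ∑ᶠ t, ρ t (F.proj q) * η t q with hw
  have hsupp : ∀ q t, ρ t (F.proj q) ≠ 0 → t ∈ ρ.finsupport (F.proj q) := fun q t h =>
    (ρ.mem_finsupport _).2 h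
  have hwsmooth : ContMDiff J 𝓘(ℝ, ℝ) ∞ w := by
    refine contMDiff_finsum (fun t => ?_) ?_
    · exact ((ρ t).contMDiff.comp F.smooth).mul (hηs t)
    · refine (ρ.locallyFinite.preimage_continuous F.smooth.continuous).subset fun t q hq => ?_
      exact left_ne_zero_of_mul hq
  refine ⟨fun q => 1 - w q, contMDiff_const.sub hwsmooth, fun t₀ => ?_, fun q₀ => ?_⟩
  · obtain ⟨V', hV'sub, hV', ht₀⟩ := mem_nhds_iff.1 (ρ.eventually_finsupport_subset t₀)
    refine ⟨V', hV', ht₀, ⋃ t ∈ ρ.fintsupport t₀, C t,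
      (ρ.fintsupport t₀).isCompact_biUnion fun t _ => hC t, fun q hq hne => ?_⟩
    have h1 : ∑ᶠ t, ρ t (F.proj q) * η t q ≠ 0 := fun h => hne (by simp [hw, h])
    obtain ⟨t, ht⟩ : ∃ t, ρ t (F.proj q) * η t q ≠ 0 := by
      by_contra! h
      exact h1 (by simp only [h, finsum_zero])
    exact mem_iUnion₂.2 ⟨t, hV'sub hq (hsupp q t (left_ne_zero_of_mul ht)),
      hη0 t q (right_ne_zero_of_mul ht)⟩
  · have h1 : ∀ t ∈ ρ.fintsupport (F.proj q₀), ∃ T : ℝ, ∀ᶠ q in 𝓝 q₀, ∀ u, T ≤ u →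
        liouvilleFlow hθ (-u) q ∈ S t := by
      intro t ht
      have htV : F.proj q₀ ∈ V t := hρ t ((ρ.mem_fintsupport_iff _ _).1 ht)
      obtain ⟨u, hu, hmem⟩ := (hS t).reaches q₀ htV
      have h2 := (hS t).interior _ hmem (by rwa [proj_liouvilleFlow])
      rw [← liouvilleFlow_add] at h2
      refine ⟨1 + u, ?_⟩
      filter_upwards [(continuous_liouvilleFlow_apply hθ _).continuousAt.eventually
        (isOpen_interior.mem_nhds h2), F.smooth.continuous.continuousAt.eventually
        ((hV t).mem_nhds htV)] with q h3 h4 r hr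
      have h5 := (hS t).backward _ (interior_subset h3) (by rwa [proj_liouvilleFlow])
        (r - (1 + u)) (by linarith)
      rw [← liouvilleFlow_add] at h5
      convert h5 using 2
      ring
    choose! T hT using h1
    obtain ⟨T', hT'⟩ := ((ρ.fintsupport (F.proj q₀)).image T).bddAbove
    refine ⟨T', ?_⟩
    have h3 : ∀ᶠ q in 𝓝 q₀, ∀ t ∈ ρ.fintsupport (F.proj q₀), ∀ u, T t ≤ u →
        liouvilleFlow hθ (-u) q ∈ S t := by
      rw [Finset.eventually_all]
      exact hT
    filter_upwards [h3, F.smooth.continuous.continuousAt.eventually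
      (ρ.eventually_finsupport_subset (F.proj q₀))] with q h4 h5 u hu
    have h6 : w (liouvilleFlow hθ (-u) q) = ∑ᶠ t, ρ t (F.proj q) := by
      simp only [hw, proj_liouvilleFlow]
      refine finsum_congr fun t => ?_
      by_cases ht : ρ t (F.proj q) = 0
      · rw [ht, zero_mul]
      · have h7 := h5 (hsupp q t ht)
        rw [hη1 t _ (h4 t h7 u ((hT' (by
          simpa using ⟨t, h7, rfl⟩)).trans hu)), mul_one]
    rw [h6, ρ.sum_eq_one (mem_univ _), sub_self]

end Cutoff

/-! ### The extension of the one-forms to the pull-back of the family -/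

section ExtendedForm

variable {E EB HB EN HN B N : Type*}
  [NormedAddCommGroup E] [NormedSpace ℝ E] [FiniteDimensional ℝ E]
  [NormedAddCommGroup EB] [NormedSpace ℝ EB] [TopologicalSpace HB]
  [NormedAddCommGroup EN] [NormedSpace ℝ EN] [TopologicalSpace HN]
  {I : ModelWithCorners ℝ EB HB} {J : ModelWithCorners ℝ EN HN}
  [TopologicalSpace B] [ChartedSpace HB B] [TopologicalSpace N] [ChartedSpace HN N]
  {EP HP P : Type*} [NormedAddCommGroup EP] [NormedSpace ℝ EP]
  [TopologicalSpace HP]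
  {IP : ModelWithCorners ℝ EP HP} [TopologicalSpace P] [ChartedSpace HP P]
  {F : SmoothFamily E I J N B} {h : P × ℝ → B} {θ : F.OneForms}

/-- The derivative in the time direction of the change of coordinates from `c` to `c'`. -/
def timeDeriv (c c' : F.ProductChart) (h : P × ℝ → B) (z : E × (P × ℝ)) : E :=
  fderiv ℝ (c.changeAlong c' h z.2.1) (z.1, z.2.2) (0, 1)

theorem fderiv_changeAlong (hh : ContMDiff (IP.prod 𝓘(ℝ, ℝ)) I ∞ h) {c c' : F.ProductChart}
    {z : E × (P × ℝ)} (hz : (z.1, h z.2) ∈ c.overlap c') (v : E) (r : ℝ) :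
    fderiv ℝ (c.changeAlong c' h z.2.1) (z.1, z.2.2) (v, r) =
      c.fibDeriv c' (z.1, h z.2) v + r • timeDeriv c c' h z := by
  have h1 : HasFDerivAt (c.changeAlong c' h z.2.1) _ (z.1, z.2.2) :=
    ((contDiffAt_changeAlong hh (p := z.2.1) (s := z.2.2) hz).differentiableAt
      (by simp)).hasFDerivAt
  have h2 := HasFDerivAt.comp z.1 (f := fun e : E => (e, z.2.2)) h1
    ((hasFDerivAt_id z.1).prodMk (hasFDerivAt_const z.2.2 z.1))
  have h3 : c.fibDeriv c' (z.1, h z.2) v =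
      fderiv ℝ (c.changeAlong c' h z.2.1) (z.1, z.2.2) (v, 0) :=
    congrArg (fun T => T v) h2.fderiv
  rw [h3, timeDeriv, ← map_smul, ← map_add]
  simp

/-- The cocycle rule for time derivatives of coordinate changes. -/
theorem timeDeriv_comp (hh : ContMDiff (IP.prod 𝓘(ℝ, ℝ)) I ∞ h) {c c' c'' : F.ProductChart}
    {z : E × (P × ℝ)} (hz : (z.1, h z.2) ∈ c.overlap c') (hz' : (z.1, h z.2) ∈ c.overlap c'') :
    timeDeriv c c'' h z = c'.fibDeriv c'' (c.change c' (z.1, h z.2), h z.2) (timeDeriv c c' h z) +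
      timeDeriv c' c'' h (c.change c' (z.1, h z.2), z.2) := by
  have h1 : (c.change c' (z.1, h z.2), h z.2) ∈ c'.overlap c'' :=
    ⟨change_mem_target hz, by rw [pt_change hz]; exact hz'.2⟩
  have h2 : HasFDerivAt (c'.changeAlong c'' h z.2.1) _ (c.change c' (z.1, h z.2), z.2.2) :=
    ((contDiffAt_changeAlong hh (p := z.2.1) (s := z.2.2) h1).differentiableAt
      (by simp)).hasFDerivAt
  have h3 : HasFDerivAt (c.changeAlong c' h z.2.1) _ (z.1, z.2.2) :=
    ((contDiffAt_changeAlong hh (p := z.2.1) (s := z.2.2) hz).differentiableAt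
      (by simp)).hasFDerivAt
  have h4 := HasFDerivAt.comp (z.1, z.2.2)
    (f := fun w : E × ℝ => (c.changeAlong c' h z.2.1 w, w.2)) h2 (h3.prodMk hasFDerivAt_snd)
  have hev : ∀ᶠ w : E × ℝ in 𝓝 (z.1, z.2.2), (w.1, h (z.2.1, w.2)) ∈ c.overlap c' := by
    have hc : Continuous fun w : E × ℝ => (w.1, h (z.2.1, w.2)) :=
      continuous_fst.prodMk (hh.continuous.comp (by fun_prop))
    exact hc.continuousAt.eventually (isOpen_overlap.mem_nhds hz)
  have h5 := h4.congr_of_eventuallyEq (f₁ := c.changeAlong c'' h z.2.1)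
    (hev.mono fun w hw => (change_change hw).symm)
  have h6 := congrArg (fun T => T (0, 1)) h5.fderiv
  simp only [ContinuousLinearMap.comp_apply, ContinuousLinearMap.prod_apply,
    ContinuousLinearMap.coe_snd'] at h6
  have h7 := fderiv_changeAlong hh (z := (c.change c' (z.1, h z.2), z.2)) h1
    (timeDeriv c c' h z) 1
  rw [one_smul] at h7
  exact h6.trans h7

/-- The coefficient of `ds` in the extension of the forms `θ` to the pull-back of the family:
product charts define local extensions, by forms without `ds`-component, and these are averaged
with a partition of unity. -/
def connForm (ρ : SmoothPartitionOfUnity N J N) (θ : F.OneForms) (h : P × ℝ → B)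
    (c : F.ProductChart) (z : E × (P × ℝ)) : ℝ :=
  ∑ᶠ j : N, ρ j (c.pt (z.1, h z.2)) *
    (F.chartOf j).form θ (c.change (F.chartOf j) (z.1, h z.2), h z.2)
      (timeDeriv c (F.chartOf j) h z)

/-- The extension of the forms `θ` to a form in the variables `(e, s)`, the parameter `p` being
fixed; `κ` is a function on the pull-back which is added to the coefficient of `ds`. -/
def extForm (ρ : SmoothPartitionOfUnity N J N) (θ : F.OneForms) (h : P × ℝ → B)
    (κ : N → P × ℝ → ℝ) (c : F.ProductChart) (p : P) (w : E × ℝ) : E × ℝ →L[ℝ] ℝ :=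
  (c.form θ (w.1, h (p, w.2))).comp (ContinuousLinearMap.fst ℝ E ℝ) +
    (connForm ρ θ h c (w.1, (p, w.2)) + κ (c.pt (w.1, h (p, w.2))) (p, w.2)) •
      ContinuousLinearMap.snd ℝ E ℝ

variable {ρ : SmoothPartitionOfUnity N J N} {κ : N → P × ℝ → ℝ}

theorem extForm_apply (c : F.ProductChart) (p : P) (w : E × ℝ) (v : E) (r : ℝ) :
    extForm ρ θ h κ c p w (v, r) = c.form θ (w.1, h (p, w.2)) v +
      (connForm ρ θ h c (w.1, (p, w.2)) + κ (c.pt (w.1, h (p, w.2))) (p, w.2)) * r := rfl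

/-- The averaged coefficient of `ds` transforms as required of a one-form; each summand does so by
the cocycle rule, and the weights add up to one. -/
theorem connForm_change (hh : ContMDiff (IP.prod 𝓘(ℝ, ℝ)) I ∞ h)
    (hρ : ρ.IsSubordinate fun j => (F.chartOf j).toHomeo.source) {c c' : F.ProductChart}
    {z : E × (P × ℝ)} (hz : (z.1, h z.2) ∈ c.overlap c') :
    connForm ρ θ h c z = connForm ρ θ h c' (c.change c' (z.1, h z.2), z.2) +
      c'.form θ (c.change c' (z.1, h z.2), h z.2) (timeDeriv c c' h z) := by
  set q := c.pt (z.1, h z.2) with hq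
  have hfin : ∀ f : N → ℝ, (Function.support fun j => ρ j q * f j).Finite := fun f =>
    (ρ.locallyFinite.point_finite q).subset fun j hj => left_ne_zero_of_mul hj
  have h1 : c'.form θ (c.change c' (z.1, h z.2), h z.2) (timeDeriv c c' h z) =
      ∑ᶠ j, ρ j q * c'.form θ (c.change c' (z.1, h z.2), h z.2) (timeDeriv c c' h z) := by
    rw [← finsum_mul' _ _ (ρ.locallyFinite.point_finite q), ρ.sum_eq_one (mem_univ q), one_mul]
  have hpc : c'.pt (c.change c' (z.1, h z.2), h z.2) = q := pt_change hz
  rw [h1, connForm, connForm]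
  simp only [hpc, ← hq]
  rw [← finsum_add_distrib (hfin _) (hfin _)]
  refine finsum_congr fun j => ?_
  by_cases hj : ρ j q = 0
  · simp [hj]
  have hjq : q ∈ (F.chartOf j).toHomeo.source := hρ j (subset_tsupport _ hj)
  have hov : (c.change c' (z.1, h z.2), h z.2) ∈ c'.overlap (F.chartOf j) :=
    ⟨change_mem_target hz, by rw [pt_change hz]; exact hjq⟩
  rw [timeDeriv_comp hh hz ⟨hz.1, hjq⟩, map_add, form_eq_comp θ hov, change_change hz]
  simp only [ContinuousLinearMap.comp_apply]
  ring

/-- The change of coordinates on the pull-back, with the parameter fixed. -/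
def changeExt (c c' : F.ProductChart) (h : P × ℝ → B) (p : P) (w : E × ℝ) : E × ℝ :=
  (c.changeAlong c' h p w, w.2)

theorem contDiffAt_changeExt (hh : ContMDiff (IP.prod 𝓘(ℝ, ℝ)) I ∞ h) {c c' : F.ProductChart}
    {p : P} {w : E × ℝ} (hw : (w.1, h (p, w.2)) ∈ c.overlap c') :
    ContDiffAt ℝ ∞ (changeExt c c' h p) w :=
  (contDiffAt_changeAlong hh hw).prodMk contDiffAt_snd

theorem fderiv_changeExt (hh : ContMDiff (IP.prod 𝓘(ℝ, ℝ)) I ∞ h) {c c' : F.ProductChart}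
    {p : P} {w : E × ℝ} (hw : (w.1, h (p, w.2)) ∈ c.overlap c') (v : E) (r : ℝ) :
    fderiv ℝ (changeExt c c' h p) w (v, r) = (fderiv ℝ (c.changeAlong c' h p) w (v, r), r) := by
  have h1 := (((contDiffAt_changeAlong hh hw).differentiableAt (by simp)).hasFDerivAt.prodMk
    (hasFDerivAt_snd (p := w))).fderiv
  exact congrArg (fun T => T (v, r)) h1

theorem eventually_mem_overlap_curve (hh : Continuous h) {c c' : F.ProductChart} {p : P}
    {w : E × ℝ} (hw : (w.1, h (p, w.2)) ∈ c.overlap c') :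
    ∀ᶠ w' : E × ℝ in 𝓝 w, (w'.1, h (p, w'.2)) ∈ c.overlap c' := by
  have hc : Continuous fun w : E × ℝ => (w.1, h (p, w.2)) :=
    continuous_fst.prodMk (hh.comp (by fun_prop))
  exact hc.continuousAt.eventually (isOpen_overlap.mem_nhds hw)

/-- The extended forms are compatible with changes of product charts. -/
theorem extForm_change (hh : ContMDiff (IP.prod 𝓘(ℝ, ℝ)) I ∞ h)
    (hρ : ρ.IsSubordinate fun j => (F.chartOf j).toHomeo.source) {c c' : F.ProductChart}
    {p : P} {w : E × ℝ} (hw : (w.1, h (p, w.2)) ∈ c.overlap c') :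
    extForm ρ θ h κ c p w =
      (extForm ρ θ h κ c' p (changeExt c c' h p w)).comp (fderiv ℝ (changeExt c c' h p) w) := by
  refine ContinuousLinearMap.ext fun ⟨v, r⟩ => ?_
  rw [ContinuousLinearMap.comp_apply, fderiv_changeExt hh hw,
    fderiv_changeAlong hh (z := (w.1, (p, w.2))) hw, extForm_apply, extForm_apply,
    connForm_change hh hρ (z := (w.1, (p, w.2))) hw, form_eq_comp θ hw]
  simp only [changeExt, changeAlong, pt_change hw, ContinuousLinearMap.comp_apply, map_add,
    map_smul, smul_eq_mul]
  ring

section Smooth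

variable [IsManifold IP ∞ P]

theorem contMDiffAt_fderiv_curve {Y : Type*} [NormedAddCommGroup Y] [NormedSpace ℝ Y]
    {f : E × (P × ℝ) → Y} {z : E × (P × ℝ)}
    (hf : ContMDiffAt (𝓘(ℝ, E).prod (IP.prod 𝓘(ℝ, ℝ))) 𝓘(ℝ, Y) ∞ f z) :
    ContMDiffAt (𝓘(ℝ, E).prod (IP.prod 𝓘(ℝ, ℝ))) 𝓘(ℝ, E × ℝ →L[ℝ] Y) ∞
      (fun z => fderiv ℝ (fun w : E × ℝ => f (w.1, (z.2.1, w.2))) (z.1, z.2.2)) z := by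
  have h1 : ContMDiffAt ((𝓘(ℝ, E).prod (IP.prod 𝓘(ℝ, ℝ))).prod 𝓘(ℝ, E × ℝ))
      (𝓘(ℝ, E).prod (IP.prod 𝓘(ℝ, ℝ))) ∞
      (fun y : (E × (P × ℝ)) × (E × ℝ) => (y.2.1, (y.1.2.1, y.2.2))) (z, (z.1, z.2.2)) := by
    have hf1 : ContMDiff 𝓘(ℝ, E × ℝ) 𝓘(ℝ, E) ∞ (Prod.fst : E × ℝ → E) := contDiff_fst.contMDiff
    have hf2 : ContMDiff 𝓘(ℝ, E × ℝ) 𝓘(ℝ, ℝ) ∞ (Prod.snd : E × ℝ → ℝ) := contDiff_snd.contMDiff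
    exact ((hf1.comp contMDiff_snd).prodMk ((contMDiff_fst.comp (contMDiff_snd.comp
      contMDiff_fst)).prodMk (hf2.comp contMDiff_snd))).contMDiffAt
  exact contMDiffAt_fderiv (f := fun (z : E × (P × ℝ)) (w : E × ℝ) => f (w.1, (z.2.1, w.2)))
    (g := fun z => (z.1, z.2.2)) (ContMDiffAt.comp (g := f) (z, (z.1, z.2.2)) hf h1)
    (contMDiffAt_fst.prodMk_space (contMDiffAt_snd.comp _ contMDiffAt_snd))

theorem contMDiffAt_lift (hh : ContMDiff (IP.prod 𝓘(ℝ, ℝ)) I ∞ h) (z : E × (P × ℝ)) :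
    ContMDiffAt (𝓘(ℝ, E).prod (IP.prod 𝓘(ℝ, ℝ))) (𝓘(ℝ, E).prod I) ∞
      (fun z : E × (P × ℝ) => (z.1, h z.2)) z := (contMDiff_lift hh).contMDiffAt

theorem contMDiffAt_connForm (hθ : SmoothFamily.OneForms.IsSmooth θ)
    (hh : ContMDiff (IP.prod 𝓘(ℝ, ℝ)) I ∞ h)
    (hρ : ρ.IsSubordinate fun j => (F.chartOf j).toHomeo.source) {c : F.ProductChart}
    {z : E × (P × ℝ)} (hz : z ∈ c.dom h) :
    ContMDiffAt (𝓘(ℝ, E).prod (IP.prod 𝓘(ℝ, ℝ))) 𝓘(ℝ, ℝ) ∞ (connForm ρ θ h c) z := by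
  have hpt : ContMDiffAt (𝓘(ℝ, E).prod (IP.prod 𝓘(ℝ, ℝ))) J ∞
      (fun z : E × (P × ℝ) => c.pt (z.1, h z.2)) z :=
    ContMDiffAt.comp (g := c.pt) z (contMDiffOn_pt.contMDiffAt (c.toHomeo.open_target.mem_nhds hz))
      (contMDiffAt_lift hh z)
  have hev : ∀ᶠ z' in 𝓝 z, connForm ρ θ h c z' =
      ∑ j ∈ ρ.fintsupport (c.pt (z.1, h z.2)), ρ j (c.pt (z'.1, h z'.2)) *
        (F.chartOf j).form θ (c.change (F.chartOf j) (z'.1, h z'.2), h z'.2)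
          (timeDeriv c (F.chartOf j) h z') := by
    filter_upwards [hpt.continuousAt.eventually
      (ρ.eventually_finsupport_subset (c.pt (z.1, h z.2)))] with z' hz'
    refine finsum_eq_sum_of_support_subset _ fun j hj => hz' ?_
    exact (ρ.mem_finsupport _).2 (left_ne_zero_of_mul hj)
  refine ContMDiffAt.congr_of_eventuallyEq (ContMDiffAt.sum fun j hj => ?_) hev
  have hjq : c.pt (z.1, h z.2) ∈ (F.chartOf j).toHomeo.source :=
    hρ j ((ρ.mem_fintsupport_iff _ _).1 hj)
  have hov : (z.1, h z.2) ∈ c.overlap (F.chartOf j) := ⟨hz, hjq⟩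
  have hch : ContMDiffAt (𝓘(ℝ, E).prod (IP.prod 𝓘(ℝ, ℝ))) 𝓘(ℝ, E) ∞
      (fun z : E × (P × ℝ) => c.change (F.chartOf j) (z.1, h z.2)) z :=
    ContMDiffAt.comp (g := c.change (F.chartOf j)) z
      (contMDiffOn_change.contMDiffAt (isOpen_overlap.mem_nhds hov)) (contMDiffAt_lift hh z)
  refine ContMDiffAt.mul (ContMDiffAt.comp (g := ρ j) z (ρ j).contMDiff.contMDiffAt hpt)
    (ContMDiffAt.clm_apply ?_ ?_)
  · refine ContMDiffAt.comp (g := (F.chartOf j).form θ) z ((contMDiffOn_form hθ _).contMDiffAt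
      ((F.chartOf j).toHomeo.open_target.mem_nhds (change_mem_target hov))) ?_
    exact hch.prodMk (hh.comp contMDiff_snd).contMDiffAt
  · exact (contMDiffAt_fderiv_curve hch).clm_apply contMDiffAt_const

variable (hθ : SmoothFamily.OneForms.IsSmooth θ) (hh : ContMDiff (IP.prod 𝓘(ℝ, ℝ)) I ∞ h)
  (hρ : ρ.IsSubordinate fun j => (F.chartOf j).toHomeo.source) (hκ : IsSmoothOnPullback IP F h κ)

include hθ hh hρ hκ

theorem contMDiffAt_extForm {c : F.ProductChart} {z : E × (P × ℝ)} (hz : z ∈ c.dom h) :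
    ContMDiffAt (𝓘(ℝ, E).prod (IP.prod 𝓘(ℝ, ℝ))) 𝓘(ℝ, E × ℝ →L[ℝ] ℝ) ∞
      (fun z => extForm ρ θ h κ c z.2.1 (z.1, z.2.2)) z := by
  have h1 : ContMDiffAt (𝓘(ℝ, E).prod (IP.prod 𝓘(ℝ, ℝ))) 𝓘(ℝ, E →L[ℝ] ℝ) ∞
      (fun z : E × (P × ℝ) => c.form θ (z.1, h z.2)) z :=
    ContMDiffAt.comp (g := c.form θ) z ((contMDiffOn_form hθ c).contMDiffAt
      (c.toHomeo.open_target.mem_nhds hz)) (contMDiffAt_lift hh z)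
  have h2 := (contMDiffAt_connForm hθ hh hρ hz).add
    ((hκ c).contMDiffAt ((isOpen_dom hh.continuous c).mem_nhds hz))
  exact (h1.clm_comp contMDiffAt_const).add (h2.smul contMDiffAt_const)

theorem contDiffAt_extForm {c : F.ProductChart} {p : P} {w : E × ℝ}
    (hw : (w.1, h (p, w.2)) ∈ c.toHomeo.target) : ContDiffAt ℝ ∞ (extForm ρ θ h κ c p) w :=
  contDiffAt_of_contMDiffOn (isOpen_dom hh.continuous c) (O := c.dom h) (p := p)
    (f := fun z => extForm ρ θ h κ c z.2.1 (z.1, z.2.2))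
    (fun _ hz => (contMDiffAt_extForm hθ hh hρ hκ hz).contMDiffWithinAt) hw

theorem contMDiffAt_dForm_extForm {c : F.ProductChart} {z : E × (P × ℝ)} (hz : z ∈ c.dom h) :
    ContMDiffAt (𝓘(ℝ, E).prod (IP.prod 𝓘(ℝ, ℝ))) 𝓘(ℝ, E × ℝ →L[ℝ] E × ℝ →L[ℝ] ℝ) ∞
      (fun z => dForm (extForm ρ θ h κ c z.2.1) (z.1, z.2.2)) z := by
  have h1 := contMDiffAt_fderiv_curve (contMDiffAt_extForm hθ hh hρ hκ hz)
  have h2 : ContMDiffAt (𝓘(ℝ, E).prod (IP.prod 𝓘(ℝ, ℝ))) 𝓘(ℝ, E × ℝ →L[ℝ] E × ℝ →L[ℝ] ℝ) ∞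
      (fun z : E × (P × ℝ) => flipCLM (E × ℝ)
        (fderiv ℝ (fun w : E × ℝ => extForm ρ θ h κ c z.2.1 (w.1, w.2)) (z.1, z.2.2))) z :=
    ContMDiffAt.comp (g := flipCLM (E × ℝ)) z (flipCLM (E × ℝ)).contDiff.contMDiff.contMDiffAt h1
  exact h1.sub h2

end Smooth

end ExtendedForm

/-! ### The lift to the kernel of the exterior derivative -/

section HorizontalLift

variable {E EB HB EN HN B N : Type*}
  [NormedAddCommGroup E] [NormedSpace ℝ E] [FiniteDimensional ℝ E]
  [NormedAddCommGroup EB] [NormedSpace ℝ EB] [TopologicalSpace HB]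
  [NormedAddCommGroup EN] [NormedSpace ℝ EN] [TopologicalSpace HN]
  {I : ModelWithCorners ℝ EB HB} {J : ModelWithCorners ℝ EN HN}
  [TopologicalSpace B] [ChartedSpace HB B] [TopologicalSpace N] [ChartedSpace HN N]
  [IsManifold I ∞ B]
  {EP HP P : Type*} [NormedAddCommGroup EP] [NormedSpace ℝ EP]
  [TopologicalSpace HP]
  {IP : ModelWithCorners ℝ EP HP} [TopologicalSpace P] [ChartedSpace HP P] [IsManifold IP ∞ P]
  {F : SmoothFamily E I J N B} {h : P × ℝ → B} {θ : F.OneForms}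
  {ρ : SmoothPartitionOfUnity N J N} {κ : N → P × ℝ → ℝ}

/-- The coordinate expression of the lift of `∂/∂s` to the kernel of the exterior derivative of the
extended form. -/
def liftCoef (ρ : SmoothPartitionOfUnity N J N) (θ : F.OneForms) (h : P × ℝ → B)
    (κ : N → P × ℝ → ℝ) (c : F.ProductChart) (z : E × (P × ℝ)) : E :=
  (c.symp θ (z.1, h z.2)).inverse
    (-(dForm (extForm ρ θ h κ c z.2.1) (z.1, z.2.2) (0, 1)).comp (ContinuousLinearMap.inl ℝ E ℝ))

variable (hθ : F.IsLiouvilleFamily θ) (hh : ContMDiff (IP.prod 𝓘(ℝ, ℝ)) I ∞ h)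
  (hρ : ρ.IsSubordinate fun j => (F.chartOf j).toHomeo.source) (hκ : IsSmoothOnPullback IP F h κ)

include hθ hh hρ hκ

/-- On vectors tangent to the fibres, the exterior derivative of the extended form is the
symplectic form. -/
theorem dForm_extForm_vertical {c : F.ProductChart} {p : P} {w : E × ℝ}
    (hw : (w.1, h (p, w.2)) ∈ c.toHomeo.target) (a b : E) :
    dForm (extForm ρ θ h κ c p) w (a, 0) (b, 0) = c.symp θ (w.1, h (p, w.2)) a b := by
  have hf : ∀ e : E, HasFDerivAt (fun e : E => (e, w.2)) (ContinuousLinearMap.inl ℝ E ℝ) e :=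
    fun e => (hasFDerivAt_id e).prodMk (hasFDerivAt_const w.2 e)
  have h1 := dForm_pullback (l := fun e => c.form θ (e, h (p, w.2)))
    (l' := extForm ρ θ h κ c p) (f := fun e : E => (e, w.2)) (x := w.1)
    (contDiffAt_id.prodMk contDiffAt_const)
    ((contDiffAt_extForm hθ.smooth hh hρ hκ hw).differentiableAt (by simp))
    (Filter.Eventually.of_forall fun e => by
      rw [(hf e).fderiv]
      ext v
      simp [extForm_apply]) a b
  rw [(hf w.1).fderiv] at h1
  exact h1.symm

/-- The contraction of the exterior derivative with the lift vanishes on vertical vectors by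
construction, and on the lift itself since the exterior derivative is alternating; together these
span. -/
theorem dForm_extForm_liftCoef {c : F.ProductChart} {p : P} {w : E × ℝ}
    (hw : (w.1, h (p, w.2)) ∈ c.toHomeo.target) :
    dForm (extForm ρ θ h κ c p) w (liftCoef ρ θ h κ c (w.1, (p, w.2)), 1) = 0 := by
  set a := liftCoef ρ θ h κ c (w.1, (p, w.2)) with ha
  have h1 : ∀ b : E, dForm (extForm ρ θ h κ c p) w (a, 1) (b, 0) = 0 := by
    intro b
    have h2 : ((a, 1) : E × ℝ) = (a, 0) + (0, 1) := by simp
    rw [h2, map_add, add_apply,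
      dForm_extForm_vertical hθ hh hρ hκ hw, ha, liftCoef,
      (isInvertible_symp hθ hw).self_apply_inverse]
    simp
  refine ContinuousLinearMap.ext fun ⟨v, r⟩ => ?_
  have h3 : ((v, r) : E × ℝ) = (v - r • a, 0) + r • (a, 1) := by simp
  rw [h3, map_add, map_smul, h1, dForm_self]
  simp

/-- The lift is determined by its pairings with vertical vectors, by nondegeneracy on the fibres. -/
theorem eq_liftCoef {c : F.ProductChart} {p : P} {w : E × ℝ}
    (hw : (w.1, h (p, w.2)) ∈ c.toHomeo.target) {a : E}
    (ha : ∀ b : E, dForm (extForm ρ θ h κ c p) w (a, 1) (b, 0) = 0) :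
    a = liftCoef ρ θ h κ c (w.1, (p, w.2)) := by
  refine eq_of_symp_eq hθ hw fun b => ?_
  have h1 := ha b
  have h2 := congrArg (fun T => T (b, 0)) (dForm_extForm_liftCoef hθ hh hρ hκ hw)
  have h3 : ∀ a : E, ((a, 1) : E × ℝ) = (a, 0) + (0, 1) := fun a => by simp
  simp only [h3 (liftCoef _ _ _ _ _ _), h3 a, map_add, add_apply,
    dForm_extForm_vertical hθ hh hρ hκ hw, zero_apply] at h1 h2
  linarith

theorem liftCoef_change {c c' : F.ProductChart} {p : P} {w : E × ℝ}
    (hw : (w.1, h (p, w.2)) ∈ c.overlap c') :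
    liftCoef ρ θ h κ c' (c.changeAlong c' h p w, (p, w.2)) =
      fderiv ℝ (c.changeAlong c' h p) w (liftCoef ρ θ h κ c (w.1, (p, w.2)), 1) := by
  refine (eq_liftCoef hθ hh hρ hκ (w := changeExt c c' h p w) (change_mem_target hw)
    fun b => ?_).symm
  have h1 := dForm_pullback (l := extForm ρ θ h κ c p) (l' := extForm ρ θ h κ c' p)
    (f := changeExt c c' h p) (x := w)
    ((contDiffAt_changeExt hh hw).of_le (WithTop.coe_le_coe.2 (le_top : (2 : ℕ∞) ≤ ⊤)))
    ((contDiffAt_extForm hθ.smooth hh hρ hκ (change_mem_target hw)).differentiableAt (by simp))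
    ((eventually_mem_overlap_curve hh.continuous hw).mono fun w' hw' => extForm_change hh hρ hw')
    (liftCoef ρ θ h κ c (w.1, (p, w.2)), 1)
    (c'.fibDeriv c (c.change c' (w.1, h (p, w.2)), h (p, w.2)) b, 0)
  rw [dForm_extForm_liftCoef hθ hh hρ hκ hw.1, fderiv_changeExt hh hw, fderiv_changeExt hh hw,
    fderiv_changeAlong hh (z := (w.1, (p, w.2))) hw
      (c'.fibDeriv c (c.change c' (w.1, h (p, w.2)), h (p, w.2)) b), zero_smul, add_zero,
    fibDeriv_rightInverse hw] at h1
  exact h1.symm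

theorem contMDiffAt_liftCoef {c : F.ProductChart} {z : E × (P × ℝ)} (hz : z ∈ c.dom h) :
    ContMDiffAt (𝓘(ℝ, E).prod (IP.prod 𝓘(ℝ, ℝ))) 𝓘(ℝ, E) ∞ (liftCoef ρ θ h κ c) z := by
  refine contMDiffAt_inverse_symp hθ c (contMDiffAt_lift hh z) ?_ hz
  exact (((contMDiffAt_dForm_extForm hθ.smooth hh hρ hκ hz).clm_apply
    contMDiffAt_const).clm_comp contMDiffAt_const).neg

omit hθ hh hρ hκ in
/-- The lift of `∂/∂s` to the kernel of the exterior derivative of the extended form. -/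
def kernelLift (hθ : F.IsLiouvilleFamily θ) (hh : ContMDiff (IP.prod 𝓘(ℝ, ℝ)) I ∞ h)
    (hρ : ρ.IsSubordinate fun j => (F.chartOf j).toHomeo.source)
    (hκ : IsSmoothOnPullback IP F h κ) : LiftField IP F h where
  coef := liftCoef ρ θ h κ
  smooth _ _ hz := (contMDiffAt_liftCoef hθ hh hρ hκ hz).contMDiffWithinAt
  compat _ _ _ _ _ hz := liftCoef_change hθ hh hρ hκ (w := (_, _)) hz

omit hθ hh hρ hκ in
/-- The value of the extended form on the lift of `∂/∂s` to the kernel of its exterior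
derivative. -/
def energy (ρ : SmoothPartitionOfUnity N J N) (θ : F.OneForms) (h : P × ℝ → B)
    (κ : N → P × ℝ → ℝ) (q : N) (x : P × ℝ) : ℝ :=
  extForm ρ θ h κ (F.chartOf q) x.1 ((F.chartOf q).coord q, x.2)
    (liftCoef ρ θ h κ (F.chartOf q) ((F.chartOf q).coord q, x), 1)

theorem energy_pt {c : F.ProductChart} {z : E × (P × ℝ)} (hz : z ∈ c.dom h) :
    energy ρ θ h κ (c.pt (z.1, h z.2)) z.2 =
      extForm ρ θ h κ c z.2.1 (z.1, z.2.2) (liftCoef ρ θ h κ c z, 1) := by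
  have hov : (z.1, h z.2) ∈ c.overlap (F.chartOf (c.pt (z.1, h z.2))) := ⟨hz, mem_chartOf _⟩
  have h1 := liftCoef_change hθ hh hρ hκ (p := z.2.1) (w := (z.1, z.2.2)) hov
  rw [extForm_change hh hρ (w := (z.1, z.2.2)) hov, ContinuousLinearMap.comp_apply,
    fderiv_changeExt hh hov, ← h1]
  rfl

theorem isSmoothOnPullback_energy : IsSmoothOnPullback IP F h (energy ρ θ h κ) := by
  intro c
  have h1 : ContMDiffOn (𝓘(ℝ, E).prod (IP.prod 𝓘(ℝ, ℝ))) 𝓘(ℝ, ℝ) ∞ (fun z =>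
      extForm ρ θ h κ c z.2.1 (z.1, z.2.2) (liftCoef ρ θ h κ c z, 1)) (c.dom h) := fun z hz =>
    ((contMDiffAt_extForm hθ.smooth hh hρ hκ hz).clm_apply
      ((contMDiffAt_liftCoef hθ hh hρ hκ hz).prodMk_space contMDiffAt_const)).contMDiffWithinAt
  exact h1.congr fun z hz => energy_pt hθ hh hρ hκ hz

/-- Contraction of the exterior derivative of the extended form with the Liouville field. -/
theorem dForm_extForm_liou {c : F.ProductChart} {p : P} {w : E × ℝ}
    (hw : (w.1, h (p, w.2)) ∈ c.toHomeo.target) (v : E) (r : ℝ) :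
    dForm (extForm ρ θ h κ c p) w (c.liou θ (w.1, h (p, w.2)), 0) (v, r) =
      extForm ρ θ h κ c p w (v, r) -
        r * energy ρ θ h κ (c.pt (w.1, h (p, w.2))) (p, w.2) := by
  rw [energy_pt hθ hh hρ hκ (z := (w.1, (p, w.2))) hw]
  set a := liftCoef ρ θ h κ c (w.1, (p, w.2)) with ha
  have h3 : ((v, r) : E × ℝ) = (v - r • a, 0) + r • (a, 1) := by simp
  rw [h3, map_add, map_smul, dForm_extForm_vertical hθ hh hρ hκ hw, symp_liou hθ hw,
    dForm_swap, dForm_extForm_liftCoef hθ hh hρ hκ hw, map_add, map_smul, extForm_apply]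
  simp

/-- Adding a function `κ` to the coefficient of `ds` changes the value on the lift
by `κ - dκ (Z)`, where `Z` is the Liouville field. -/
theorem energy_eq_add {c : F.ProductChart} {z : E × (P × ℝ)} (hz : z ∈ c.dom h) :
    energy ρ θ h κ (c.pt (z.1, h z.2)) z.2 =
      energy ρ θ h (fun _ _ => 0) (c.pt (z.1, h z.2)) z.2 + κ (c.pt (z.1, h z.2)) z.2 -
        fderiv ℝ (fun e => κ (c.pt (e, h z.2)) z.2) z.1 (c.liou θ (z.1, h z.2)) := by
  have h₀ : IsSmoothOnPullback IP F h (fun _ _ => 0) := fun c => contMDiffOn_const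
  obtain ⟨e, p, s⟩ := z
  have e1 := dForm_extForm_liou hθ hh hρ hκ (p := p) (w := (e, s)) hz 0 1
  have e0 := dForm_extForm_liou hθ hh hρ h₀ (p := p) (w := (e, s)) hz 0 1
  rw [extForm_apply] at e1 e0
  -- the two extended forms differ by `κ ds`
  set K : E × ℝ → ℝ := fun w => κ (c.pt (w.1, h (p, w.2))) (p, w.2) with hK
  have hKd : DifferentiableAt ℝ K (e, s) :=
    (contDiffAt_of_contMDiffOn (isOpen_dom hh.continuous c) (hκ c) hz).differentiableAt (by simp)
  have hd0 := (contDiffAt_extForm hθ.smooth hh hρ h₀ (p := p) (w := (e, s)) hz).differentiableAt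
    (by simp)
  have hsum : HasFDerivAt (extForm ρ θ h κ c p) (fderiv ℝ (extForm ρ θ h (fun _ _ => 0) c p) (e, s)
      + (fderiv ℝ K (e, s)).smulRight (ContinuousLinearMap.snd ℝ E ℝ)) (e, s) := by
    refine (hd0.hasFDerivAt.add (hKd.hasFDerivAt.smul_const
      (ContinuousLinearMap.snd ℝ E ℝ))).congr_of_eventuallyEq
      (Filter.Eventually.of_forall fun w => ?_)
    refine ContinuousLinearMap.ext fun ⟨v, r⟩ => ?_
    change _ = extForm ρ θ h (fun _ _ => 0) c p w (v, r) + K w * r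
    rw [extForm_apply, extForm_apply]
    simp only [hK]
    ring
  have hslice : fderiv ℝ (fun e => κ (c.pt (e, h (p, s))) (p, s)) e (c.liou θ (e, h (p, s))) =
      fderiv ℝ K (e, s) (c.liou θ (e, h (p, s)), 0) := by
    have h1 := HasFDerivAt.comp e (f := fun e : E => (e, s)) hKd.hasFDerivAt
      ((hasFDerivAt_id e).prodMk (hasFDerivAt_const s e))
    exact congrArg (fun T => T (c.liou θ (e, h (p, s)))) h1.fderiv
  have hdf : dForm (extForm ρ θ h κ c p) (e, s) (c.liou θ (e, h (p, s)), 0) (0, 1) =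
      dForm (extForm ρ θ h (fun _ _ => 0) c p) (e, s) (c.liou θ (e, h (p, s)), 0) (0, 1) +
        fderiv ℝ K (e, s) (c.liou θ (e, h (p, s)), 0) := by
    rw [dForm_apply, dForm_apply, hsum.fderiv]
    simp
    ring
  simp only at hslice e0 e1 ⊢
  rw [hslice]
  linarith

end HorizontalLift

/-! ### Correction of the extended form along the Liouville flow -/

section BackwardIntegral

variable {E EB HB EN HN B N : Type*}
  [NormedAddCommGroup E] [NormedSpace ℝ E] [FiniteDimensional ℝ E]
  [NormedAddCommGroup EB] [NormedSpace ℝ EB] [FiniteDimensional ℝ EB] [TopologicalSpace HB]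
  [NormedAddCommGroup EN] [NormedSpace ℝ EN] [TopologicalSpace HN]
  {I : ModelWithCorners ℝ EB HB} {J : ModelWithCorners ℝ EN HN}
  [TopologicalSpace B] [ChartedSpace HB B] [TopologicalSpace N] [ChartedSpace HN N]
  [IsManifold I ∞ B] [T2Space N]
  {EP HP P : Type*} [NormedAddCommGroup EP] [NormedSpace ℝ EP] [FiniteDimensional ℝ EP]
  [TopologicalSpace HP]
  {IP : ModelWithCorners ℝ EP HP} [TopologicalSpace P] [ChartedSpace HP P] [IsManifold IP ∞ P]
  {F : SmoothFamily E I J N B} {h : P × ℝ → B} {θ : F.OneForms}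

/-- The solution `κ` of `Z κ = κ + f` which is given by integration along the backward Liouville
flow lines. -/
def backwardIntegral (hθ : F.IsLiouvilleFamily θ) (f : N → P × ℝ → ℝ) (q : N) (x : P × ℝ) : ℝ :=
  ∫ u in Iic (0 : ℝ), Real.exp (-u) * f (liouvilleFlow hθ u q) x

/-- The function `f` vanishes far back along Liouville flow lines, locally uniformly. -/
def VanishesBackward (hθ : F.IsLiouvilleFamily θ) (f : N → P × ℝ → ℝ) : Prop :=
  ∀ q₀, ∃ T : ℝ, ∀ᶠ q in 𝓝 q₀, ∀ u, T ≤ u → ∀ x, f (liouvilleFlow hθ (-u) q) x = 0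

variable {hθ : F.IsLiouvilleFamily θ} {f : N → P × ℝ → ℝ}

theorem backwardIntegral_eq {q : N} {x : P × ℝ} {T : ℝ} (hT : 0 ≤ T)
    (hf : ∀ u, T ≤ u → f (liouvilleFlow hθ (-u) q) x = 0) :
    backwardIntegral hθ f q x =
      ∫ u in (-T)..0, Real.exp (-u) * f (liouvilleFlow hθ u q) x := by
  rw [intervalIntegral.integral_of_le (by linarith), backwardIntegral]
  refine MeasureTheory.setIntegral_eq_of_subset_of_forall_sdiff_eq_zero measurableSet_Iic
    (fun u hu => hu.2) fun u hu => ?_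
  have h1 : T ≤ -u := by
    by_contra h2
    exact hu.2 ⟨by linarith, hu.1⟩
  have h2 := hf (-u) h1
  rw [neg_neg] at h2
  rw [h2, mul_zero]

theorem IsSmoothOnPullback.comp_fst (hf : IsSmoothOnPullback IP F h f) :
    IsSmoothOnPullback (IP.prod 𝓘(ℝ, ℝ)) F (fun y : (P × ℝ) × ℝ => h y.1)
      (fun q y => f q y.1) := by
  intro c
  have h1 : ContMDiff (𝓘(ℝ, E).prod ((IP.prod 𝓘(ℝ, ℝ)).prod 𝓘(ℝ, ℝ)))
      (𝓘(ℝ, E).prod (IP.prod 𝓘(ℝ, ℝ))) ∞ fun y : E × ((P × ℝ) × ℝ) => (y.1, y.2.1) :=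
    contMDiff_fst.prodMk (contMDiff_fst.comp contMDiff_snd)
  exact ContMDiffOn.comp (g := fun z : E × (P × ℝ) => f (c.pt (z.1, h z.2)) z.2) (hf c)
    h1.contMDiffOn fun y hy => hy

variable (hh : ContMDiff (IP.prod 𝓘(ℝ, ℝ)) I ∞ h) (hf : IsSmoothOnPullback IP F h f)
  (hv : VanishesBackward hθ f)

include hh hf hv

theorem contMDiffAt_backwardIntegral {c : F.ProductChart} {z : E × (P × ℝ)} (hz : z ∈ c.dom h) :
    ContMDiffAt (𝓘(ℝ, E).prod (IP.prod 𝓘(ℝ, ℝ))) 𝓘(ℝ, ℝ) ∞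
      (fun z => backwardIntegral hθ f (c.pt (z.1, h z.2)) z.2) z := by
  have hpt : ContMDiffAt (𝓘(ℝ, E).prod (IP.prod 𝓘(ℝ, ℝ))) J ∞
      (fun z : E × (P × ℝ) => c.pt (z.1, h z.2)) z :=
    ContMDiffAt.comp (g := c.pt) z (contMDiffOn_pt.contMDiffAt (c.toHomeo.open_target.mem_nhds hz))
      (contMDiffAt_lift hh z)
  obtain ⟨T₀, hT₀⟩ := hv (c.pt (z.1, h z.2))
  set T := max T₀ 0 with hT
  have hg : IsSmoothOnPullback (IP.prod 𝓘(ℝ, ℝ)) F (fun y : (P × ℝ) × ℝ => h y.1)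
      (fun q y => Real.exp (-y.2) * f q y.1) := fun c =>
    ContMDiffOn.mul (Real.contDiff_exp.contMDiff.comp
      (contDiff_neg.contMDiff.comp (contMDiff_snd.comp contMDiff_snd))).contMDiffOn
      (hf.comp_fst c)
  have hcurve : ∀ᶠ y : E × (P × ℝ) in 𝓝 z, ∀ s ∈ (univ : Set ℝ),
      IsIntegralAt (liouvilleLift hθ hh) y.2
        (fun u => liouvilleFlow hθ u (c.pt (y.1, h y.2))) s := by
    filter_upwards [(isOpen_dom hh.continuous c).mem_nhds hz] with y hy s _
    have h1 := isLiouvilleCurveAt_liouvilleFlow hθ (c.pt (y.1, h y.2)) s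
    rw [proj_pt hy] at h1
    exact IsLiouvilleCurveAt.isIntegralAt (hh₀ := hh) h1
  have key := (contMDiffAt_integralCurve (contMDiff_comp_fst hh) (A := liouvilleLift hθ hh) hg
    (γ := fun (y : E × (P × ℝ)) u => liouvilleFlow hθ u (c.pt (y.1, h y.2)))
    (τ := fun y => y.2) (σ := fun _ => -T) (s := 0) isOpen_univ ordConnected_univ hcurve
    contMDiffAt_snd contMDiffAt_const (mem_univ _)
    (ContMDiffAt.comp (g := fun w : N × ℝ => liouvilleFlow hθ w.2 w.1) z
      (contMDiff_liouvilleFlow hθ).contMDiffAt (hpt.prodMk contMDiffAt_const)) (mem_univ _)).2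
  have key2 := ContMDiffAt.comp (f := fun y : E × (P × ℝ) => (y, (0 : ℝ))) z key
    (contMDiffAt_id.prodMk contMDiffAt_const)
  refine key2.congr_of_eventuallyEq ?_
  filter_upwards [hpt.continuousAt.eventually hT₀] with y hy
  exact backwardIntegral_eq (le_max_right _ _) fun u hu => hy u ((le_max_left _ _).trans hu) _

theorem isSmoothOnPullback_backwardIntegral :
    IsSmoothOnPullback IP F h (backwardIntegral hθ f) := fun _ _ hz =>
  (contMDiffAt_backwardIntegral hh hf hv hz).contMDiffWithinAt

/-- `κ = backwardIntegral hθ f` solves `Z κ = κ + f`. -/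
theorem fderiv_backwardIntegral {c : F.ProductChart} {z : E × (P × ℝ)} (hz : z ∈ c.dom h) :
    fderiv ℝ (fun e => backwardIntegral hθ f (c.pt (e, h z.2)) z.2) z.1
        (c.liou θ (z.1, h z.2)) =
      backwardIntegral hθ f (c.pt (z.1, h z.2)) z.2 + f (c.pt (z.1, h z.2)) z.2 := by
  obtain ⟨e, x⟩ := z
  set q := c.pt (e, h x) with hq
  have hqs : q ∈ c.toHomeo.source := pt_mem hz
  have hqp : F.proj q = h x := proj_pt hz
  set K : E → ℝ := fun e => backwardIntegral hθ f (c.pt (e, h x)) x with hK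
  have hKd : DifferentiableAt ℝ K e := by
    have h1 : ContMDiffAt 𝓘(ℝ, E) 𝓘(ℝ, ℝ) ∞ K e :=
      ContMDiffAt.comp (g := fun z : E × (P × ℝ) =>
        backwardIntegral hθ f (c.pt (z.1, h z.2)) z.2) (f := fun e : E => (e, x)) e
        (contMDiffAt_backwardIntegral hh hf hv hz) (contMDiffAt_id.prodMk contMDiffAt_const)
    exact h1.contDiffAt.differentiableAt (by simp)
  have hcurve := isLiouvilleCurveAt_liouvilleFlow hθ q
  rw [hqp] at hcurve
  have h0 : liouvilleFlow hθ 0 q = q := liouvilleFlow_zero hθ q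
  have hd1 : HasDerivAt (fun r => K (c.coord (liouvilleFlow hθ r q)))
      (fderiv ℝ K e (c.liou θ (e, h x))) 0 := by
    have h1 := (hcurve 0).deriv c (by rwa [h0])
    have h2 : c.coord (liouvilleFlow hθ 0 q) = e := by rw [h0, hq, coord_pt hz]
    have h3 : HasDerivAt (fun r => c.coord (liouvilleFlow hθ r q)) (c.liou θ (e, h x)) 0 := by
      have h4 : HasDerivAt (fun r => c.coord (liouvilleFlow hθ r q))
        (c.liou θ (c.coord (liouvilleFlow hθ 0 q), h x)) 0 := h1
      rwa [h2] at h4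
    rw [← h2] at hKd
    have h5 := hKd.hasFDerivAt.comp_hasDerivAt (0 : ℝ) h3
    rwa [h2] at h5
  obtain ⟨T₀, hT₀⟩ := hv q
  have hTq := hT₀.self_of_nhds
  set T := max T₀ 1 with hT
  set G : ℝ → ℝ := fun u => Real.exp (-u) * f (liouvilleFlow hθ u q) x with hG
  have hGc : Continuous G := by
    have h1 : Continuous fun u => f (liouvilleFlow hθ u q) x := by
      rw [continuous_iff_continuousAt]
      intro u
      have h2 := (hcurve u).isIntegralAt (hh₀ := hh)
      exact h2.continuousAt_integrand (contMDiff_comp_fst hh).continuous (g := fun q y => f q y.1)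
        hf.comp_fst
    exact (Real.continuous_exp.comp continuous_neg).mul h1
  -- shifting the variable of integration by `r` moves the dependence on `r` to the endpoint
  have hval : ∀ᶠ r in 𝓝 (0 : ℝ), K (c.coord (liouvilleFlow hθ r q)) =
      Real.exp r * ∫ u in (-T)..r, G u := by
    have hcont : ContinuousAt (fun r => liouvilleFlow hθ r q) 0 := (hcurve 0).continuousAt
    filter_upwards
      [hcont.eventually (c.toHomeo.open_source.mem_nhds (by simpa only [h0] using hqs)),
      Ioo_mem_nhds (by norm_num : (-1 : ℝ) < 0) one_pos] with r hr hr1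
    have h1 : c.pt (c.coord (liouvilleFlow hθ r q), h x) = liouvilleFlow hθ r q := by
      rw [← hqp, ← proj_liouvilleFlow hθ r q, pt_coord hr]
    simp only [hK, h1]
    rw [backwardIntegral_eq (T := T + r) (by linarith [le_max_right T₀ 1, hr1.1]) fun u hu => by
      rw [← liouvilleFlow_add]
      have := hTq (u - r) (by linarith [le_max_left T₀ 1]) x
      rwa [neg_sub, sub_eq_neg_add] at this]
    have h2 := intervalIntegral.integral_comp_add_right (a := -(T + r)) (b := 0) G r
    rw [zero_add, show -(T + r) + r = -T by ring] at h2
    rw [← h2, ← intervalIntegral.integral_const_mul]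
    refine intervalIntegral.integral_congr fun u _ => ?_
    simp only [hG, ← liouvilleFlow_add]
    rw [← mul_assoc, ← Real.exp_add]
    congr 2
    ring
  have hd2 : HasDerivAt (fun r => Real.exp r * ∫ u in (-T)..r, G u)
      ((∫ u in (-T)..0, G u) + G 0) 0 := by
    have h1 : HasDerivAt (fun r => ∫ u in (-T)..r, G u) (G 0) 0 :=
      intervalIntegral.integral_hasDerivAt_right (hGc.intervalIntegrable _ _)
        (hGc.stronglyMeasurableAtFilter _ _) hGc.continuousAt
    have h2 : HasDerivAt (fun r => Real.exp r * ∫ u in (-T)..r, G u)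
        (Real.exp 0 * (∫ u in (-T)..0, G u) + Real.exp 0 * G 0) 0 :=
      (Real.hasDerivAt_exp 0).mul h1
    rwa [Real.exp_zero, one_mul, one_mul] at h2
  have h3 := hd1.unique (hd2.congr_of_eventuallyEq hval)
  have h4 := hval.self_of_nhds
  simp only [Real.exp_zero, one_mul, h0] at h4
  have h5 : c.coord q = e := by rw [hq, coord_pt hz]
  rw [h5] at h4
  have h6 : G 0 = f q x := by simp [hG, h0]
  rw [h6, ← h4] at h3
  exact h3

end BackwardIntegral

section Homotopy

variable {EB HB B : Type*} [NormedAddCommGroup EB] [NormedSpace ℝ EB] [TopologicalSpace HB]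
  {I : ModelWithCorners ℝ EB HB} [TopologicalSpace B] [ChartedSpace HB B]

/-- A smooth contraction can be reparametrized to be defined for all times. -/
theorem SmoothlyContractible.exists_contMDiff (hB : SmoothlyContractible I B) :
    ∃ (a : B) (h : B × ℝ → B), ContMDiff (I.prod 𝓘(ℝ, ℝ)) I ∞ h ∧ (∀ t, h (t, 0) = t) ∧
      ∀ t, h (t, 1) = a := by
  obtain ⟨a, h, hh, h0, h1⟩ := hB
  have hs : ContMDiff (I.prod 𝓘(ℝ, ℝ)) (I.prod 𝓘(ℝ, ℝ)) ∞
      fun z : B × ℝ => (z.1, Real.smoothTransition z.2) :=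
    contMDiff_fst.prodMk (Real.smoothTransition.contDiff.contMDiff.comp contMDiff_snd)
  refine ⟨a, fun z => h (z.1, Real.smoothTransition z.2), hh.comp_contMDiff hs fun z =>
    ⟨mem_univ _, Real.smoothTransition.nonneg _, Real.smoothTransition.le_one _⟩, fun t => ?_,
    fun t => ?_⟩
  · simp only [Real.smoothTransition.zero, h0]
  · simp only [Real.smoothTransition.one, h1]

end Homotopy

/-! ### Commutation with the Liouville flow -/

section MixedDerivatives

variable {V : Type*} [NormedAddCommGroup V] [NormedSpace ℝ V]

/-- If `c (u, s)` solves a differential equation in `u`, then `∂c/∂s` solves the linearized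
equation. -/
theorem hasDerivAt_fderiv_snd {c : ℝ × ℝ → V} {ζ : V × ℝ → V} {u s : ℝ}
    (hc : ContDiffAt ℝ 2 c (u, s)) (hζ : DifferentiableAt ℝ ζ (c (u, s), s))
    (hd : ∀ᶠ z in 𝓝 (u, s), fderiv ℝ c z (1, 0) = ζ (c z, z.2)) :
    HasDerivAt (fun u' => fderiv ℝ c (u', s) (0, 1))
      (fderiv ℝ ζ (c (u, s), s) (fderiv ℝ c (u, s) (0, 1), 1)) u := by
  have h1 : HasFDerivAt c (fderiv ℝ c (u, s)) (u, s) := (hc.differentiableAt (by simp)).hasFDerivAt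
  have h2 : HasFDerivAt (fderiv ℝ c) (fderiv ℝ (fderiv ℝ c) (u, s)) (u, s) :=
    ((hc.fderiv_right (m := 1) (by norm_num)).differentiableAt (by simp)).hasFDerivAt
  have hsym : IsSymmSndFDerivAt ℝ c (u, s) := hc.isSymmSndFDerivAt (by simp)
  have h3 := (h2.clm_apply (hasFDerivAt_const ((0 : ℝ), (1 : ℝ)) (u, s)))
  have h4 := h3.comp_hasDerivAt u (f := fun u' : ℝ => (u', s))
    ((hasDerivAt_id u).prodMk (hasDerivAt_const u s))
  have h5 := (h2.clm_apply (hasFDerivAt_const ((1 : ℝ), (0 : ℝ)) (u, s))).congr_of_eventuallyEq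
    (hd.mono fun z hz => hz.symm)
  have h6 := h5.unique (hζ.hasFDerivAt.comp (u, s) (f := fun z : ℝ × ℝ => (c z, z.2))
    (h1.prodMk hasFDerivAt_snd))
  have h7 := congrArg (fun T => T ((0 : ℝ), (1 : ℝ))) h6
  have h8 := hsym.eq (1, 0) (0, 1)
  simp at h7
  refine h4.congr_deriv ?_
  simp
  rw [h8, h7]

end MixedDerivatives

section UniformExistence

variable {E EB HB EN HN B N : Type*}
  [NormedAddCommGroup E] [NormedSpace ℝ E] [FiniteDimensional ℝ E]
  [NormedAddCommGroup EB] [NormedSpace ℝ EB] [FiniteDimensional ℝ EB] [TopologicalSpace HB]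
  [NormedAddCommGroup EN] [NormedSpace ℝ EN] [FiniteDimensional ℝ EN] [TopologicalSpace HN]
  {I : ModelWithCorners ℝ EB HB} {J : ModelWithCorners ℝ EN HN}
  [TopologicalSpace B] [ChartedSpace HB B] [TopologicalSpace N] [ChartedSpace HN N]
  [T2Space N] [T2Space B] [IsManifold I ∞ B]
  {EP HP P : Type*} [NormedAddCommGroup EP] [NormedSpace ℝ EP] [FiniteDimensional ℝ EP]
  [TopologicalSpace HP]
  {IP : ModelWithCorners ℝ EP HP} [TopologicalSpace P] [ChartedSpace HP P] [IsManifold IP ∞ P]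
  {F : SmoothFamily E I J N B} {h : P × ℝ → B}

/-- Integral curves that start in a compact set exist for a uniform time. -/
theorem exists_uniform_integral_curve (hh : ContMDiff (IP.prod 𝓘(ℝ, ℝ)) I ∞ h)
    (A : LiftField IP F h) {C G : Set N} (hC : IsCompact C) (hG : IsOpen G) {p : P} {s₁ : ℝ}
    (hCG : ∀ q ∈ C, F.proj q = h (p, s₁) → q ∈ G) :
    ∃ ε > 0, ∀ s ∈ Ioo (s₁ - ε) (s₁ + ε), ∀ q ∈ C, F.proj q = h (p, s) →
      ∃ γ : ℝ → N, γ s = q ∧ ∀ s' ∈ Ioo (s₁ - ε) (s₁ + ε), IsIntegralAt A p γ s' ∧ γ s' ∈ G := by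
  have hcl : IsClosed {q | F.proj q = h (p, s₁)} :=
    isClosed_singleton.preimage F.smooth.continuous
  have hIoo : ∀ {ε ε' x : ℝ}, ε ≤ ε' → x ∈ Ioo (s₁ - ε) (s₁ + ε) → x ∈ Ioo (s₁ - ε') (s₁ + ε') :=
    fun hε hx => ⟨by linarith [hx.1], by linarith [hx.2]⟩
  obtain ⟨ε, hε, W, hW, hCW, H⟩ := (hC.inter_right hcl).induction_on
    (p := fun S => ∃ ε > 0, ∃ W, IsOpen W ∧ S ⊆ W ∧ ∀ q ∈ W, ∀ s ∈ Ioo (s₁ - ε) (s₁ + ε),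
      F.proj q = h (p, s) → ∃ γ : ℝ → N, γ s = q ∧ ∀ s' ∈ Ioo (s₁ - ε) (s₁ + ε),
        IsIntegralAt A p γ s' ∧ γ s' ∈ G)
    ⟨1, one_pos, ∅, isOpen_empty, subset_rfl, fun q hq => absurd hq (notMem_empty q)⟩
    (fun S S' hSS' ⟨ε, hε, W, hW, hSW, H⟩ => ⟨ε, hε, W, hW, hSS'.trans hSW, H⟩)
    (by
      rintro S S' ⟨ε, hε, W, hW, hSW, H⟩ ⟨ε', hε', W', hW', hSW', H'⟩
      refine ⟨min ε ε', lt_min hε hε', W ∪ W', hW.union hW', union_subset_union hSW hSW', ?_⟩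
      rintro q (hq | hq) s hs hqs
      · obtain ⟨γ, h1, h2⟩ := H q hq s (hIoo (min_le_left _ _) hs) hqs
        exact ⟨γ, h1, fun s' hs' => h2 s' (hIoo (min_le_left _ _) hs')⟩
      · obtain ⟨γ, h1, h2⟩ := H' q hq s (hIoo (min_le_right _ _) hs) hqs
        exact ⟨γ, h1, fun s' hs' => h2 s' (hIoo (min_le_right _ _) hs')⟩)
    (by
      rintro q ⟨hqC, hq⟩
      obtain ⟨ε, hε, hev⟩ := exists_local_integral_curve hh A hq (hG.mem_nhds (hCG q hqC hq))
      obtain ⟨W, hW, R, hR, hWR⟩ := mem_nhds_prod_iff.1 hev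
      obtain ⟨W', hW'W, hW', hqW'⟩ := mem_nhds_iff.1 hW
      obtain ⟨δ, hδ, hδR⟩ := Metric.mem_nhds_iff.1 hR
      rw [Real.ball_eq_Ioo] at hδR
      have hmin : 0 < min (ε / 2) δ := lt_min (by linarith) hδ
      refine ⟨W', mem_nhdsWithin_of_mem_nhds (hW'.mem_nhds hqW'), min (ε / 2) δ, hmin, W', hW',
        subset_rfl, fun q' hq' s hs hq's => ?_⟩
      have hmem : (q', s) ∈ W ×ˢ R := ⟨hW'W hq', hδR (hIoo (min_le_right _ _) hs)⟩
      obtain ⟨γ, h1, h2⟩ := hWR hmem hq's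
      refine ⟨γ, h1, fun s' hs' => h2 s' ?_⟩
      have h3 := hIoo (min_le_left _ _) hs
      have h4 := hIoo (min_le_left _ _) hs'
      exact ⟨by simp only; linarith [h3.2, h4.1], by simp only; linarith [h3.1, h4.2]⟩)
  have hev : ∀ᶠ t' in 𝓝 (h (p, s₁)), ∀ q ∈ C \ W, F.proj q ≠ t' :=
    eventually_forall_proj_ne (hC.diff hW) fun q hq he => hq.2 (hCW ⟨hq.1, he⟩)
  have hcont : Continuous fun s => h (p, s) := hh.continuous.comp (by fun_prop)
  obtain ⟨δ, hδ, hδ'⟩ := Metric.eventually_nhds_iff_ball.1 (hcont.continuousAt.eventually hev)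
  rw [Real.ball_eq_Ioo] at hδ'
  refine ⟨min ε δ, lt_min hε hδ, fun s hs q hq hqs => ?_⟩
  have hqW : q ∈ W := by
    by_contra hn
    exact hδ' s (hIoo (min_le_right _ _) hs) q ⟨hq, hn⟩ hqs
  obtain ⟨γ, h1, h2⟩ := H q hqW s (hIoo (min_le_left _ _) hs) hqs
  exact ⟨γ, h1, fun s' hs' => h2 s' (hIoo (min_le_left _ _) hs')⟩

/-- Integral curves are smooth. -/
theorem contMDiffAt_of_isIntegralAt (hh : ContMDiff (IP.prod 𝓘(ℝ, ℝ)) I ∞ h)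
    {A : LiftField IP F h} {p : P} {γ : ℝ → N} {s : ℝ}
    (hγ : ∀ᶠ s' in 𝓝 s, IsIntegralAt A p γ s') : ContMDiffAt 𝓘(ℝ, ℝ) J ∞ γ s := by
  obtain ⟨ε, hε, H⟩ := Metric.eventually_nhds_iff_ball.1 hγ
  rw [Real.ball_eq_Ioo] at H
  have hs : s ∈ Ioo (s - ε) (s + ε) := ⟨by linarith, by linarith⟩
  have h1 := (contMDiffAt_integralCurve (IY := 𝓘(ℝ, ℝ)) hh (A := A) (g := fun _ _ => 0)
    (fun _ => contMDiffOn_const) (γ := fun _ : ℝ => γ) (τ := fun _ => p) (σ := fun _ => s)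
    (y₀ := (0 : ℝ)) isOpen_Ioo ordConnected_Ioo (Filter.Eventually.of_forall fun _ => H)
    contMDiffAt_const contMDiffAt_const hs contMDiffAt_const hs).1
  exact ContMDiffAt.comp (f := fun s' : ℝ => ((0 : ℝ), s')) s h1
    (contMDiffAt_const.prodMk contMDiffAt_id)

end UniformExistence

section Commutation

variable {E EB HB EN HN B N : Type*}
  [NormedAddCommGroup E] [NormedSpace ℝ E] [FiniteDimensional ℝ E]
  [NormedAddCommGroup EB] [NormedSpace ℝ EB] [FiniteDimensional ℝ EB] [TopologicalSpace HB]
  [NormedAddCommGroup EN] [NormedSpace ℝ EN] [FiniteDimensional ℝ EN] [TopologicalSpace HN]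
  {I : ModelWithCorners ℝ EB HB} {J : ModelWithCorners ℝ EN HN}
  [TopologicalSpace B] [ChartedSpace HB B] [TopologicalSpace N] [ChartedSpace HN N]
  [T2Space N] [T2Space B] [IsManifold I ∞ B]
  {EP HP P : Type*} [NormedAddCommGroup EP] [NormedSpace ℝ EP] [FiniteDimensional ℝ EP]
  [TopologicalSpace HP]
  {IP : ModelWithCorners ℝ EP HP} [TopologicalSpace P] [ChartedSpace HP P] [IsManifold IP ∞ P]
  {F : SmoothFamily E I J N B} {h : P × ℝ → B} {θ : F.OneForms}
  {ρ : SmoothPartitionOfUnity N J N} {κ : N → P × ℝ → ℝ}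
  (hθ : F.IsLiouvilleFamily θ) (hh : ContMDiff (IP.prod 𝓘(ℝ, ℝ)) I ∞ h)
  (hρ : ρ.IsSubordinate fun j => (F.chartOf j).toHomeo.source) (hκ : IsSmoothOnPullback IP F h κ)

include hθ hh hρ hκ

theorem eventually_mem_target_curve (c : F.ProductChart) {p : P} {w : E × ℝ}
    (hw : (w.1, h (p, w.2)) ∈ c.toHomeo.target) :
    ∀ᶠ w' : E × ℝ in 𝓝 w, (w'.1, h (p, w'.2)) ∈ c.toHomeo.target := by
  have hc : Continuous fun w : E × ℝ => (w.1, h (p, w.2)) :=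
    continuous_fst.prodMk (hh.continuous.comp (by fun_prop))
  exact hc.continuousAt.eventually (c.toHomeo.open_target.mem_nhds hw)

theorem contDiffAt_liou_curve {c : F.ProductChart} {p : P} {w : E × ℝ}
    (hw : (w.1, h (p, w.2)) ∈ c.toHomeo.target) :
    ContDiffAt ℝ ∞ (fun w : E × ℝ => c.liou θ (w.1, h (p, w.2))) w :=
  contDiffAt_of_contMDiffOn (isOpen_dom hh.continuous c) (O := c.dom h) (p := p)
    (f := fun z => c.liou θ (z.1, h z.2))
    ((contMDiffOn_liou hθ c).comp (contMDiff_lift hh).contMDiffOn fun _ hz => hz) hw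

/-- Where the energy vanishes, the kernel lift commutes with the Liouville field. -/
theorem fderiv_liou_liftCoef {c : F.ProductChart} {p : P} {w : E × ℝ}
    (hw : (w.1, h (p, w.2)) ∈ c.toHomeo.target)
    (hen : ∀ᶠ w' : E × ℝ in 𝓝 w,
      energy ρ θ h κ (c.pt (w'.1, h (p, w'.2))) (p, w'.2) = 0) :
    fderiv ℝ (fun w : E × ℝ => c.liou θ (w.1, h (p, w.2))) w
        (liftCoef ρ θ h κ c (w.1, (p, w.2)), 1) =
      fderiv ℝ (fun w : E × ℝ => liftCoef ρ θ h κ c (w.1, (p, w.2))) w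
        (c.liou θ (w.1, h (p, w.2)), 0) := by
  have hm : DifferentiableAt ℝ (fun w : E × ℝ => liftCoef ρ θ h κ c (w.1, (p, w.2))) w :=
    (contDiffAt_coef hh (kernelLift hθ hh hρ hκ) (c := c) (e := w.1) (p := p) (s := w.2)
      hw).differentiableAt (by simp)
  have hz : DifferentiableAt ℝ (fun w : E × ℝ => c.liou θ (w.1, h (p, w.2))) w :=
    (contDiffAt_liou_curve hθ hh hρ hκ hw).differentiableAt (by simp)
  have htg := eventually_mem_target_curve hθ hh hρ hκ c hw
  have hv' := hm.hasFDerivAt.prodMk (hasFDerivAt_const (1 : ℝ) w)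
  have hz' := hz.hasFDerivAt.prodMk (hasFDerivAt_const (0 : ℝ) w)
  have key := dForm_bracket_eq_zero (l := extForm ρ θ h κ c p)
    (contDiffAt_extForm hθ.smooth hh hρ hκ hw) hv'.differentiableAt hz'.differentiableAt
    (htg.mono fun w' hw' => dForm_extForm_liftCoef hθ hh hρ hκ hw')
    ((htg.and hen).mono fun w' hw' => ContinuousLinearMap.ext fun ⟨v, r⟩ => by
      rw [dForm_extForm_liou hθ hh hρ hκ hw'.1, hw'.2, mul_zero, sub_zero])
    ((htg.and hen).mono fun w' hw' => by
      rw [← hw'.2, energy_pt hθ hh hρ hκ (z := (w'.1, (p, w'.2))) hw'.1])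
  rw [hv'.fderiv, hz'.fderiv] at key
  simp only [ContinuousLinearMap.prod_apply, zero_apply, Prod.mk_sub_mk,
    sub_zero] at key
  refine sub_eq_zero.1 (symp_nondegenerate hθ hw fun b => ?_)
  rw [← dForm_extForm_vertical hθ hh hρ hκ hw, key]
  rfl

/-- The Liouville flow maps integral curves of the kernel lift to integral curves, as long as the
energy vanishes along the Liouville flow lines. -/
theorem isIntegralAt_liouvilleFlow {p : P} {γ : ℝ → N} {s a : ℝ} (ha : 0 ≤ a)
    (hγ : ∀ᶠ s' in 𝓝 s, IsIntegralAt (kernelLift hθ hh hρ hκ) p γ s')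
    (hen : ∀ u ∈ Icc 0 a, ∀ᶠ z : N × ℝ in 𝓝 (liouvilleFlow hθ u (γ s), s),
      F.proj z.1 = h (p, z.2) → energy ρ θ h κ z.1 (p, z.2) = 0) :
    IsIntegralAt (kernelLift hθ hh hρ hκ) p (fun s' => liouvilleFlow hθ a (γ s')) s := by
  set S : Set ℝ := {u | IsIntegralAt (kernelLift hθ hh hρ hκ) p
    (fun s' => liouvilleFlow hθ u (γ s')) s} with hS
  have hproj : ∀ᶠ s' in 𝓝 s, F.proj (γ s') = h (p, s') := hγ.mono fun s' h => h.proj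
  have hγs := contMDiffAt_of_isIntegralAt hh hγ
  have hfl : ∀ u, ContMDiffAt 𝓘(ℝ, ℝ × ℝ) J ∞
      (fun z : ℝ × ℝ => liouvilleFlow hθ z.1 (γ z.2)) (u, s) := by
    intro u
    have hf1 : ContMDiff 𝓘(ℝ, ℝ × ℝ) 𝓘(ℝ, ℝ) ∞ (Prod.fst : ℝ × ℝ → ℝ) := contDiff_fst.contMDiff
    have hf2 : ContMDiff 𝓘(ℝ, ℝ × ℝ) 𝓘(ℝ, ℝ) ∞ (Prod.snd : ℝ × ℝ → ℝ) := contDiff_snd.contMDiff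
    exact ContMDiffAt.comp (g := fun w : N × ℝ => liouvilleFlow hθ w.2 w.1) (u, s)
      (contMDiff_liouvilleFlow hθ).contMDiffAt
      ((ContMDiffAt.comp (g := γ) (u, s) hγs hf2.contMDiffAt).prodMk hf1.contMDiffAt)
  have hloc : ∀ u₀ ∈ Icc 0 a, (u₀ ∈ S → ∀ᶠ u in 𝓝 u₀, u ∈ S) ∧
      (u₀ ∉ S → ∀ᶠ u in 𝓝 u₀, u ∉ S) := by
    intro u₀ hu₀
    obtain ⟨c, hc⟩ := F.exists_productChart (liouvilleFlow hθ u₀ (γ s))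
    set k : ℝ × ℝ → E := fun z => c.coord (liouvilleFlow hθ z.1 (γ z.2)) with hk
    set ζ : E × ℝ → E := fun w => c.liou θ (w.1, h (p, w.2)) with hζ
    set m : E × ℝ → E := fun w => liftCoef ρ θ h κ c (w.1, (p, w.2)) with hm
    have hsrc : ∀ᶠ z : ℝ × ℝ in 𝓝 (u₀, s), liouvilleFlow hθ z.1 (γ z.2) ∈ c.toHomeo.source :=
      (hfl u₀).continuousAt.eventually (c.toHomeo.open_source.mem_nhds hc)
    have hpr : ∀ u, ∀ᶠ z : ℝ × ℝ in 𝓝 (u, s), F.proj (γ z.2) = h (p, z.2) := fun u =>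
      (continuousAt_snd (p := (u, s))).eventually hproj
    have hks : ∀ u, liouvilleFlow hθ u (γ s) ∈ c.toHomeo.source → ContDiffAt ℝ ∞ k (u, s) := by
      intro u hu
      rw [← contMDiffAt_iff_contDiffAt]
      exact ContMDiffAt.comp (g := c.coord) (u, s)
        (contMDiffOn_coord.contMDiffAt (c.toHomeo.open_source.mem_nhds hu)) (hfl u)
    have hline : ContinuousAt (fun u : ℝ => (u, s)) u₀ := by fun_prop
    have hsrcu : ∀ᶠ u in 𝓝 u₀, liouvilleFlow hθ u (γ s) ∈ c.toHomeo.source :=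
      hline.eventually (p := fun z : ℝ × ℝ => liouvilleFlow hθ z.1 (γ z.2) ∈ c.toHomeo.source) hsrc
    have htg : ∀ u, liouvilleFlow hθ u (γ s) ∈ c.toHomeo.source →
        (k (u, s), h (p, s)) ∈ c.toHomeo.target := by
      intro u hu
      have := mem_target hu
      rwa [proj_liouvilleFlow, hproj.self_of_nhds] at this
    set W : ℝ → E := fun u => fderiv ℝ k (u, s) (0, 1) - m (k (u, s), s) with hW
    have hiff : ∀ u, liouvilleFlow hθ u (γ s) ∈ c.toHomeo.source → (u ∈ S ↔ W u = 0) := by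
      intro u hu
      have hd : HasDerivAt (fun s' => c.coord (liouvilleFlow hθ u (γ s')))
          (fderiv ℝ k (u, s) (0, 1)) s := by
        exact ((hks u hu).differentiableAt (by simp)).hasFDerivAt.comp_hasDerivAt s
          (f := fun s' : ℝ => (u, s')) ((hasDerivAt_const s u).prodMk (hasDerivAt_id s))
      constructor
      · intro h1
        exact sub_eq_zero.2 (hd.unique (h1.deriv c hu))
      · intro h1
        refine IsIntegralAt.of_chart hh ?_ ?_ c hu ?_
        · exact ContinuousAt.comp (g := liouvilleFlow hθ u)
            (continuous_liouvilleFlow_apply hθ u).continuousAt hγs.continuousAt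
        · filter_upwards [hproj] with s' hs'
          rw [proj_liouvilleFlow, hs']
        · have h2 := sub_eq_zero.1 h1
          rw [h2] at hd
          exact hd
    have hdW : ∀ᶠ u in 𝓝 u₀, HasDerivAt W (fderiv ℝ ζ (k (u, s), s) (W u, 0)) u := by
      -- the energy vanishes near the point, read in the chart
      have hen1 : ∀ᶠ u in 𝓝 u₀, ∀ᶠ w : E × ℝ in 𝓝 (k (u, s), s),
          energy ρ θ h κ (c.pt (w.1, h (p, w.2))) (p, w.2) = 0 := by
        have h1 : ∀ᶠ w : E × ℝ in 𝓝 (k (u₀, s), s),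
            energy ρ θ h κ (c.pt (w.1, h (p, w.2))) (p, w.2) = 0 := by
          have h2 : ContinuousAt (fun w : E × ℝ => (c.pt (w.1, h (p, w.2)), w.2))
              (k (u₀, s), s) := by
            have h3 : Continuous fun w : E × ℝ => (w.1, h (p, w.2)) :=
              continuous_fst.prodMk (hh.continuous.comp (by fun_prop))
            exact (ContinuousAt.comp (g := c.pt) (f := fun w : E × ℝ => (w.1, h (p, w.2)))
              (continuousAt_pt (htg u₀ hc)) h3.continuousAt).prodMk continuousAt_snd
          have h4 : c.pt (k (u₀, s), h (p, s)) = liouvilleFlow hθ u₀ (γ s) := by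
            have := pt_coord hc
            rwa [proj_liouvilleFlow, hproj.self_of_nhds] at this
          have h5 := hen u₀ hu₀
          rw [← h4] at h5
          filter_upwards [h2.eventually h5, eventually_mem_target_curve hθ hh hρ hκ c
            (w := (k (u₀, s), s)) (htg u₀ hc)] with w h6 h7
          exact h6 (proj_pt h7)
        have h2 : ContinuousAt (fun u => (k (u, s), s)) u₀ := by
          have h3 : ContinuousAt (fun u => k (u, s)) u₀ :=
            ContinuousAt.comp (g := k) (f := fun u : ℝ => (u, s)) (hks u₀ hc).continuousAt hline
          exact h3.prodMk continuousAt_const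
        exact h2.eventually h1.eventually_nhds
      have hsrcn : ∀ᶠ u in 𝓝 u₀, ∀ᶠ z : ℝ × ℝ in 𝓝 (u, s),
          liouvilleFlow hθ z.1 (γ z.2) ∈ c.toHomeo.source := hline.eventually hsrc.eventually_nhds
      filter_upwards [hen1, hsrcn, hsrcu] with u h1 h2 h3
      have hζd : DifferentiableAt ℝ ζ (k (u, s), s) :=
        (contDiffAt_liou_curve hθ hh hρ hκ (w := (k (u, s), s)) (htg u h3)).differentiableAt
          (by simp)
      have hmd : DifferentiableAt ℝ m (k (u, s), s) :=
        (contDiffAt_coef hh (kernelLift hθ hh hρ hκ) (c := c) (htg u h3)).differentiableAt (by simp)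
      have hdu : ∀ z : ℝ × ℝ, DifferentiableAt ℝ k z →
          liouvilleFlow hθ z.1 (γ z.2) ∈ c.toHomeo.source → F.proj (γ z.2) = h (p, z.2) →
          fderiv ℝ k z (1, 0) = ζ (k z, z.2) := by
        intro z hz1 hz2 hz3
        have h4 := (isLiouvilleCurveAt_liouvilleFlow hθ (γ z.2) z.1).deriv c hz2
        rw [hz3] at h4
        have h5 : HasDerivAt (fun u => c.coord (liouvilleFlow hθ u (γ z.2)))
            (fderiv ℝ k z (1, 0)) z.1 :=
          hz1.hasFDerivAt.comp_hasDerivAt z.1 (f := fun u : ℝ => (u, z.2))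
            ((hasDerivAt_id z.1).prodMk (hasDerivAt_const z.1 z.2))
        exact h5.unique h4
      have hks2 : ContDiffAt ℝ 2 k (u, s) :=
        (hks u h3).of_le (WithTop.coe_le_coe.2 (le_top : (2 : ℕ∞) ≤ ⊤))
      have h4 := hasDerivAt_fderiv_snd hks2 hζd (by
        filter_upwards [h2, hpr u, hks2.eventually (by simp)] with z h5 h6 h7
        exact hdu z (h7.differentiableAt (by simp)) h5 h6)
      have h5 : HasDerivAt (fun u => (k (u, s), s)) (ζ (k (u, s), s), (0 : ℝ)) u := by
        have h6 := (hks2.differentiableAt (by simp)).hasFDerivAt.comp_hasDerivAt u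
          (f := fun u : ℝ => (u, s)) ((hasDerivAt_id u).prodMk (hasDerivAt_const u s))
        rw [hdu (u, s) (hks2.differentiableAt (by simp)) h3 hproj.self_of_nhds] at h6
        exact h6.prodMk (hasDerivAt_const u s)
      have h6 := h4.sub (hmd.hasFDerivAt.comp_hasDerivAt u h5)
      refine h6.congr_deriv ?_
      have h7 := fderiv_liou_liftCoef hθ hh hρ hκ (w := (k (u, s), s)) (htg u h3) h1
      have h8 : fderiv ℝ m (k (u, s), s) (ζ (k (u, s), s), 0) =
          fderiv ℝ ζ (k (u, s), s) (m (k (u, s), s), 1) := h7.symm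
      rw [h8, ← map_sub]
      simp [hW]
    have hWc : ContinuousAt W u₀ := hdW.self_of_nhds.continuousAt
    constructor
    · intro hu₀S
      have hW0 : W u₀ = 0 := (hiff u₀ hc).1 hu₀S
      -- `W` solves a linear equation, so it vanishes identically
      have hfield : ContDiffAt ℝ 1 (fun y : E × ℝ =>
          (fderiv ℝ ζ (k (y.2, s), s) (y.1, 0), (1 : ℝ))) (W u₀, u₀) := by
        have h1 : ContDiffAt ℝ 1 (fderiv ℝ ζ) (k (u₀, s), s) :=
          ((contDiffAt_liou_curve hθ hh hρ hκ (w := (k (u₀, s), s)) (htg u₀ hc)).fderiv_right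
            (m := ∞) (by simp)).of_le (WithTop.coe_le_coe.2 (le_top : (1 : ℕ∞) ≤ ⊤))
        have h2 : ContDiffAt ℝ 1 (fun y : E × ℝ => (k (y.2, s), s)) (W u₀, u₀) := by
          have h3 : ContDiffAt ℝ 1 k (u₀, s) :=
            (hks u₀ hc).of_le (WithTop.coe_le_coe.2 (le_top : (1 : ℕ∞) ≤ ⊤))
          exact (ContDiffAt.comp (g := k) (f := fun y : E × ℝ => (y.2, s)) (W u₀, u₀) h3
            (contDiffAt_snd.prodMk contDiffAt_const)).prodMk contDiffAt_const
        have h4 : ContDiffAt ℝ 1 (fun y : E × ℝ => fderiv ℝ ζ (k (y.2, s), s)) (W u₀, u₀) :=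
          ContDiffAt.comp (g := fderiv ℝ ζ) (f := fun y : E × ℝ => (k (y.2, s), s)) (W u₀, u₀) h1 h2
        exact (h4.clm_apply (contDiffAt_fst.prodMk contDiffAt_const)).prodMk contDiffAt_const
      have h1 := eventuallyEq_of_hasDerivAt_of_contDiffAt (γ₁ := fun u => (W u, u))
        (γ₂ := fun u => ((0 : E), u)) hfield
        (hdW.mono fun u hu => hu.prodMk (hasDerivAt_id u))
        (Filter.Eventually.of_forall fun u => by
          refine ((hasDerivAt_const u (0 : E)).prodMk (hasDerivAt_id u)).congr_deriv ?_
          rw [Prod.mk_zero_zero, map_zero]) (by rw [hW0])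
      filter_upwards [h1, hsrcu] with u h2 h3
      exact (hiff u h3).2 (congrArg Prod.fst h2)
    · intro hu₀S
      have hW0 : W u₀ ≠ 0 := fun h1 => hu₀S ((hiff u₀ hc).2 h1)
      filter_upwards [hWc.eventually_ne hW0, hsrcu] with u h2 h3
      exact fun h4 => h2 ((hiff u h3).1 h4)
  have h0S : (0 : ℝ) ∈ S := by
    have h1 : (fun s' => liouvilleFlow hθ 0 (γ s')) = γ := funext fun s' => liouvilleFlow_zero hθ _
    simp only [hS, mem_ofPred_eq, h1]
    exact hγ.self_of_nhds
  have hsub : Icc 0 a ⊆ interior S ∪ interior Sᶜ := by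
    intro u hu
    by_cases h1 : u ∈ S
    · exact Or.inl (mem_interior_iff_mem_nhds.2 ((hloc u hu).1 h1))
    · exact Or.inr (mem_interior_iff_mem_nhds.2 ((hloc u hu).2 h1))
  have hdisj : Disjoint (interior S) (interior Sᶜ) :=
    disjoint_compl_right.mono interior_subset interior_subset
  have h0 : (0 : ℝ) ∈ Icc 0 a := ⟨le_rfl, ha⟩
  have h1 : a ∈ interior S := isPreconnected_Icc.subset_left_of_subset_union isOpen_interior
    isOpen_interior hdisj hsub ⟨0, h0, mem_interior_iff_mem_nhds.2 ((hloc 0 h0).1 h0S)⟩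
    ⟨ha, le_rfl⟩
  have h2 : a ∈ S := interior_subset h1
  exact h2

end Commutation

/-! ### Completeness of the kernel lift -/

section Completeness

variable {E EB HB EN HN B N : Type*}
  [NormedAddCommGroup E] [NormedSpace ℝ E] [FiniteDimensional ℝ E]
  [NormedAddCommGroup EB] [NormedSpace ℝ EB] [FiniteDimensional ℝ EB] [TopologicalSpace HB]
  [NormedAddCommGroup EN] [NormedSpace ℝ EN] [FiniteDimensional ℝ EN] [TopologicalSpace HN]
  {I : ModelWithCorners ℝ EB HB} {J : ModelWithCorners ℝ EN HN}
  [TopologicalSpace B] [ChartedSpace HB B] [TopologicalSpace N] [ChartedSpace HN N]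
  [T2Space N] [T2Space B] [IsManifold I ∞ B]
  {EP HP P : Type*} [NormedAddCommGroup EP] [NormedSpace ℝ EP] [FiniteDimensional ℝ EP]
  [TopologicalSpace HP]
  {IP : ModelWithCorners ℝ EP HP} [TopologicalSpace P] [ChartedSpace HP P] [IsManifold IP ∞ P]
  {F : SmoothFamily E I J N B} {h : P × ℝ → B} {θ : F.OneForms}
  {ρ : SmoothPartitionOfUnity N J N} {κ : N → P × ℝ → ℝ}

/-- Locally over the base, the function `g` on the pull-back of the family vanishes outside a
compact set. -/
def HasProperSupport (F : SmoothFamily E I J N B) (h : P × ℝ → B) (g : N → P × ℝ → ℝ) : Prop :=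
  ∀ t₀, ∃ V, IsOpen V ∧ t₀ ∈ V ∧ ∃ C, IsCompact C ∧
    ∀ q x, F.proj q = h x → h x ∈ V → g q x ≠ 0 → q ∈ C

/-- The correction `κ` can be chosen such that the energy has proper support. -/
theorem exists_hasProperSupport_energy [SecondCountableTopology B] [SecondCountableTopology N]
    [IsManifold J ∞ N] (hθ : F.IsLiouvilleFamily θ) (hdom : F.LocallyHasGeneratingDomains θ)
    (hh : ContMDiff (IP.prod 𝓘(ℝ, ℝ)) I ∞ h)
    (hρ : ρ.IsSubordinate fun j => (F.chartOf j).toHomeo.source) :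
    ∃ κ, IsSmoothOnPullback IP F h κ ∧ HasProperSupport F h (energy ρ θ h κ) := by
  obtain ⟨χ, hχ, hχ1, hχ0⟩ := exists_cutoff hθ hdom
  have h₀ : IsSmoothOnPullback IP F h (fun _ _ => 0) := fun c => contMDiffOn_const
  set f : N → P × ℝ → ℝ := fun q x => χ q * energy ρ θ h (fun _ _ => 0) q x with hf
  have hfs : IsSmoothOnPullback IP F h f := by
    intro c
    have h1 : ContMDiffOn (𝓘(ℝ, E).prod (IP.prod 𝓘(ℝ, ℝ))) J ∞
        (fun z : E × (P × ℝ) => c.pt (z.1, h z.2)) (c.dom h) :=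
      ContMDiffOn.comp (g := c.pt) contMDiffOn_pt (contMDiff_lift hh).contMDiffOn fun _ hz => hz
    exact (hχ.comp_contMDiffOn h1).mul (isSmoothOnPullback_energy hθ hh hρ h₀ c)
  have hfv : VanishesBackward hθ f := by
    intro q₀
    obtain ⟨T, hT⟩ := hχ0 q₀
    exact ⟨T, hT.mono fun q hq u hu x => by simp only [hf, hq u hu, zero_mul]⟩
  refine ⟨backwardIntegral hθ f, isSmoothOnPullback_backwardIntegral hh hfs hfv, fun t₀ => ?_⟩
  obtain ⟨V, hV, ht₀, C, hC, hVC⟩ := hχ1 t₀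
  refine ⟨V, hV, ht₀, C, hC, fun q x hq hx hne => hVC q (hq ▸ hx) fun h1 => hne ?_⟩
  obtain ⟨c, hc⟩ := F.exists_productChart q
  have hpt : c.pt (c.coord q, h x) = q := by rw [← hq]; exact pt_coord hc
  have hz : (c.coord q, x) ∈ c.dom h := by
    have := mem_target hc
    rw [hq] at this
    exact this
  have h2 := energy_eq_add hθ hh hρ (isSmoothOnPullback_backwardIntegral hh hfs hfv) hz
  rw [fderiv_backwardIntegral hh hfs hfv hz] at h2
  simp only [hpt] at h2
  rw [h2]
  simp only [hf, h1]
  ring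

/-- The kernel lift is complete if the energy has proper support. Near the support of the energy
integral curves exist for a uniform time by compactness. Elsewhere the kernel lift commutes with
the Liouville flow, by which every point can be moved into a compact set. -/
theorem exists_integralCurve_kernelLift (hθ : F.IsLiouvilleFamily θ)
    (hdom : F.LocallyHasGeneratingDomains θ) (hh : ContMDiff (IP.prod 𝓘(ℝ, ℝ)) I ∞ h)
    (hρ : ρ.IsSubordinate fun j => (F.chartOf j).toHomeo.source)
    (hκ : IsSmoothOnPullback IP F h κ) (hen : HasProperSupport F h (energy ρ θ h κ))
    {p : P} {q : N} {s₀ : ℝ} (hq : F.proj q = h (p, s₀)) :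
    ∃ γ : ℝ → N, γ s₀ = q ∧ ∀ s, IsIntegralAt (kernelLift hθ hh hρ hκ) p γ s := by
  refine exists_global_integralCurve hh (fun s₁ => ?_) hq
  obtain ⟨V₁, hV₁, ht₁, C, hC, hVC⟩ := hen (h (p, s₁))
  obtain ⟨V₂, hV₂, ht₂, S, hS', hCS⟩ := exists_isTrap_superset hθ hdom (h (p, s₁)) hC
  set V : Set B := V₁ ∩ V₂ with hV
  have hVo : IsOpen V := hV₁.inter hV₂
  have hS : IsTrap hθ V S := hS'.mono hθ inter_subset_right
  set S₁ : Set N := liouvilleFlow hθ (-1) ⁻¹' S with hS₁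
  set S₂ : Set N := liouvilleFlow hθ (-2) ⁻¹' S with hS₂
  have htrap : IsTrap hθ V S₂ := hS.preimage (by norm_num)
  have hSS₁ : ∀ q ∈ S, F.proj q ∈ V → q ∈ interior S₁ := fun q hqS hqV =>
    preimage_interior_subset (-1) S (hS.interior q hqS hqV)
  have hKc : IsCompact (S₂ \ interior S₁) := htrap.isCompact.diff isOpen_interior
  obtain ⟨ε₁, hε₁, H₁⟩ := exists_uniform_integral_curve hh (kernelLift hθ hh hρ hκ)
    (p := p) (s₁ := s₁) htrap.isCompact isOpen_univ fun _ _ _ => mem_univ _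
  obtain ⟨ε₂, hε₂, H₂⟩ := exists_uniform_integral_curve hh (kernelLift hθ hh hρ hκ)
    (p := p) (s₁ := s₁) hKc hS.isCompact.isClosed.isOpen_compl fun q hqK hqp hqS =>
      hqK.2 (hSS₁ q hqS (by rw [hqp]; exact ⟨ht₁, ht₂⟩))
  have hcont : Continuous fun s => h (p, s) := hh.continuous.comp (by fun_prop)
  obtain ⟨ε₃, hε₃, H₃⟩ := Metric.eventually_nhds_iff_ball.1
    (hcont.continuousAt.eventually (hVo.mem_nhds (⟨ht₁, ht₂⟩ : h (p, s₁) ∈ V)))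
  rw [Real.ball_eq_Ioo] at H₃
  have hIoo : ∀ {ε ε' : ℝ}, ε ≤ ε' → Ioo (s₁ - ε) (s₁ + ε) ⊆ Ioo (s₁ - ε') (s₁ + ε') :=
    fun hε => Ioo_subset_Ioo (by linarith) (by linarith)
  set ε := min ε₁ (min ε₂ ε₃) with hε
  have hle₁ : ε ≤ ε₁ := min_le_left _ _
  have hle₂ : ε ≤ ε₂ := (min_le_right _ _).trans (min_le_left _ _)
  have hle₃ : ε ≤ ε₃ := (min_le_right _ _).trans (min_le_right _ _)
  refine ⟨ε, lt_min hε₁ (lt_min hε₂ hε₃), fun s hs q hq => ?_⟩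
  have hqV : F.proj q ∈ V := by
    rw [hq]
    exact H₃ s (hIoo hle₃ hs)
  by_cases hqS₂ : q ∈ S₂
  · obtain ⟨γ, h1, h2⟩ := H₁ s (hIoo hle₁ hs) q hqS₂ hq
    exact ⟨γ, h1, fun s' hs' => (h2 s' (hIoo hle₁ hs')).1⟩
  -- the first time at which the backward flow line of `q`, sampled at integers, lies in `S₂`
  have hex : ∃ n : ℕ, liouvilleFlow hθ (-n) q ∈ S₂ := by
    obtain ⟨u, hu, hmem⟩ := htrap.reaches q hqV
    refine ⟨⌈u⌉₊, ?_⟩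
    have h1 := htrap.backward _ hmem (by rwa [proj_liouvilleFlow]) (⌈u⌉₊ - u)
      (sub_nonneg.2 (Nat.le_ceil u))
    rw [← liouvilleFlow_add] at h1
    convert h1 using 2
    ring
  classical
  obtain ⟨m, hm⟩ : ∃ m, Nat.find hex = m + 1 := by
    refine Nat.exists_eq_succ_of_ne_zero fun h0 => hqS₂ ?_
    have h1 := Nat.find_spec hex
    rwa [h0, Nat.cast_zero, neg_zero, liouvilleFlow_zero] at h1
  have hyS₂ := Nat.find_spec hex
  have hmS₂ : liouvilleFlow hθ (-m) q ∉ S₂ := Nat.find_min hex (by omega)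
  rw [hm] at hyS₂
  set y := liouvilleFlow hθ (-(m + 1 : ℕ)) q with hy
  have hyS₁ : y ∉ interior S₁ := by
    intro h1
    have h2 : liouvilleFlow hθ (-1) y ∈ S :=
      (interior_subset h1 : y ∈ S₁)
    refine hmS₂ ?_
    rw [hS₂, mem_preimage, ← liouvilleFlow_add]
    rw [hy, ← liouvilleFlow_add] at h2
    convert h2 using 2
    push_cast
    ring
  obtain ⟨γ, hγs, hγ⟩ := H₂ s (hIoo hle₂ hs) y ⟨hyS₂, hyS₁⟩ (by rw [hy, proj_liouvilleFlow, hq])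
  refine ⟨fun s' => liouvilleFlow hθ (m + 1 : ℕ) (γ s'), ?_, fun s' hs' => ?_⟩
  · simp only [hγs, hy]
    exact liouvilleFlow_neg' hθ _ q
  have hs'V : h (p, s') ∈ V := H₃ s' (hIoo hle₃ hs')
  have hγ' := hγ s' (hIoo hle₂ hs')
  refine isIntegralAt_liouvilleFlow hθ hh hρ hκ (Nat.cast_nonneg _) ?_ fun u hu => ?_
  · filter_upwards [isOpen_Ioo.mem_nhds (hIoo hle₂ hs')] with r hr
    exact (hγ r hr).1
  · have h1 : liouvilleFlow hθ u (γ s') ∉ S := by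
      intro h2
      have h3 := hS.backward _ h2 (by rw [proj_liouvilleFlow, hγ'.1.proj]; exact hs'V) u hu.1
      rw [liouvilleFlow_neg] at h3
      exact hγ'.2 h3
    filter_upwards [continuousAt_fst.eventually
        (hS.isCompact.isClosed.isOpen_compl.mem_nhds (x := liouvilleFlow hθ u (γ s')) h1),
      (hcont.continuousAt.comp continuousAt_snd).eventually (hVo.mem_nhds hs'V)] with z hz1 hz2 hz3
    by_contra hne
    exact hz1 (hCS z.1 (hVC z.1 (p, z.2) hz3 hz2.1 hne) (by rw [hz3]; exact hz2.2))

end Completeness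

/-! ### Parallel transport -/

section Transport

variable {E EB HB EN HN B N : Type*}
  [NormedAddCommGroup E] [NormedSpace ℝ E] [FiniteDimensional ℝ E]
  [NormedAddCommGroup EB] [NormedSpace ℝ EB] [TopologicalSpace HB]
  [NormedAddCommGroup EN] [NormedSpace ℝ EN] [TopologicalSpace HN]
  {I : ModelWithCorners ℝ EB HB} {J : ModelWithCorners ℝ EN HN}
  [TopologicalSpace B] [ChartedSpace HB B] [TopologicalSpace N] [ChartedSpace HN N]
  [T2Space N]
  {EP HP P : Type*} [NormedAddCommGroup EP] [NormedSpace ℝ EP] [FiniteDimensional ℝ EP]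
  [TopologicalSpace HP]
  {IP : ModelWithCorners ℝ EP HP} [TopologicalSpace P] [ChartedSpace HP P] [IsManifold IP ∞ P]
  {F : SmoothFamily E I J N B} {h : P × ℝ → B} {A : LiftField IP F h}

/-- Integral curves of the lift through every point exist for all times. -/
def LiftField.IsComplete (A : LiftField IP F h) : Prop :=
  ∀ (p : P) (q : N) (s₀ : ℝ), F.proj q = h (p, s₀) →
    ∃ γ : ℝ → N, γ s₀ = q ∧ ∀ s, IsIntegralAt A p γ s

open Classical in
/-- Parallel transport along the curve `s ↦ h (p, s)`, from time `s₀` to time `s`. It is meaningful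
for points `q` over `h (p, s₀)`; other points are left where they are. -/
def transport (hA : A.IsComplete) (p : P) (s₀ s : ℝ) (q : N) : N :=
  if hq : F.proj q = h (p, s₀) then (hA p q s₀ hq).choose s else q

variable {hA : A.IsComplete} {p : P} {s₀ : ℝ} {q : N}

theorem transport_self : transport hA p s₀ s₀ q = q := by
  unfold transport
  split_ifs with hq
  exacts [(hA p q s₀ hq).choose_spec.1, rfl]

theorem isIntegralAt_transport (hq : F.proj q = h (p, s₀)) (s : ℝ) :
    IsIntegralAt A p (fun s => transport hA p s₀ s q) s := by
  have h1 : (fun s => transport hA p s₀ s q) = (hA p q s₀ hq).choose :=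
    funext fun s => dif_pos hq
  rw [h1]
  exact (hA p q s₀ hq).choose_spec.2 s

theorem proj_transport (hq : F.proj q = h (p, s₀)) (s : ℝ) :
    F.proj (transport hA p s₀ s q) = h (p, s) :=
  (isIntegralAt_transport hq s).proj

theorem transport_transport (hh : ContMDiff (IP.prod 𝓘(ℝ, ℝ)) I ∞ h) (hq : F.proj q = h (p, s₀))
    (s₁ s₂ : ℝ) :
    transport hA p s₁ s₂ (transport hA p s₀ s₁ q) = transport hA p s₀ s₂ q :=
  IsIntegralAt.eqOn hh isOpen_univ isPreconnected_univ
    (fun s _ => isIntegralAt_transport (hA := hA) (proj_transport (hA := hA) hq s₁) s)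
    (fun s _ => isIntegralAt_transport (hA := hA) hq s) (mem_univ s₁) transport_self (mem_univ s₂)

variable {EY HY Y : Type*} [NormedAddCommGroup EY] [NormedSpace ℝ EY] [TopologicalSpace HY]
  {IY : ModelWithCorners ℝ EY HY} [TopologicalSpace Y] [ChartedSpace HY Y]
  {τ : Y → P} {σ r : Y → ℝ} {m : Y → N} {y₀ : Y} {g : N → P × ℝ → ℝ}

theorem contMDiffAt_transport (hh : ContMDiff (IP.prod 𝓘(ℝ, ℝ)) I ∞ h)
    (hτ : ContMDiffAt IY IP ∞ τ y₀) (hσ : ContMDiffAt IY 𝓘(ℝ, ℝ) ∞ σ y₀)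
    (hr : ContMDiffAt IY 𝓘(ℝ, ℝ) ∞ r y₀) (hm : ContMDiffAt IY J ∞ m y₀)
    (hp : ∀ᶠ y in 𝓝 y₀, F.proj (m y) = h (τ y, σ y)) :
    ContMDiffAt IY J ∞ (fun y => transport hA (τ y) (σ y) (r y) (m y)) y₀ := by
  have h1 := (contMDiffAt_integralCurve hh (A := A) (g := fun _ _ => 0)
    (fun _ => contMDiffOn_const) (γ := fun y s => transport hA (τ y) (σ y) s (m y)) isOpen_univ
    ordConnected_univ (hp.mono fun y hy s _ => isIntegralAt_transport hy s) hτ hσ (mem_univ _)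
    (by simpa only [transport_self] using hm) (mem_univ (r y₀))).1
  exact ContMDiffAt.comp (g := fun z : Y × ℝ => transport hA (τ z.1) (σ z.1) z.2 (m z.1))
    (f := fun y => (y, r y)) y₀ h1 (contMDiffAt_id.prodMk hr)

theorem contMDiffAt_integral_transport (hh : ContMDiff (IP.prod 𝓘(ℝ, ℝ)) I ∞ h)
    (hg : IsSmoothOnPullback IP F h g)
    (hτ : ContMDiffAt IY IP ∞ τ y₀) (hσ : ContMDiffAt IY 𝓘(ℝ, ℝ) ∞ σ y₀)
    (hr : ContMDiffAt IY 𝓘(ℝ, ℝ) ∞ r y₀) (hm : ContMDiffAt IY J ∞ m y₀)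
    (hp : ∀ᶠ y in 𝓝 y₀, F.proj (m y) = h (τ y, σ y)) :
    ContMDiffAt IY 𝓘(ℝ, ℝ) ∞
      (fun y => ∫ u in σ y..r y, g (transport hA (τ y) (σ y) u (m y)) (τ y, u)) y₀ := by
  have h1 := (contMDiffAt_integralCurve hh (A := A) hg
    (γ := fun y s => transport hA (τ y) (σ y) s (m y)) isOpen_univ
    ordConnected_univ (hp.mono fun y hy s _ => isIntegralAt_transport hy s) hτ hσ (mem_univ _)
    (by simpa only [transport_self] using hm) (mem_univ (r y₀))).2
  exact ContMDiffAt.comp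
    (g := fun z : Y × ℝ => ∫ u in σ z.1..z.2, g (transport hA (τ z.1) (σ z.1) u (m z.1)) (τ z.1, u))
    (f := fun y => (y, r y)) y₀ h1 (contMDiffAt_id.prodMk hr)

/-- Transport is continuous in the starting point and the starting time. -/
theorem continuousOn_transport (hh : ContMDiff (IP.prod 𝓘(ℝ, ℝ)) I ∞ h) (s : ℝ) :
    ContinuousOn (fun z : N × (P × ℝ) => transport hA z.2.1 z.2.2 s z.1)
      {z | F.proj z.1 = h z.2} := by
  rintro ⟨q₀, p₀, s₀⟩ hz₀
  obtain ⟨c, hc⟩ := F.exists_productChart q₀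
  have hdom : (c.coord q₀, (p₀, s₀)) ∈ c.dom h := by
    have := mem_target hc
    rw [show F.proj q₀ = h (p₀, s₀) from hz₀] at this
    exact this
  have h1 := contMDiffAt_transport (hA := hA) (IY := 𝓘(ℝ, E).prod (IP.prod 𝓘(ℝ, ℝ)))
    (Y := E × (P × ℝ)) (τ := fun y => y.2.1) (σ := fun y => y.2.2) (r := fun _ => s)
    (m := fun y => c.pt (y.1, h y.2)) (y₀ := (c.coord q₀, (p₀, s₀))) hh
    (contMDiff_fst.comp contMDiff_snd).contMDiffAt (contMDiff_snd.comp contMDiff_snd).contMDiffAt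
    contMDiffAt_const
    (ContMDiffAt.comp (g := c.pt) (f := fun y : E × (P × ℝ) => (y.1, h y.2)) _
      (contMDiffOn_pt.contMDiffAt (c.toHomeo.open_target.mem_nhds hdom))
      (contMDiff_lift hh).contMDiffAt)
    (by
      filter_upwards [(isOpen_dom hh.continuous c).mem_nhds hdom] with y hy
      exact proj_pt hy)
  have h2 : ContinuousAt (fun z : N × (P × ℝ) => (c.coord z.1, z.2)) (q₀, (p₀, s₀)) :=
    (ContinuousAt.comp (g := c.coord) (f := Prod.fst) (x := (q₀, (p₀, s₀)))
      (continuousAt_coord hc) continuousAt_fst).prodMk continuousAt_snd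
  have h3 := ContinuousAt.comp
    (g := fun y : E × (P × ℝ) => transport hA y.2.1 y.2.2 s (c.pt (y.1, h y.2)))
    (f := fun z : N × (P × ℝ) => (c.coord z.1, z.2)) (x := (q₀, (p₀, s₀))) h1.continuousAt h2
  have h4 : ∀ z : N × (P × ℝ), z.1 ∈ c.toHomeo.source → F.proj z.1 = h z.2 →
      transport hA z.2.1 z.2.2 s z.1 =
        transport hA z.2.1 z.2.2 s (c.pt (c.coord z.1, h z.2)) := fun z hz hp => by
    rw [← hp, pt_coord hz]
  refine h3.continuousWithinAt.congr_of_eventuallyEq ?_ (h4 _ hc hz₀)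
  filter_upwards [self_mem_nhdsWithin, mem_nhdsWithin_of_mem_nhds
    ((c.toHomeo.open_source.preimage continuous_fst).mem_nhds (x := (q₀, (p₀, s₀))) hc)]
    with z hz hzc
  exact h4 z hzc hz

end Transport

section FiberMaps

variable {E EB HB EN HN B N : Type*}
  [NormedAddCommGroup E] [NormedSpace ℝ E]
  [NormedAddCommGroup EB] [NormedSpace ℝ EB] [TopologicalSpace HB]
  [NormedAddCommGroup EN] [NormedSpace ℝ EN] [TopologicalSpace HN]
  {I : ModelWithCorners ℝ EB HB} {J : ModelWithCorners ℝ EN HN}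
  [TopologicalSpace B] [ChartedSpace HB B] [TopologicalSpace N] [ChartedSpace HN N]
  {F : SmoothFamily E I J N B}
  {EM HM M : Type*}
  [NormedAddCommGroup EM] [NormedSpace ℝ EM] [TopologicalSpace HM]
  {IM : ModelWithCorners ℝ EM HM} [TopologicalSpace M] [ChartedSpace HM M]

theorem contMDiffAt_coord_incl (c : F.ProductChart) {t : B} {x : F.Fiber t}
    (hx : x.incl ∈ c.toHomeo.source) :
    ContMDiffAt 𝓘(ℝ, E) 𝓘(ℝ, E) ∞ (fun x : F.Fiber t => c.coord x.incl) x :=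
  contMDiffAt_of_mem_maximalAtlas
    (IsManifold.subset_maximalAtlas (I := 𝓘(ℝ, E)) (fiberChart_mem_atlas c t)) hx

theorem SmoothFamily.Fiber.contMDiff_incl {t : B} :
    ContMDiff 𝓘(ℝ, E) J ∞ (SmoothFamily.Fiber.incl : F.Fiber t → N) := by
  intro x
  obtain ⟨c, hc⟩ := F.exists_productChart x.incl
  have htg := mem_target hc
  rw [x.proj_incl] at htg
  have h1 : ContMDiffAt 𝓘(ℝ, E) J ∞ (fun x : F.Fiber t => c.pt (c.coord x.incl, t)) x :=
    ContMDiffAt.comp (g := c.pt) (f := fun x : F.Fiber t => (c.coord x.incl, t)) x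
      (contMDiffOn_pt.contMDiffAt (c.toHomeo.open_target.mem_nhds htg))
      ((contMDiffAt_coord_incl c hc).prodMk contMDiffAt_const)
  refine h1.congr_of_eventuallyEq ?_
  filter_upwards [(SmoothFamily.Fiber.isInducing_incl F t).continuous.continuousAt.eventually
    (c.toHomeo.open_source.mem_nhds hc)] with y hy
  have := pt_coord hy
  rw [y.proj_incl] at this
  exact this.symm

/-- A map into a fibre is smooth if it is smooth as a map into the total space. -/
theorem SmoothFamily.Fiber.contMDiffAt_of_incl {t : B} {m : M → F.Fiber t} {y : M}
    (hm : ContMDiffAt IM J ∞ (fun y => (m y).incl) y) : ContMDiffAt IM 𝓘(ℝ, E) ∞ m y := by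
  have hcont : ContinuousAt m y :=
    (SmoothFamily.Fiber.isInducing_incl F t).continuousAt_iff.2 hm.continuousAt
  rw [contMDiffAt_iff_target]
  refine ⟨hcont, ?_⟩
  exact ContMDiffAt.comp (g := (F.chartOf (m y).incl).coord) (f := fun y => (m y).incl) y
    (contMDiffOn_coord.contMDiffAt
      ((F.chartOf (m y).incl).toHomeo.open_source.mem_nhds (mem_chartOf _))) hm

end FiberMaps

/-! ### The change of the one-forms under parallel transport -/

section PullbackFormula

variable {EM M V : Type*} [NormedAddCommGroup EM] [NormedSpace ℝ EM] [TopologicalSpace M]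
  [ChartedSpace EM M] [NormedAddCommGroup V] [NormedSpace ℝ V]

/-- The tangent space of `M` is identified with `EM` by the preferred chart. -/
theorem mfderiv_eq_fderiv_comp_symm {f : M → V} {x : M}
    (hf : MDifferentiableAt 𝓘(ℝ, EM) 𝓘(ℝ, V) f x) (v : EM) :
    (mfderiv 𝓘(ℝ, EM) 𝓘(ℝ, V) f x v : V) =
      fderiv ℝ (fun e => f ((chartAt EM x).symm e)) (chartAt EM x x) v := by
  have h1 : mfderiv 𝓘(ℝ, EM) 𝓘(ℝ, V) f x =
      fderivWithin ℝ (writtenInExtChartAt 𝓘(ℝ, EM) 𝓘(ℝ, V) x f) (range 𝓘(ℝ, EM))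
        (extChartAt 𝓘(ℝ, EM) x x) := by
    unfold mfderiv
    exact if_pos hf
  refine (congrArg (fun T : EM →L[ℝ] V => T v) h1).trans ?_
  rw [modelWithCornersSelf_coe, range_id, fderivWithin_univ]
  rfl

theorem dForm_fderiv {f : V → ℝ} {x : V} (hf : ContDiffAt ℝ 2 f x) : dForm (fderiv ℝ f) x = 0 := by
  have hsym : IsSymmSndFDerivAt ℝ f x := hf.isSymmSndFDerivAt (by simp)
  ext a b
  rw [dForm_apply, hsym.eq a b, sub_self]
  rfl

variable {E EB HB EN HN B N : Type*}
  [NormedAddCommGroup E] [NormedSpace ℝ E] [FiniteDimensional ℝ E]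
  [NormedAddCommGroup EB] [NormedSpace ℝ EB] [FiniteDimensional ℝ EB] [TopologicalSpace HB]
  [NormedAddCommGroup EN] [NormedSpace ℝ EN] [FiniteDimensional ℝ EN] [TopologicalSpace HN]
  {I : ModelWithCorners ℝ EB HB} {J : ModelWithCorners ℝ EN HN}
  [TopologicalSpace B] [ChartedSpace HB B] [TopologicalSpace N] [ChartedSpace HN N]
  [T2Space N] [T2Space B] [IsManifold I ∞ B]
  {EP HP P : Type*} [NormedAddCommGroup EP] [NormedSpace ℝ EP] [FiniteDimensional ℝ EP]
  [TopologicalSpace HP]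
  {IP : ModelWithCorners ℝ EP HP} [TopologicalSpace P] [ChartedSpace HP P] [IsManifold IP ∞ P]
  {F : SmoothFamily E I J N B} {h : P × ℝ → B} {θ : F.OneForms}
  {ρ : SmoothPartitionOfUnity N J N} {κ : N → P × ℝ → ℝ}
  (hθ : F.IsLiouvilleFamily θ) (hh : ContMDiff (IP.prod 𝓘(ℝ, ℝ)) I ∞ h)
  (hρ : ρ.IsSubordinate fun j => (F.chartOf j).toHomeo.source) (hκ : IsSmoothOnPullback IP F h κ)
  [IsManifold 𝓘(ℝ, EM) ∞ M] {m : M × ℝ → N} {p : P}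

include hθ hh hρ hκ

/-- The curve `s ↦ m (x, s)` being integral curves of the kernel lift, the derivative in `s` of the
pull-backs of the forms equals the differential of the energy. -/
theorem hasDerivAt_pullback_sub (hm : ContMDiff (𝓘(ℝ, EM).prod 𝓘(ℝ, ℝ)) J ∞ m)
    (hint : ∀ x s, IsIntegralAt (kernelLift hθ hh hρ hκ) p (fun s => m (x, s)) s)
    {G : M × ℝ → ℝ} (hG : ContMDiff (𝓘(ℝ, EM).prod 𝓘(ℝ, ℝ)) 𝓘(ℝ, ℝ) ∞ G)
    (hGd : ∀ x s, HasDerivAt (fun s => G (x, s)) (energy ρ θ h κ (m (x, s)) (p, s)) s)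
    (x₀ : M) (v : EM) (s₁ : ℝ) :
    HasDerivAt (fun s => (OneForm.pullback (E' := EM)
        (fun x => (⟨m (x, s), (hint x s).proj⟩ : F.Fiber (h (p, s)))) (θ (h (p, s))) x₀ v : ℝ) -
      (OneForm.ofFun EM (fun x => G (x, s)) x₀ v : ℝ)) 0 s₁ := by
  obtain ⟨c, hc⟩ := F.exists_productChart (m (x₀, s₁))
  set e₀ : EM := chartAt EM x₀ x₀ with he₀
  have hsymm : (chartAt EM x₀).symm e₀ = x₀ := (chartAt EM x₀).left_inv (mem_chart_source EM x₀)
  set κ₀ : EM × ℝ → M × ℝ := fun w => ((chartAt EM x₀).symm w.1, w.2) with hκ₀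
  have hκ₀s : ∀ s, ContMDiffAt 𝓘(ℝ, EM × ℝ) (𝓘(ℝ, EM).prod 𝓘(ℝ, ℝ)) ∞ κ₀ (e₀, s) := by
    intro s
    have hf1 : ContMDiff 𝓘(ℝ, EM × ℝ) 𝓘(ℝ, EM) ∞ (Prod.fst : EM × ℝ → EM) :=
      contDiff_fst.contMDiff
    have hf2 : ContMDiff 𝓘(ℝ, EM × ℝ) 𝓘(ℝ, ℝ) ∞ (Prod.snd : EM × ℝ → ℝ) := contDiff_snd.contMDiff
    have h1 : ContMDiffAt 𝓘(ℝ, EM) 𝓘(ℝ, EM) ∞ (chartAt EM x₀).symm e₀ :=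
      contMDiffOn_chart_symm.contMDiffAt
        ((chartAt EM x₀).open_target.mem_nhds (mem_chart_target EM x₀))
    exact (ContMDiffAt.comp (g := (chartAt EM x₀).symm) (f := Prod.fst) (e₀, s) h1
      hf1.contMDiffAt).prodMk hf2.contMDiffAt
  have hκ₀v : ∀ s, κ₀ (e₀, s) = (x₀, s) := fun s => Prod.ext hsymm rfl
  set k : EM × ℝ → E := fun w => c.coord (m (κ₀ w)) with hk
  set K : EM × ℝ → E × ℝ := fun w => (k w, w.2) with hK
  set Gh : EM × ℝ → ℝ := fun w => G (κ₀ w) with hGh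
  have hGs : ∀ s, ContDiffAt ℝ ∞ Gh (e₀, s) := fun s =>
    contMDiffAt_iff_contDiffAt.1
      (ContMDiffAt.comp (g := G) (e₀, s) hG.contMDiffAt (hκ₀s s))
  have hmκ : ∀ s, ContMDiffAt 𝓘(ℝ, EM × ℝ) J ∞ (fun w => m (κ₀ w)) (e₀, s) := fun s =>
    ContMDiffAt.comp (g := m) (e₀, s) hm.contMDiffAt (hκ₀s s)
  have hks : ∀ s, m (x₀, s) ∈ c.toHomeo.source → ContDiffAt ℝ ∞ k (e₀, s) := fun s hs =>
    contMDiffAt_iff_contDiffAt.1 (ContMDiffAt.comp (g := c.coord) (e₀, s)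
      (contMDiffOn_coord.contMDiffAt (c.toHomeo.open_source.mem_nhds (by rwa [hκ₀v])))
      (hmκ s))
  have hw₁ : m (κ₀ (e₀, s₁)) ∈ c.toHomeo.source := by rwa [hκ₀v]
  have hsrc : ∀ᶠ w in 𝓝 (e₀, s₁), m (κ₀ w) ∈ c.toHomeo.source :=
    (hmκ s₁).continuousAt.eventually (c.toHomeo.open_source.mem_nhds hw₁)
  have hline : ContinuousAt (fun s : ℝ => (e₀, s)) s₁ := by fun_prop
  have hsrcs : ∀ᶠ s in 𝓝 s₁, m (x₀, s) ∈ c.toHomeo.source := by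
    filter_upwards [hline.eventually hsrc] with s hs
    rwa [hκ₀v] at hs
  have hproj : ∀ w : EM × ℝ, F.proj (m (κ₀ w)) = h (p, w.2) := fun w => (hint _ _).proj
  have hpt : ∀ w : EM × ℝ, m (κ₀ w) ∈ c.toHomeo.source →
      c.pt (k w, h (p, w.2)) = m (κ₀ w) := fun w hw => by
    rw [← hproj w]; exact pt_coord hw
  have htg : ∀ w : EM × ℝ, m (κ₀ w) ∈ c.toHomeo.source →
      (k w, h (p, w.2)) ∈ c.toHomeo.target := fun w hw => by
    rw [← hproj w]; exact mem_target hw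
  -- the form which the surface `K` pulls back, minus the differential of the integrated energy
  set l : EM × ℝ → EM × ℝ →L[ℝ] ℝ := fun w =>
    (extForm ρ θ h κ c p (K w)).comp (fderiv ℝ K w) with hl
  have hkd : ContDiffAt ℝ ∞ k (e₀, s₁) := hks s₁ hc
  have hKd : ContDiffAt ℝ ∞ K (e₀, s₁) := hkd.prodMk contDiffAt_snd
  have hext : ContDiffAt ℝ ∞ (extForm ρ θ h κ c p) (K (e₀, s₁)) :=
    contDiffAt_extForm hθ.smooth hh hρ hκ (htg _ hw₁)
  have hld : DifferentiableAt ℝ l (e₀, s₁) := by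
    have h1 : ContDiffAt ℝ ∞ (fderiv ℝ K) (e₀, s₁) := hKd.fderiv_right (by simp)
    exact ((ContDiffAt.comp (g := extForm ρ θ h κ c p) (f := K) (e₀, s₁) hext hKd).clm_comp
      h1).differentiableAt (by simp)
  have hGd' : DifferentiableAt ℝ (fderiv ℝ Gh) (e₀, s₁) :=
    ((hGs s₁).fderiv_right (m := ∞) (by simp)).differentiableAt (by simp)
  have h2le : (2 : WithTop ℕ∞) ≤ ∞ := WithTop.coe_le_coe.2 (le_top : (2 : ℕ∞) ≤ ⊤)
  have hKev : ∀ᶠ w in 𝓝 (e₀, s₁), DifferentiableAt ℝ k w ∧ DifferentiableAt ℝ Gh w := by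
    filter_upwards [(hkd.of_le h2le).eventually (by simp),
      ((hGs s₁).of_le h2le).eventually (by simp)] with w h1 h2
    exact ⟨h1.differentiableAt (by simp), h2.differentiableAt (by simp)⟩
  have hfK : ∀ w, DifferentiableAt ℝ k w → ∀ a, fderiv ℝ K w a = (fderiv ℝ k w a, a.2) := by
    intro w hw a
    rw [hK, (hw.hasFDerivAt.prodMk hasFDerivAt_snd).fderiv]
    rfl
  have hks1 : ∀ w, DifferentiableAt ℝ k w → m (κ₀ w) ∈ c.toHomeo.source →
      fderiv ℝ k w (0, 1) = liftCoef ρ θ h κ c (k w, (p, w.2)) := by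
    intro w hw hws
    have h1 : HasDerivAt (fun s => k (w.1, s)) (fderiv ℝ k w (0, 1)) w.2 :=
      hw.hasFDerivAt.comp_hasDerivAt w.2 (f := fun s : ℝ => (w.1, s))
        ((hasDerivAt_const w.2 w.1).prodMk (hasDerivAt_id w.2))
    exact h1.unique ((hint _ w.2).deriv c hws)
  have hzero : ∀ᶠ w in 𝓝 (e₀, s₁), l w (0, 1) - fderiv ℝ Gh w (0, 1) = 0 := by
    filter_upwards [hKev, hsrc] with w hw hws
    have h1 : HasDerivAt (fun s => Gh (w.1, s)) (fderiv ℝ Gh w (0, 1)) w.2 :=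
      hw.2.hasFDerivAt.comp_hasDerivAt w.2 (f := fun s : ℝ => (w.1, s))
        ((hasDerivAt_const w.2 w.1).prodMk (hasDerivAt_id w.2))
    have h2 := energy_pt hθ hh hρ hκ (z := (k w, (p, w.2))) (htg w hws)
    simp only [hpt w hws] at h2
    have h3 : fderiv ℝ Gh w (0, 1) = energy ρ θ h κ (m (κ₀ w)) (p, w.2) :=
      h1.unique (hGd ((chartAt EM x₀).symm w.1) w.2)
    rw [h3, h2]
    simp only [hl, ContinuousLinearMap.comp_apply, hfK w hw.1, hks1 w hw.1 hws]
    exact sub_self _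
  have hdl : dForm l (e₀, s₁) (0, 1) (v, 0) = 0 := by
    rw [dForm_pullback (hKd.of_le h2le) (hext.differentiableAt (by simp))
      (Filter.Eventually.of_forall fun w => rfl), hfK _ hKev.self_of_nhds.1,
      hks1 _ hKev.self_of_nhds.1 hw₁]
    have h1 := dForm_extForm_liftCoef hθ hh hρ hκ (w := K (e₀, s₁)) (htg _ hw₁)
    exact congrArg (fun T : E × ℝ →L[ℝ] ℝ => T (fderiv ℝ K (e₀, s₁) (v, 0))) h1
  have hdG := congrArg (fun T : EM × ℝ →L[ℝ] EM × ℝ →L[ℝ] ℝ => T (0, 1) (v, 0))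
    (dForm_fderiv ((hGs s₁).of_le h2le))
  have hz1 : fderiv ℝ l (e₀, s₁) (v, 0) (0, 1) - fderiv ℝ (fderiv ℝ Gh) (e₀, s₁) (v, 0) (0, 1)
      = 0 := by
    have h1 := ((hld.hasFDerivAt.clm_apply (hasFDerivAt_const ((0 : EM), (1 : ℝ)) (e₀, s₁))).sub
      (hGd'.hasFDerivAt.clm_apply (hasFDerivAt_const ((0 : EM), (1 : ℝ)) (e₀, s₁)))).unique
      ((hasFDerivAt_const (0 : ℝ) (e₀, s₁)).congr_of_eventuallyEq hzero)
    simpa using congrArg (fun T : EM × ℝ →L[ℝ] ℝ => T (v, 0)) h1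
  have hder : HasDerivAt (fun s => l (e₀, s) (v, 0) - fderiv ℝ Gh (e₀, s) (v, 0)) 0 s₁ := by
    have h1 : HasDerivAt (fun s : ℝ => (e₀, s)) ((0 : EM), (1 : ℝ)) s₁ :=
      (hasDerivAt_const s₁ e₀).prodMk (hasDerivAt_id s₁)
    have h2 := ((hld.hasFDerivAt.comp_hasDerivAt s₁ h1).clm_apply
      (hasDerivAt_const s₁ ((v, 0) : EM × ℝ))).sub
      ((hGd'.hasFDerivAt.comp_hasDerivAt s₁ h1).clm_apply
      (hasDerivAt_const s₁ ((v, 0) : EM × ℝ)))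
    refine h2.congr_deriv ?_
    simp only [dForm_apply, zero_apply] at hdl hdG
    simp only [map_zero, add_zero]
    linarith
  refine hder.congr_of_eventuallyEq ?_
  filter_upwards [hsrcs] with s hs
  have hkss := (hks s hs).differentiableAt (by simp)
  have hGss := (hGs s).differentiableAt (by simp)
  have hslice : HasFDerivAt (fun e : EM => (e, s)) (ContinuousLinearMap.inl ℝ EM ℝ) e₀ :=
    (hasFDerivAt_id e₀).prodMk (hasFDerivAt_const s e₀)
  have hxs : ContMDiffAt 𝓘(ℝ, EM) (𝓘(ℝ, EM).prod 𝓘(ℝ, ℝ)) ∞ (fun x : M => (x, s)) x₀ :=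
    contMDiffAt_id.prodMk contMDiffAt_const
  have hms : ContMDiffAt 𝓘(ℝ, EM) J ∞ (fun x => m (x, s)) x₀ :=
    ContMDiffAt.comp (g := m) x₀ hm.contMDiffAt hxs
  have hmf : MDifferentiableAt 𝓘(ℝ, EM) 𝓘(ℝ, E)
      (fun x => (⟨m (x, s), (hint x s).proj⟩ : F.Fiber (h (p, s)))) x₀ :=
    (SmoothFamily.Fiber.contMDiffAt_of_incl hms).mdifferentiableAt (by simp)
  congr 1
  · refine (apply_mfderiv_eq_form θ hmf c hs v).trans ?_
    have h1 : MDifferentiableAt 𝓘(ℝ, EM) 𝓘(ℝ, E) (fun x => c.coord (m (x, s))) x₀ :=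
      (ContMDiffAt.comp (g := c.coord) x₀ (contMDiffOn_coord.contMDiffAt
        (c.toHomeo.open_source.mem_nhds hs)) hms).mdifferentiableAt (by simp)
    have h2 := mfderiv_eq_fderiv_comp_symm h1 v
    have h3 : fderiv ℝ (fun e => c.coord (m ((chartAt EM x₀).symm e, s))) e₀ =
        (fderiv ℝ k (e₀, s)).comp (ContinuousLinearMap.inl ℝ EM ℝ) :=
      (HasFDerivAt.comp (g := k) (f := fun e : EM => (e, s)) e₀ hkss.hasFDerivAt hslice).fderiv
    rw [← he₀, h3] at h2
    have h4 : k (e₀, s) = c.coord (m (x₀, s)) := by simp only [hk, hκ₀v]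
    simp only [hl, ContinuousLinearMap.comp_apply, hfK _ hkss]
    rw [extForm_apply, mul_zero, add_zero]
    simp only [hK, h4]
    exact congrArg (c.form θ (c.coord (m (x₀, s)), h (p, s))) h2
  · have h1 : MDifferentiableAt 𝓘(ℝ, EM) 𝓘(ℝ, ℝ) (fun x => G (x, s)) x₀ :=
      (ContMDiffAt.comp (g := G) x₀ hG.contMDiffAt hxs).mdifferentiableAt (by simp)
    refine (mfderiv_eq_fderiv_comp_symm h1 v).trans ?_
    have h3 : fderiv ℝ (fun e => G ((chartAt EM x₀).symm e, s)) e₀ =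
        (fderiv ℝ Gh (e₀, s)).comp (ContinuousLinearMap.inl ℝ EM ℝ) :=
      (HasFDerivAt.comp (g := Gh) (f := fun e : EM => (e, s)) e₀ hGss.hasFDerivAt hslice).fderiv
    rw [← he₀, h3]
    rfl

/-- The pull-backs of the forms along the integral curves of the kernel lift differ by the
differential of the integral of the energy. -/
theorem pullback_add_ofFun (hm : ContMDiff (𝓘(ℝ, EM).prod 𝓘(ℝ, ℝ)) J ∞ m)
    (hint : ∀ x s, IsIntegralAt (kernelLift hθ hh hρ hκ) p (fun s => m (x, s)) s)
    (hG : ContMDiff (𝓘(ℝ, EM).prod 𝓘(ℝ, ℝ)) 𝓘(ℝ, ℝ) ∞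
      fun z : M × ℝ => ∫ u in (1 : ℝ)..z.2, energy ρ θ h κ (m (z.1, u)) (p, u))
    {t₀ t₁ : B} (ht₀ : h (p, 0) = t₀) (ht₁ : h (p, 1) = t₁)
    (hm₀ : ∀ x, F.proj (m (x, 0)) = t₀) (hm₁ : ∀ x, F.proj (m (x, 1)) = t₁) :
    OneForm.pullback (E' := EM) (fun x => (⟨m (x, 0), hm₀ x⟩ : F.Fiber t₀)) (θ t₀) +
        OneForm.ofFun EM (fun x => ∫ u in (0 : ℝ)..1, energy ρ θ h κ (m (x, u)) (p, u)) =
      OneForm.pullback (E' := EM) (fun x => (⟨m (x, 1), hm₁ x⟩ : F.Fiber t₁)) (θ t₁) := by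
  subst ht₀ ht₁
  have hcont : ∀ x, Continuous fun u => energy ρ θ h κ (m (x, u)) (p, u) := fun x =>
    continuous_iff_continuousAt.2 fun u => IsIntegralAt.continuousAt_integrand hh.continuous
      (isSmoothOnPullback_energy hθ hh hρ hκ) (hint x u)
  have hGd : ∀ x s, HasDerivAt (fun s => ∫ u in (1 : ℝ)..s, energy ρ θ h κ (m (x, u)) (p, u))
      (energy ρ θ h κ (m (x, s)) (p, s)) s := fun x s =>
    intervalIntegral.integral_hasDerivAt_right ((hcont x).intervalIntegrable _ _)
      ((hcont x).stronglyMeasurableAtFilter _ _) (hcont x).continuousAt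
  funext x₀
  refine ContinuousLinearMap.ext fun v => ?_
  have hder := hasDerivAt_pullback_sub hθ hh hρ hκ hm hint hG hGd x₀ v
  have h1 := is_const_of_deriv_eq_zero (fun s => (hder s).differentiableAt)
    (fun s => (hder s).deriv) 0 1
  have h2 : OneForm.ofFun EM (fun x => ∫ u in (1 : ℝ)..1, energy ρ θ h κ (m (x, u)) (p, u)) x₀
      = 0 := by
    have h4 : (fun x => ∫ u in (1 : ℝ)..1, energy ρ θ h κ (m (x, u)) (p, u)) = fun _ => (0 : ℝ) :=
      funext fun x => intervalIntegral.integral_same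
    rw [h4]
    exact mfderiv_const
  have h3 : OneForm.ofFun EM (fun x => ∫ u in (1 : ℝ)..0, energy ρ θ h κ (m (x, u)) (p, u)) x₀
      = -OneForm.ofFun EM (fun x => ∫ u in (0 : ℝ)..1, energy ρ θ h κ (m (x, u)) (p, u)) x₀ := by
    have h4 : (fun x => ∫ u in (1 : ℝ)..0, energy ρ θ h κ (m (x, u)) (p, u)) =
        -fun x => ∫ u in (0 : ℝ)..1, energy ρ θ h κ (m (x, u)) (p, u) :=
      funext fun x => intervalIntegral.integral_symm _ _
    rw [h4]
    exact mfderiv_neg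
  simp only [h2, h3] at h1
  change _ - (-(_ : ℝ)) = _ - (0 : ℝ) at h1
  rw [sub_neg_eq_add, sub_zero] at h1
  exact h1

end PullbackFormula

/-! ### The trivialization of the family -/

section Trivialization

variable {E EB HB EN HN B N : Type*}
  [NormedAddCommGroup E] [NormedSpace ℝ E] [FiniteDimensional ℝ E]
  [NormedAddCommGroup EB] [NormedSpace ℝ EB] [FiniteDimensional ℝ EB] [TopologicalSpace HB]
  [NormedAddCommGroup EN] [NormedSpace ℝ EN] [TopologicalSpace HN]
  {I : ModelWithCorners ℝ EB HB} {J : ModelWithCorners ℝ EN HN}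
  [TopologicalSpace B] [ChartedSpace HB B] [TopologicalSpace N] [ChartedSpace HN N]
  [T2Space N] [T2Space B] [IsManifold I ∞ B]
  {F : SmoothFamily E I J N B} {h : B × ℝ → B} {A : LiftField I F h} {a : B}

theorem SmoothFamily.Fiber.isClosedEmbedding_incl (F : SmoothFamily E I J N B) (t : B) :
    IsClosedEmbedding (SmoothFamily.Fiber.incl : F.Fiber t → N) := by
  refine ⟨⟨SmoothFamily.Fiber.isInducing_incl F t, fun _ _ h => SmoothFamily.Fiber.ext h⟩, ?_⟩
  have h1 : range (SmoothFamily.Fiber.incl : F.Fiber t → N) = F.proj ⁻¹' {t} :=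
    Subset.antisymm (range_subset_iff.2 fun x => x.proj_incl) fun q hq => ⟨⟨q, hq⟩, rfl⟩
  rw [h1]
  exact isClosed_singleton.preimage F.smooth.continuous

theorem HasProperSupport.exists_isCompact {g : N → B × ℝ → ℝ} (hg : HasProperSupport F h g)
    {K : Set B} (hK : IsCompact K) :
    ∃ C, IsCompact C ∧ ∀ q x, F.proj q = h x → h x ∈ K → g q x ≠ 0 → q ∈ C := by
  refine hK.induction_on (p := fun K => ∃ C, IsCompact C ∧
    ∀ q x, F.proj q = h x → h x ∈ K → g q x ≠ 0 → q ∈ C) ?_ ?_ ?_ ?_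
  · exact ⟨∅, isCompact_empty, fun _ _ _ hx => hx.elim⟩
  · rintro K K' hKK' ⟨C, hC, H⟩
    exact ⟨C, hC, fun q x hq hx => H q x hq (hKK' hx)⟩
  · rintro K K' ⟨C, hC, H⟩ ⟨C', hC', H'⟩
    exact ⟨C ∪ C', hC.union hC', fun q x hq hx hne =>
      hx.imp (fun hx => H q x hq hx hne) fun hx => H' q x hq hx hne⟩
  · intro t _
    obtain ⟨V, hV, ht, C, hC, H⟩ := hg t
    exact ⟨V, mem_nhdsWithin_of_mem_nhds (hV.mem_nhds ht), C, hC, H⟩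

/-- Along a contraction `h` of the base to the point `a`, transport from the fibre over `b` to the
fibre over `a` and back to the fibre over `t`. -/
def trivialization (hA : A.IsComplete) (b : B) (z : F.Fiber b × B) : N :=
  transport hA z.2 1 0 (transport hA b 0 1 z.1.incl)

variable {hA : A.IsComplete} (h0 : ∀ t, h (t, 0) = t) (h1 : ∀ t, h (t, 1) = a) {b : B}

include h0 h1

theorem proj_transport_incl (x : F.Fiber b) (t : B) :
    F.proj (transport hA b 0 1 x.incl) = h (t, 1) := by
  rw [proj_transport (x.proj_incl.trans (h0 b).symm), h1, h1]

theorem proj_trivialization (x : F.Fiber b) (t : B) :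
    F.proj (trivialization hA b (x, t)) = t := by
  rw [trivialization, proj_transport (proj_transport_incl h0 h1 x t), h0]

variable (hh : ContMDiff (I.prod 𝓘(ℝ, ℝ)) I ∞ h)

include hh

theorem trivialization_self (x : F.Fiber b) : trivialization hA b (x, b) = x.incl := by
  rw [trivialization, transport_transport hh (x.proj_incl.trans (h0 b).symm), transport_self]

theorem contMDiff_transport_incl :
    ContMDiff 𝓘(ℝ, E) J ∞ fun x : F.Fiber b => transport hA b 0 1 x.incl := fun _ =>
  contMDiffAt_transport hh contMDiffAt_const contMDiffAt_const contMDiffAt_const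
    SmoothFamily.Fiber.contMDiff_incl.contMDiffAt
    (Filter.Eventually.of_forall fun x => x.proj_incl.trans (h0 b).symm)

theorem contMDiff_trivialization :
    ContMDiff (𝓘(ℝ, E).prod I) J ∞ (trivialization hA b (F := F)) := fun _ =>
  contMDiffAt_transport hh contMDiffAt_snd contMDiffAt_const contMDiffAt_const
    ((contMDiff_transport_incl h0 h1 hh).comp contMDiff_fst).contMDiffAt
    (Filter.Eventually.of_forall fun z => proj_transport_incl h0 h1 z.1 z.2)

theorem proj_transport_transport (q : N) :
    F.proj (transport hA b 1 0 (transport hA (F.proj q) 0 1 q)) = b := by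
  rw [proj_transport, h0]
  rw [proj_transport (h0 _).symm, h1, h1]

/-- The trivialization as a diffeomorphism. -/
def trivializationDiffeomorph (hA : A.IsComplete) (b : B) :
    Diffeomorph (𝓘(ℝ, E).prod I) J (F.Fiber b × B) N ∞ where
  toFun := trivialization hA b
  invFun q := (⟨transport hA b 1 0 (transport hA (F.proj q) 0 1 q),
    proj_transport_transport h0 h1 hh q⟩, F.proj q)
  left_inv := by
    rintro ⟨x, t⟩
    refine Prod.ext (SmoothFamily.Fiber.ext ?_) (proj_trivialization h0 h1 x t)
    simp only [proj_trivialization h0 h1 x t]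
    rw [trivialization, transport_transport hh (proj_transport_incl h0 h1 x t), transport_self,
      transport_transport hh (x.proj_incl.trans (h0 b).symm), transport_self]
  right_inv q := by
    have e1 : F.proj q = h (F.proj q, 0) := (h0 _).symm
    have e2 : F.proj (transport hA (F.proj q) 0 1 q) = h (b, 1) := by
      rw [proj_transport e1, h1, h1]
    rw [trivialization]
    simp only
    rw [transport_transport hh e2, transport_self, transport_transport hh e1, transport_self]
  contMDiff_toFun := contMDiff_trivialization h0 h1 hh
  contMDiff_invFun := by
    refine ContMDiff.prodMk (fun q => SmoothFamily.Fiber.contMDiffAt_of_incl ?_) F.smooth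
    refine contMDiffAt_transport hh contMDiffAt_const contMDiffAt_const contMDiffAt_const
      (contMDiffAt_transport hh F.smooth.contMDiffAt contMDiffAt_const contMDiffAt_const
        contMDiffAt_id (Filter.Eventually.of_forall fun q => (h0 _).symm))
      (Filter.Eventually.of_forall fun q => ?_)
    rw [proj_transport (h0 _).symm, h1, h1]

/-- Transport paths that meet the support of a function with proper support over a compact set of
parameters start in a compact set. -/
theorem exists_isCompact_of_transport_ne_zero {g : N → B × ℝ → ℝ} (hg : HasProperSupport F h g)
    {K : Set B} (hK : IsCompact K) :
    ∃ D : Set (F.Fiber b), IsCompact D ∧ ∀ x, ∀ t ∈ K, ∀ u ∈ Icc (0 : ℝ) 1,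
      g (transport hA t 1 u (transport hA b 0 1 x.incl)) (t, u) ≠ 0 → x ∈ D := by
  obtain ⟨C, hC, H⟩ := hg.exists_isCompact ((hK.prod (isCompact_Icc (a := (0 : ℝ)) (b := 1))).image
    hh.continuous)
  set X : Set (N × (B × ℝ)) := C ×ˢ (K ×ˢ Icc (0 : ℝ) 1) ∩ {z | F.proj z.1 = h z.2} with hX
  have hXc : IsCompact X := (hC.prod (hK.prod isCompact_Icc)).inter_right
    (isClosed_eq (F.smooth.continuous.comp continuous_fst) (hh.continuous.comp continuous_snd))
  have hcont : ContinuousOn (fun z : N × (B × ℝ) =>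
      transport hA b 1 0 (transport hA z.2.1 z.2.2 1 z.1)) X := by
    refine (continuousOn_transport (hA := hA) hh 0).comp
      (f := fun z : N × (B × ℝ) => (transport hA z.2.1 z.2.2 1 z.1, (b, (1 : ℝ))))
      (((continuousOn_transport (hA := hA) hh 1).mono inter_subset_right).prodMk
        continuousOn_const) fun z hz => ?_
    change F.proj (transport hA z.2.1 z.2.2 1 z.1) = h (b, 1)
    rw [proj_transport hz.2, h1, h1]
  refine ⟨SmoothFamily.Fiber.incl ⁻¹' _, (SmoothFamily.Fiber.isClosedEmbedding_incl F
    b).isCompact_preimage (hXc.image_of_continuousOn hcont), fun x t ht u hu hne => ?_⟩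
  have hy := proj_transport_incl (hA := hA) h0 h1 x t
  refine ⟨(transport hA t 1 u (transport hA b 0 1 x.incl), (t, u)),
    ⟨⟨H _ _ (proj_transport hy u) ⟨(t, u), ⟨ht, hu⟩, rfl⟩ hne, ht, hu⟩, proj_transport hy u⟩, ?_⟩
  simp only
  rw [transport_transport hh hy, transport_self,
    transport_transport hh (x.proj_incl.trans (h0 b).symm), transport_self]

end Trivialization

end LiouvilleFamily

end

open LiouvilleFamily in
theorem mainTheorem12 {E EB HB EN HN B N : Type*}
    [NormedAddCommGroup E] [NormedSpace ℝ E] [FiniteDimensional ℝ E]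
    [NormedAddCommGroup EB] [NormedSpace ℝ EB] [FiniteDimensional ℝ EB] [TopologicalSpace HB]
    [NormedAddCommGroup EN] [NormedSpace ℝ EN] [FiniteDimensional ℝ EN] [TopologicalSpace HN]
    (I : ModelWithCorners ℝ EB HB) (J : ModelWithCorners ℝ EN HN)
    [TopologicalSpace B] [ChartedSpace HB B] [IsManifold I ∞ B]
    [T2Space B] [SecondCountableTopology B]
    [TopologicalSpace N] [ChartedSpace HN N] [IsManifold J ∞ N]
    [T2Space N] [SecondCountableTopology N]
    (F : LiouvilleFamily.SmoothFamily E I J N B) (θ : F.OneForms)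
    (hθ : F.IsLiouvilleFamily θ) (hdom : F.LocallyHasGeneratingDomains θ)
    (hB : LiouvilleFamily.SmoothlyContractible I B) (b : B) :
    ∃ (ψ : Diffeomorph (𝓘(ℝ, E).prod I) J (F.Fiber b × B) N ∞)
      (hψ : ∀ x t, F.proj (ψ (x, t)) = t) (f : F.Fiber b × B → ℝ),
      (∀ x, ψ (x, b) = x.incl) ∧
      ContMDiff (𝓘(ℝ, E).prod I) 𝓘(ℝ, ℝ) ∞ f ∧
      (∀ x, f (x, b) = 0) ∧
      (∃ L : Set (F.Fiber b × B),
        Function.support f ⊆ L ∧ LiouvilleFamily.ProperOver Prod.snd L univ) ∧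
      ∀ t : B,
        LiouvilleFamily.OneForm.pullback (F.fiberMap ψ hψ t) (θ t) +
          LiouvilleFamily.OneForm.ofFun E (fun x => f (x, t)) = θ b := by
  have := F.locallyCompact_base
  have := F.locallyCompact_total
  obtain ⟨a, h, hh, h0, h1⟩ := hB.exists_contMDiff
  obtain ⟨ρ, hρ⟩ : ∃ ρ : SmoothPartitionOfUnity N J N,
      ρ.IsSubordinate fun j => (F.chartOf j).toHomeo.source :=
    SmoothPartitionOfUnity.exists_isSubordinate J isClosed_univ _
      (fun j => (F.chartOf j).toHomeo.open_source)
      fun q _ => mem_iUnion.2 ⟨q, mem_chartOf q⟩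
  obtain ⟨κ, hκ, hsupp⟩ := exists_hasProperSupport_energy (ρ := ρ) hθ hdom hh hρ
  have hA : (kernelLift hθ hh hρ hκ).IsComplete := fun p q s₀ hq =>
    exists_integralCurve_kernelLift hθ hdom hh hρ hκ hsupp hq
  -- the path over `t` which starts from the image of `x` in the fibre over `a`, and its energy
  set m : B → F.Fiber b × ℝ → N := fun t z =>
    transport hA t 1 z.2 (transport hA b 0 1 z.1.incl) with hm
  set e : F.Fiber b → B → ℝ → ℝ := fun x t u => energy ρ θ h κ (m t (x, u)) (t, u) with he
  set f' : F.Fiber b × B → ℝ := fun z => ∫ u in (0 : ℝ)..1, e z.1 z.2 u with hf'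
  have hpr : ∀ (x : F.Fiber b) t, F.proj (transport hA b 0 1 x.incl) = h (t, 1) :=
    fun x t => proj_transport_incl h0 h1 x t
  have hsm := contMDiff_transport_incl (hA := hA) (b := b) h0 h1 hh
  have hesm := isSmoothOnPullback_energy hθ hh hρ hκ
  have hf's : ContMDiff (𝓘(ℝ, E).prod I) 𝓘(ℝ, ℝ) ∞ f' := by
    have h2 : ContMDiff (𝓘(ℝ, E).prod I) 𝓘(ℝ, ℝ) ∞
        fun z : F.Fiber b × B => ∫ u in (1 : ℝ)..0, e z.1 z.2 u := fun z =>
      contMDiffAt_integral_transport (A := kernelLift hθ hh hρ hκ) (hA := hA)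
        (m := fun z : F.Fiber b × B => transport hA b 0 1 z.1.incl) hh hesm
        contMDiffAt_snd contMDiffAt_const contMDiffAt_const (hsm.comp contMDiff_fst).contMDiffAt
        (Filter.Eventually.of_forall fun z => hpr z.1 z.2)
    have h3 : f' = fun z => -∫ u in (1 : ℝ)..0, e z.1 z.2 u :=
      funext fun z => intervalIntegral.integral_symm _ _
    rw [h3]
    exact h2.neg
  have hint : ∀ t x s, IsIntegralAt (kernelLift hθ hh hρ hκ) t (fun s => m t (x, s)) s :=
    fun t x s => isIntegralAt_transport (hpr x t) s
  have hms : ∀ t, ContMDiff (𝓘(ℝ, E).prod 𝓘(ℝ, ℝ)) J ∞ (m t) := fun t z =>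
    contMDiffAt_transport (hA := hA) hh contMDiffAt_const contMDiffAt_const contMDiffAt_snd
      (hsm.comp contMDiff_fst).contMDiffAt (Filter.Eventually.of_forall fun z => hpr z.1 t)
  have hGs : ∀ t, ContMDiff (𝓘(ℝ, E).prod 𝓘(ℝ, ℝ)) 𝓘(ℝ, ℝ) ∞
      fun z : F.Fiber b × ℝ => ∫ u in (1 : ℝ)..z.2, e z.1 t u := fun t z =>
    contMDiffAt_integral_transport (A := kernelLift hθ hh hρ hκ) (hA := hA)
      (m := fun z : F.Fiber b × ℝ => transport hA b 0 1 z.1.incl) hh hesm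
      contMDiffAt_const contMDiffAt_const contMDiffAt_snd (hsm.comp contMDiff_fst).contMDiffAt
      (Filter.Eventually.of_forall fun z => hpr z.1 t)
  have hm1 : ∀ t x, m t (x, 1) = transport hA b 0 1 x.incl := fun t x => transport_self
  have hproj1 : ∀ t x, F.proj (m t (x, 1)) = a := fun t x => by rw [hm1, hpr x t, h1]
  have hpull : ∀ t, OneForm.pullback (E' := E)
        (fun x => (⟨trivialization hA b (x, t), proj_trivialization h0 h1 x t⟩ : F.Fiber t)) (θ t) +
      OneForm.ofFun E (fun x => f' (x, t)) =
      OneForm.pullback (E' := E) (fun x : F.Fiber b => (⟨transport hA b 0 1 x.incl,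
        (hpr x b).trans (h1 b)⟩ : F.Fiber a)) (θ a) := by
    intro t
    have h2 := pullback_add_ofFun hθ hh hρ hκ (hms t) (hint t) (hGs t) (h0 t) (h1 t)
      (fun x => proj_trivialization h0 h1 x t) (hproj1 t)
    have h3 : (fun x => (⟨m t (x, 1), hproj1 t x⟩ : F.Fiber a)) = fun x : F.Fiber b =>
        (⟨transport hA b 0 1 x.incl, (hpr x b).trans (h1 b)⟩ : F.Fiber a) :=
      funext fun x => SmoothFamily.Fiber.ext (hm1 t x)
    rw [h3] at h2
    exact h2
  refine ⟨trivializationDiffeomorph h0 h1 hh hA b, fun x t => proj_trivialization h0 h1 x t,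
    fun z => f' z - f' (z.1, b), fun x => trivialization_self h0 h1 hh x,
    hf's.sub (hf's.comp (contMDiff_fst.prodMk contMDiff_const)), fun x => sub_self _,
    ⟨closure (Function.support fun z => f' z - f' (z.1, b)), subset_closure,
      fun _ _ => mem_univ _, fun K _ hK => ?_⟩, fun t => ?_⟩
  · obtain ⟨K', hK', hKK'⟩ := exists_compact_superset hK
    obtain ⟨D, hD, H⟩ := exists_isCompact_of_transport_ne_zero (hA := hA) (b := b) h0 h1 hh hsupp
      (hK'.insert b)
    have hzero : ∀ x ∉ D, ∀ t ∈ insert b K', f' (x, t) = 0 := by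
      intro x hx t ht
      have h2 : EqOn (e x t) (fun _ => 0) (uIcc (0 : ℝ) 1) := fun u hu => by
        rw [uIcc_of_le zero_le_one] at hu
        by_contra hne
        exact hx (H x t ht u hu hne)
      exact (intervalIntegral.integral_congr h2).trans (by simp)
    have : T2Space (F.Fiber b) := SmoothFamily.Fiber.t2Space
    refine (hD.prod hK).of_isClosed_subset
      (isClosed_closure.inter (hK.isClosed.preimage continuous_snd)) ?_
    rintro ⟨x, t⟩ ⟨hcl, ht⟩
    refine ⟨by_contra fun hx => ?_, ht⟩
    obtain ⟨⟨x', t'⟩, ⟨hx', ht'⟩, hne⟩ := mem_closure_iff.1 hcl (Dᶜ ×ˢ interior K')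
      (hD.isClosed.isOpen_compl.prod isOpen_interior) ⟨hx, hKK' ht⟩
    refine hne ?_
    simp only [hzero x' hx' t' (mem_insert_of_mem _ (interior_subset ht')),
      hzero x' hx' b (mem_insert _ _), sub_self]
  · have hd : ∀ t, MDifferentiable 𝓘(ℝ, E) 𝓘(ℝ, ℝ) fun x => f' (x, t) := fun t =>
      (hf's.comp (contMDiff_id.prodMk contMDiff_const)).mdifferentiable (by simp)
    have hb : OneForm.pullback (E' := E) (fun x =>
        (⟨trivialization hA b (x, b), proj_trivialization h0 h1 x b⟩ : F.Fiber b)) (θ b) = θ b := by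
      have h2 : (fun x => (⟨trivialization hA b (x, b), proj_trivialization h0 h1 x b⟩ :
          F.Fiber b)) = id :=
        funext fun x => SmoothFamily.Fiber.ext (trivialization_self h0 h1 hh x)
      rw [h2]
      funext x
      rw [OneForm.pullback, mfderiv_id]
      rfl
    have hsub : OneForm.ofFun E (fun x => f' (x, t) - f' (x, b)) =
        OneForm.ofFun E (fun x => f' (x, t)) - OneForm.ofFun E (fun x => f' (x, b)) :=
      funext fun x => ((hd t x).hasMFDerivAt.sub (hd b x).hasMFDerivAt).mfderiv
    have h2 := (hpull t).trans (hpull b).symm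
    rw [hb] at h2
    refine Eq.trans ?_ (sub_eq_of_eq_add h2)
    exact (congrArg _ hsub).trans (add_sub_assoc _ _ _).symm
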